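/- **Theorem.** Let $\omega\neq 0$ and $a\ne 0$ be real, put $b=a/\omega$, $\beta=1/(2a)$, $A=\begin{pmatrix} a & a/\omega\\ -\omega/(2a) & 1/(2a)\end{pmatrix}\in SL_2(\mathbb R)$, and let $c\in\mathbb C$ with $|c|=(2\pi|b|)^{-1/2}$. Let $W_A=M_2\mathcal F M_1$ be the unitary operator on $L^2(\mathbb R)$ where $M_1$, $M_2$ are the multiplications by $e^{iax^2/(2b)}$, $e^{i\beta u^2/(2b)}$ and $\mathcal F$ is the unitary extension of $f\mapsto c\int_{\mathbb R}e^{-iux/b}f(x)\,dx$. Let $U_{\exp}:L^2(\mathbb R)\to L^2(\mathbb R_{+1}\amalg\mathbb R_{-1})$ ($L^2$ of two disjoint copies of $\mathbb R$) be the unitary operator $(U_{\exp}f)(t,\pm1)=\sqrt{e^{t}}\,f(\pm e^{t})$. Let $$D=W_A^{-1}U_{\exp}^{-1}\bigl(\mathcal S(\mathbb R_{+1})\amalg\mathcal S(\mathbb R_{-1})\bigr)\subset L^2(\mathbb R),$$ where $\mathcal S(\mathbb R_{+1})\amalg\mathcal S(\mathbb R_{-1})$ is the space of pairs of Schwartz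 functions, and give $D$ the topology transported from this space. For a continuous linear operator $H$ on $D$, a *generalized eigenvector* of $H$ with eigenvalue $\lambda\in\mathbb C$ is a nonzero continuous linear functional $F$ on $D$ with $F(H\varphi)=\lambda F(\varphi)$ for all $\varphi\in D$; the *generalized spectrum* is the set of all such $\lambda$. Then: 1. $(W_Af)(u)=\int_{\mathbb R} c\,\exp\!\bigl[\tfrac{i}{2b}(ax^2-2ux+\beta u^2)\bigr]f(x)\,dx$ for almost every $u$, for all $f\in L^1(\mathbb R)\cap L^2(\mathbb R)$; $(U_{\exp}f)(t,\pm1)=\sqrt{e^t}f(\pm e^t)$ almost everywhere for all $f\in L^2(\mathbb R)$; and $D$ is dense in $L^2(\mathbb R)$. 2. The inverted oscillator $-\frac{d^2}{dx^2}-\omega^2x^2$ (in the sense of distributions) maps $D$ into $D$ and defines a continuous linear operator $H:D\to D$; moreover $U_{\exp}W_A\,H=2\omega\bigl(-i\tfrac{d}{dt}\bigr)U_{\exp}W_A$ on $D$. 3. The generalized spectrum of $H$ equals $\mathbb R$. 4. Let $\lambda\in\mathbb R$, $\alpha\in\{\omega,-\omega\}$, $\nu=\frac{\lambda}{4i\alpha}$,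 and let $$\psi_P(x)=e^{i\alpha x^2/2}\,{}_1F_1\!\left(\nu+\tfrac14;\tfrac12;-i\alpha x^2\right),\qquad \psi_N(x)=e^{i\alpha x^2/2}\,x\,{}_1F_1\!\left(\nu+\tfrac34;\tfrac32;-i\alpha x^2\right)$$ be the even and odd Kummer solutions, where ${}_1F_1(p;q;z)=\sum_{n\ge0}\frac{(p)_n z^n}{(q)_n n!}$ and $(p)_n=p(p+1)\cdots(p+n-1)$. Then $\varphi\psi_P$ and $\varphi\psi_N$ are integrable for every $\varphi\in D$. The generalized eigenvectors of $H$ with eigenvalue $\lambda$ are exactly the functionals $$F(\varphi)=\int_{\mathbb R}\varphi(x)\bigl(p\,\psi_P(x)+q\,\psi_N(x)\bigr)\,dx,\qquad (p,q)\in\mathbb C^2\setminus\{0\},$$ and each of them determines $(p,q)$ uniquely. -/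

import Mathlib

open MeasureTheory SchwartzMap
open scoped ENNReal

namespace InvertedOscillator

noncomputable section

/-! ### Weighted composition operators between `L²` spaces -/

/-- Data for the unitary operator `f ↦ w · (f ∘ e)` from `L²(Y, ν)` to `L²(X, μ)`: the last field is
the change of variables formula `∫ |w|² (g ∘ e) dμ = ∫ g dν`. -/
structure WeightedChange {X Y : Type} [MeasurableSpace X] [MeasurableSpace Y]
    (μ : Measure X) (ν : Measure Y) (e : X → Y) (w : X → ℂ) : Prop where
  meas_e : Measurable e
  meas_w : Measurable w
  w_ne : ∀ x, w x ≠ 0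
  left_inv : ∃ e' : Y → X, Measurable e' ∧ ∀ x, e' (e x) = x
  change : ∀ g : Y → ℝ≥0∞, Measurable g →
    ∫⁻ x, ‖w x‖ₑ ^ 2 * g (e x) ∂μ = ∫⁻ y, g y ∂ν

section WeightedComp

variable {X Y : Type} [MeasurableSpace X] [MeasurableSpace Y]
  {μ : Measure X} {ν : Measure Y} {e : X → Y} {w : X → ℂ}

theorem WeightedChange.qmp (h : WeightedChange μ ν e w) : Measure.QuasiMeasurePreserving e μ ν := by
  refine ⟨h.meas_e, Measure.AbsolutelyContinuous.mk fun s hs hs0 => ?_⟩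
  rw [Measure.map_apply h.meas_e hs]
  have h1 := h.change (s.indicator 1) (measurable_one.indicator hs)
  have hm : Measurable fun x => ‖w x‖ₑ ^ 2 * s.indicator (1 : Y → ℝ≥0∞) (e x) :=
    (h.meas_w.enorm.pow_const 2).mul ((measurable_one.indicator hs).comp h.meas_e)
  rw [lintegral_indicator_one hs, hs0, lintegral_eq_zero_iff hm] at h1
  refine measure_mono_null ?_ (ae_iff.mp h1)
  intro x hx
  have hx' : e x ∈ s := hx
  simp [hx', h.w_ne x]

theorem WeightedChange.eLpNorm_eq (h : WeightedChange μ ν e w) {f : Y → ℂ}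
    (hf : AEStronglyMeasurable f ν) :
    eLpNorm (fun x => w x * f (e x)) 2 μ = eLpNorm f 2 ν := by
  have key : eLpNorm (fun x => w x * (hf.mk f) (e x)) 2 μ = eLpNorm (hf.mk f) 2 ν := by
    rw [eLpNorm_eq_lintegral_rpow_enorm_toReal two_ne_zero ENNReal.ofNat_ne_top,
      eLpNorm_eq_lintegral_rpow_enorm_toReal two_ne_zero ENNReal.ofNat_ne_top]
    congr 1
    have h1 := h.change (fun y => ‖hf.mk f y‖ₑ ^ 2)
      (hf.stronglyMeasurable_mk.measurable.enorm.pow_const 2)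
    simpa [enorm_mul, mul_pow] using h1
  rw [eLpNorm_congr_ae hf.ae_eq_mk, ← key]
  refine eLpNorm_congr_ae ?_
  filter_upwards [h.qmp.ae_eq_comp hf.ae_eq_mk] with x hx
  simp only [Function.comp_apply] at hx
  rw [hx]

theorem WeightedChange.memLp (h : WeightedChange μ ν e w) {f : Y → ℂ} (hf : MemLp f 2 ν) :
    MemLp (fun x => w x * f (e x)) 2 μ :=
  ⟨h.meas_w.aestronglyMeasurable.mul (hf.1.comp_quasiMeasurePreserving h.qmp), by
    rw [h.eLpNorm_eq hf.1]; exact hf.2⟩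

/-- The isometry `f ↦ w · (f ∘ e)`. -/
def WeightedChange.toIsometry (h : WeightedChange μ ν e w) : Lp ℂ 2 ν →ₗᵢ[ℂ] Lp ℂ 2 μ where
  toFun f := (h.memLp (Lp.memLp f)).toLp
  map_add' f g := by
    rw [← MemLp.toLp_add, MemLp.toLp_eq_toLp_iff]
    filter_upwards [h.qmp.ae_eq_comp (Lp.coeFn_add f g)] with x hx
    simp only [Function.comp_apply, Pi.add_apply] at hx
    simp only [Pi.add_apply]
    rw [← mul_add, ← hx]
  map_smul' k f := by
    rw [RingHom.id_apply, ← MemLp.toLp_const_smul, MemLp.toLp_eq_toLp_iff]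
    filter_upwards [h.qmp.ae_eq_comp (Lp.coeFn_smul k f)] with x hx
    simp only [Function.comp_apply, Pi.smul_apply, smul_eq_mul] at hx
    simp only [hx, Pi.smul_apply, smul_eq_mul]
    ring
  norm_map' f := by
    change ‖(h.memLp (Lp.memLp f)).toLp‖ = ‖f‖
    rw [Lp.norm_toLp, h.eLpNorm_eq (Lp.memLp f).1, Lp.norm_def]

theorem WeightedChange.surjective (h : WeightedChange μ ν e w) :
    Function.Surjective h.toIsometry := by
  intro g
  obtain ⟨e', he', hl⟩ := h.left_inv
  set f : Y → ℂ := fun y => (w (e' y))⁻¹ * g (e' y) with hfdef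
  have hg : StronglyMeasurable (g : X → ℂ) := Lp.stronglyMeasurable g
  have hf : Measurable f := ((h.meas_w.comp he').inv).mul (hg.measurable.comp he')
  have hfe : (fun x => w x * f (e x)) = g := by
    funext x
    simp [hfdef, hl, h.w_ne x]
  have hfm : MemLp f 2 ν :=
    ⟨hf.aestronglyMeasurable, by
      rw [← h.eLpNorm_eq hf.aestronglyMeasurable, hfe]; exact (Lp.memLp g).2⟩
  refine ⟨hfm.toLp, ?_⟩
  change (h.memLp (Lp.memLp hfm.toLp)).toLp = g
  apply Lp.ext
  filter_upwards [(h.memLp (Lp.memLp hfm.toLp)).coeFn_toLp,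
    h.qmp.ae_eq_comp hfm.coeFn_toLp] with x hx hx2
  simp only [Function.comp_apply] at hx2
  rw [hx, hx2]
  exact congrFun hfe x

/-- The unitary operator `f ↦ w · (f ∘ e)`. -/
def WeightedChange.unitary (h : WeightedChange μ ν e w) : Lp ℂ 2 ν ≃ₗᵢ[ℂ] Lp ℂ 2 μ :=
  LinearIsometryEquiv.ofSurjective h.toIsometry h.surjective

end WeightedComp

/-! ### The Hilbert spaces -/

/-- `L²(ℝ)`. -/
abbrev L2R : Type := Lp ℂ 2 (volume : Measure ℝ)

/-- Lebesgue measure on the disjoint union of two copies of `ℝ`; the left copy is `ℝ₊₁` and the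
right copy is `ℝ₋₁`. -/
def twoLines : Measure (ℝ ⊕ ℝ) :=
  (volume : Measure ℝ).map Sum.inl + (volume : Measure ℝ).map Sum.inr

/-- `L²(ℝ₊₁ ⨿ ℝ₋₁)`. -/
abbrev L2RR : Type := Lp ℂ 2 twoLines

/-! ### The operator `W_A` -/

theorem chirp_change (k : ℝ) :
    WeightedChange (volume : Measure ℝ) (volume : Measure ℝ) (fun x => x)
      (fun x => Complex.exp (Complex.I * k * x ^ 2)) where
  meas_e := measurable_id
  meas_w := by fun_prop
  w_ne x := Complex.exp_ne_zero _
  left_inv := ⟨fun x => x, measurable_id, fun _ => rfl⟩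
  change g _ := by
    refine lintegral_congr fun x => ?_
    have h1 : Complex.I * k * (x : ℂ) ^ 2 = ((k * x ^ 2 : ℝ) : ℂ) * Complex.I := by
      push_cast; ring
    have h2 : ‖Complex.exp (Complex.I * k * (x : ℂ) ^ 2)‖ₑ = 1 := by
      rw [← ofReal_norm, h1, Complex.norm_exp_ofReal_mul_I, ENNReal.ofReal_one]
    rw [h2, one_pow, one_mul]

theorem dilation_change (b k : ℝ) (hb : b ≠ 0) (c : ℂ)
    (hc : ‖c‖ = Real.sqrt (1 / (2 * Real.pi * |b|))) :
    WeightedChange (volume : Measure ℝ) (volume : Measure ℝ)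
      (fun u => (2 * Real.pi * b)⁻¹ * u)
      (fun u => c * Complex.exp (Complex.I * k * u ^ 2)) where
  meas_e := by fun_prop
  meas_w := by fun_prop
  w_ne u := by
    refine mul_ne_zero ?_ (Complex.exp_ne_zero _)
    rw [← norm_pos_iff, hc]
    have := abs_pos.mpr hb
    have := Real.pi_pos
    positivity
  left_inv := ⟨fun y => (2 * Real.pi * b) * y, by fun_prop, fun u => by
    have := Real.pi_ne_zero
    field_simp⟩
  change g hg := by
    have hpi := Real.pi_pos
    have hb' := abs_pos.mpr hb
    have hs : (2 * Real.pi * b)⁻¹ ≠ 0 := inv_ne_zero (by positivity)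
    have h2 : ∀ u : ℝ, ‖c * Complex.exp (Complex.I * k * (u : ℂ) ^ 2)‖ₑ ^ 2
        = ENNReal.ofReal |(2 * Real.pi * b)⁻¹| := by
      intro u
      have h1 : Complex.I * k * (u : ℂ) ^ 2 = ((k * u ^ 2 : ℝ) : ℂ) * Complex.I := by
        push_cast; ring
      rw [← ofReal_norm, ← ENNReal.ofReal_pow (norm_nonneg _), norm_mul, h1,
        Complex.norm_exp_ofReal_mul_I, mul_one, hc, Real.sq_sqrt (by positivity),
        abs_inv, abs_mul, abs_of_pos (by positivity : 0 < 2 * Real.pi), one_div]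
    simp_rw [h2]
    have hm : Measurable fun u : ℝ => g ((2 * Real.pi * b)⁻¹ * u) :=
      hg.comp (measurable_const_mul _)
    rw [lintegral_const_mul _ hm]
    conv_rhs => rw [← Real.smul_map_volume_mul_left hs]
    rw [lintegral_smul_measure, lintegral_map hg (measurable_const_mul _), smul_eq_mul]

/-- For `A = [[a, b], [α, β]]` with `b ≠ 0` and `|c| = (2π|b|)^(-1/2)`, the unitary operator
`W_A = M₂ ∘ F ∘ M₁` on `L²(ℝ)`, where
`(M₁ f)(x) = exp(i a x² / (2b)) f(x)`, `(F f)(u) = c ∫ exp(-i u x / b) f(x) dx` and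
`(M₂ f)(u) = exp(i β u² / (2b)) f(u)`; that is, the integral operator with kernel
`c exp((i / (2b)) (a x² - 2 u x + β u²))`.
In the code `F` is the unitary Fourier transform of `L²(ℝ)`, with kernel `exp(-2π i x ξ)`, followed
by the substitution `ξ = u / (2π b)` and multiplication by `c`. -/
def opW (A : Matrix.SpecialLinearGroup (Fin 2) ℝ) (hb : A 0 1 ≠ 0) (c : ℂ)
    (hc : ‖c‖ = Real.sqrt (1 / (2 * Real.pi * |A 0 1|))) : L2R ≃ₗᵢ[ℂ] L2R :=
  ((chirp_change (A 0 0 / (2 * A 0 1))).unitary.trans (Lp.fourierTransformₗᵢ ℝ ℂ)).trans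
    (dilation_change (A 0 1) (A 1 1 / (2 * A 0 1)) hb c hc).unitary

/-- The matrix `[[a, a/ω], [-ω/(2a), 1/(2a)]]`, for which
`ω (û p̂_u + p̂_u û) = p̂² - ω² x̂²` with `û = a x̂ + (a/ω) p̂` and
`p̂_u = -(ω/(2a)) x̂ + (1/(2a)) p̂`. -/
def oscMatrix (ω a : ℝ) (hω : ω ≠ 0) (ha : a ≠ 0) : Matrix.SpecialLinearGroup (Fin 2) ℝ :=
  ⟨!![a, a / ω; -ω / (2 * a), 1 / (2 * a)], by
    rw [Matrix.det_fin_two_of]; field_simp; norm_num⟩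

theorem oscMatrix_ne (ω a : ℝ) (hω : ω ≠ 0) (ha : a ≠ 0) : oscMatrix ω a hω ha 0 1 ≠ 0 := by
  simpa [oscMatrix] using And.intro ha hω

/-! ### The operator `U_exp` -/

/-- `t ↦ e^t` on `ℝ₊₁` and `t ↦ -e^t` on `ℝ₋₁`. -/
def signedExp : ℝ ⊕ ℝ → ℝ := Sum.elim Real.exp (fun t => -Real.exp t)

/-- `t ↦ √(e^t)` on both copies of `ℝ`. -/
def expWeight : ℝ ⊕ ℝ → ℝ :=
  Sum.elim (fun t => Real.sqrt (Real.exp t)) (fun t => Real.sqrt (Real.exp t))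

theorem lintegral_twoLines {g : ℝ ⊕ ℝ → ℝ≥0∞} (hg : Measurable g) :
    ∫⁻ y, g y ∂twoLines = (∫⁻ t, g (Sum.inl t)) + ∫⁻ t, g (Sum.inr t) := by
  rw [twoLines, lintegral_add_measure, lintegral_map hg measurable_inl,
    lintegral_map hg measurable_inr]

theorem exp_change :
    WeightedChange twoLines (volume : Measure ℝ) signedExp (fun y => (expWeight y : ℂ)) where
  meas_e := Measurable.sumElim (by fun_prop) (by fun_prop)
  meas_w := Complex.measurable_ofReal.comp (Measurable.sumElim (by fun_prop) (by fun_prop))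
  w_ne y := by
    rcases y with t | t <;> simp [expWeight, Real.sqrt_ne_zero', Real.exp_pos]
  left_inv := by
    refine ⟨fun x => if 0 < x then Sum.inl (Real.log x) else Sum.inr (Real.log (-x)), ?_, ?_⟩
    · exact Measurable.ite measurableSet_Ioi (measurable_inl.comp Real.measurable_log)
        (measurable_inr.comp (Real.measurable_log.comp measurable_neg))
    · rintro (t | t)
      · simp [signedExp, Real.exp_pos]
      · simp [signedExp, (Real.exp_pos t).le, not_lt]
  change g hg := by
    have hw : Measurable expWeight := Measurable.sumElim (by fun_prop) (by fun_prop)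
    have he : Measurable signedExp := Measurable.sumElim (by fun_prop) (by fun_prop)
    have hm : Measurable fun y => ‖(expWeight y : ℂ)‖ₑ ^ 2 * g (signedExp y) :=
      (((Complex.measurable_ofReal.comp hw).enorm).pow_const 2).mul (hg.comp he)
    rw [lintegral_twoLines hm]
    have hn : ∀ t : ℝ, ‖((Real.sqrt (Real.exp t) : ℝ) : ℂ)‖ₑ ^ 2 = ENNReal.ofReal (Real.exp t) := by
      intro t
      rw [← ofReal_norm, ← ENNReal.ofReal_pow (norm_nonneg _), Complex.norm_real,
        Real.norm_eq_abs, sq_abs, Real.sq_sqrt (Real.exp_pos t).le]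
    have h1 : ∫⁻ x in Set.Ioi (0 : ℝ), g x
        = ∫⁻ t, ENNReal.ofReal (Real.exp t) * g (Real.exp t) := by
      have := lintegral_image_eq_lintegral_abs_deriv_mul (s := Set.univ) (f := Real.exp)
        (f' := Real.exp) MeasurableSet.univ
        (fun x _ => (Real.hasDerivAt_exp x).hasDerivWithinAt) Real.exp_injective.injOn g
      simpa [Set.image_univ, Real.range_exp, abs_of_pos (Real.exp_pos _)] using this
    have h2 : ∫⁻ x in Set.Iio (0 : ℝ), g x
        = ∫⁻ t, ENNReal.ofReal (Real.exp t) * g (-Real.exp t) := by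
      have := lintegral_image_eq_lintegral_abs_deriv_mul (s := Set.univ)
        (f := fun t => -Real.exp t) (f' := fun t => -Real.exp t) MeasurableSet.univ
        (fun x _ => (Real.hasDerivAt_exp x).neg.hasDerivWithinAt)
        (fun x _ y _ hxy => Real.exp_injective (neg_injective hxy)) g
      have hr : Set.range (fun t : ℝ => -Real.exp t) = Set.Iio 0 := by
        rw [show (fun t : ℝ => -Real.exp t) = Neg.neg ∘ Real.exp from rfl, Set.range_comp,
          Real.range_exp]
        simp
      simpa [Set.image_univ, hr, abs_of_pos (Real.exp_pos _)] using this
    simp only [expWeight, signedExp, Sum.elim_inl, Sum.elim_inr, hn]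
    rw [← h1, ← h2, add_comm, ← Measure.restrict_congr_set Iio_ae_eq_Iic.symm,
      ← lintegral_union measurableSet_Ioi (Set.disjoint_left.mpr fun x hx hx' =>
        absurd (Set.mem_Ioi.mp hx') (not_lt.mpr (Set.mem_Iic.mp hx))),
      Set.Iic_union_Ioi, Measure.restrict_univ]

/-- The unitary operator `U_exp : L²(ℝ) → L²(ℝ₊₁ ⨿ ℝ₋₁)`,
`(U_exp f)(t, ±1) = √(e^t) f(± e^t)`. -/
def opU : L2R ≃ₗᵢ[ℂ] L2RR := exp_change.unitary

/-! ### The space of test vectors -/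

theorem memLp_sumElim (g : 𝓢(ℝ, ℂ) × 𝓢(ℝ, ℂ)) : MemLp (Sum.elim g.1 g.2) 2 twoLines := by
  have hm : Measurable (Sum.elim g.1 g.2 : ℝ ⊕ ℝ → ℂ) :=
    g.1.continuous.measurable.sumElim g.2.continuous.measurable
  refine ⟨hm.aestronglyMeasurable, ?_⟩
  have h1 := (g.1.memLp 2 volume).2
  have h2 := (g.2.memLp 2 volume).2
  rw [eLpNorm_lt_top_iff_lintegral_rpow_enorm_lt_top two_ne_zero ENNReal.ofNat_ne_top] at h1 h2 ⊢
  rw [lintegral_twoLines (hm.enorm.pow_const _)]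
  exact ENNReal.add_lt_top.mpr ⟨h1, h2⟩

/-- The inclusion of `𝓢(ℝ₊₁) ⨿ 𝓢(ℝ₋₁)`, that is of pairs of Schwartz functions, into
`L²(ℝ₊₁ ⨿ ℝ₋₁)`. -/
def schwartzIncl : 𝓢(ℝ, ℂ) × 𝓢(ℝ, ℂ) →ₗ[ℂ] L2RR where
  toFun g := (memLp_sumElim g).toLp
  map_add' g h := by
    rw [← MemLp.toLp_add, MemLp.toLp_eq_toLp_iff]
    refine Filter.Eventually.of_forall ?_
    rintro (t | t) <;> simp
  map_smul' k g := by
    rw [RingHom.id_apply, ← MemLp.toLp_const_smul, MemLp.toLp_eq_toLp_iff]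
    refine Filter.Eventually.of_forall ?_
    rintro (t | t) <;> simp

/-- `W⁻¹ U_exp⁻¹` restricted to pairs of Schwartz functions. -/
def schwartzToL2 (W : L2R ≃ₗᵢ[ℂ] L2R) : 𝓢(ℝ, ℂ) × 𝓢(ℝ, ℂ) →ₗ[ℂ] L2R :=
  (W.trans opU).symm.toLinearEquiv.toLinearMap ∘ₗ schwartzIncl

/-- The domain `D = W⁻¹ U_exp⁻¹ (𝓢(ℝ₊₁) ⨿ 𝓢(ℝ₋₁))`. -/
def domain (W : L2R ≃ₗᵢ[ℂ] L2R) : Submodule ℂ L2R := LinearMap.range (schwartzToL2 W)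

/-- The vector space `D`, as a type of its own, to carry the topology of
`𝓢(ℝ₊₁) ⨿ 𝓢(ℝ₋₁)` and not the one of `L²(ℝ)`. -/
def TestSpace (W : L2R ≃ₗᵢ[ℂ] L2R) : Type := domain W

instance (W : L2R ≃ₗᵢ[ℂ] L2R) : AddCommGroup (TestSpace W) :=
  inferInstanceAs (AddCommGroup (domain W))

instance (W : L2R ≃ₗᵢ[ℂ] L2R) : Module ℂ (TestSpace W) :=
  inferInstanceAs (Module ℂ (domain W))

/-- The element of `L²(ℝ)` given by an element of `D`. -/
def TestSpace.toL2 {W : L2R ≃ₗᵢ[ℂ] L2R} : TestSpace W →ₗ[ℂ] L2R := (domain W).subtype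

/-- The linear bijection `W⁻¹ U_exp⁻¹ : 𝓢(ℝ₊₁) ⨿ 𝓢(ℝ₋₁) → D`. -/
def ofSchwartz (W : L2R ≃ₗᵢ[ℂ] L2R) : 𝓢(ℝ, ℂ) × 𝓢(ℝ, ℂ) →ₗ[ℂ] TestSpace W :=
  (schwartzToL2 W).rangeRestrict

theorem ofSchwartz_bijective (W : L2R ≃ₗᵢ[ℂ] L2R) : Function.Bijective (ofSchwartz W) := by
  refine ⟨?_, (schwartzToL2 W).surjective_rangeRestrict⟩
  intro g h hgh
  have h0 : schwartzToL2 W g = schwartzToL2 W h := congrArg Subtype.val hgh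
  have h1 : schwartzIncl g = schwartzIncl h := (W.trans opU).symm.injective h0
  have h2 : (Sum.elim g.1 g.2 : ℝ ⊕ ℝ → ℂ) =ᵐ[twoLines] Sum.elim h.1 h.2 :=
    (MemLp.toLp_eq_toLp_iff (memLp_sumElim g) (memLp_sumElim h)).mp h1
  rw [Filter.EventuallyEq, twoLines, ae_add_measure_iff] at h2
  have h3 := ae_of_ae_map measurable_inl.aemeasurable h2.1
  have h4 := ae_of_ae_map measurable_inr.aemeasurable h2.2
  refine Prod.ext ?_ ?_
  · exact DFunLike.coe_injective
      (Continuous.ae_eq_iff_eq volume g.1.continuous h.1.continuous |>.mp h3)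
  · exact DFunLike.coe_injective
      (Continuous.ae_eq_iff_eq volume g.2.continuous h.2.continuous |>.mp h4)

/-- The topology on `D` transported from `𝓢(ℝ₊₁) ⨿ 𝓢(ℝ₋₁)` by the bijection `ofSchwartz`. -/
instance (W : L2R ≃ₗᵢ[ℂ] L2R) : TopologicalSpace (TestSpace W) :=
  TopologicalSpace.coinduced (ofSchwartz W) inferInstance

/-! ### The inverted oscillator, generalized eigenvectors and the Kummer solutions -/

/-- `-φ'' - ω² x² φ = χ` in the sense of distributions on `ℝ`, for `φ` and `χ` in `L²(ℝ)`. -/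
def IsInvertedOscillator (ω : ℝ) (φ χ : L2R) : Prop :=
  ∀ θ : ℝ → ℂ, ContDiff ℝ (⊤ : ℕ∞) θ → HasCompactSupport θ →
    ∫ x, φ x * (-(deriv (deriv θ) x) - (ω : ℂ) ^ 2 * (x : ℂ) ^ 2 * θ x) = ∫ x, χ x * θ x

/-- `F ∈ Φ'` is a generalized eigenvector of the operator `A` in the linear topological space `Φ`
corresponding to the eigenvalue `z`. -/
def IsGeneralizedEigenvector {Φ : Type} [AddCommGroup Φ] [Module ℂ Φ] [TopologicalSpace Φ]
    (A : Φ →ₗ[ℂ] Φ) (z : ℂ) (F : Φ →L[ℂ] ℂ) : Prop :=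
  F ≠ 0 ∧ ∀ φ, F (A φ) = z * F φ

/-- The generalized spectrum: the set of eigenvalues of all generalized eigenvectors. -/
def generalizedSpectrum {Φ : Type} [AddCommGroup Φ] [Module ℂ Φ] [TopologicalSpace Φ]
    (A : Φ →ₗ[ℂ] Φ) : Set ℂ :=
  {z | ∃ F : Φ →L[ℂ] ℂ, IsGeneralizedEigenvector A z F}

/-- The Kummer function `₁F₁(a; b; z) = ∑ (a)ₙ zⁿ / ((b)ₙ n!)`. -/
def kummer (a b z : ℂ) : ℂ :=
  ∑' n : ℕ, (ascPochhammer ℂ n).eval a * z ^ n / ((ascPochhammer ℂ n).eval b * (n.factorial : ℂ))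

/-- The even solution `exp(i α x² / 2) ₁F₁(ν + 1/4; 1/2; -i α x²)`, `ν = z / (4 i α)`. -/
def psiP (α : ℝ) (z : ℂ) (x : ℝ) : ℂ :=
  Complex.exp (Complex.I * α * x ^ 2 / 2) *
    kummer (z / (4 * Complex.I * α) + 1 / 4) (1 / 2) (-Complex.I * α * x ^ 2)

/-- The odd solution `exp(i α x² / 2) x ₁F₁(ν + 3/4; 3/2; -i α x²)`, `ν = z / (4 i α)`. -/
def psiN (α : ℝ) (z : ℂ) (x : ℝ) : ℂ :=
  Complex.exp (Complex.I * α * x ^ 2 / 2) * (x *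
    kummer (z / (4 * Complex.I * α) + 3 / 4) (3 / 2) (-Complex.I * α * x ^ 2))

end

end InvertedOscillator

/-!
The metaplectic operator `W_A` maps the Schwartz space onto itself and acts linearly on position
and momentum; the matrix `A` is chosen so that it carries the inverted oscillator to the dilation
generator `-iω (2 u d/du + 1)` (`oscW_schwartzOsc`). In the exponential coordinate `u = ± e^t` the
latter is `2ω (-i d/dt)` on two lines. Hence the operator on the test space is `2ω (-i d/dt)` on
pairs of Schwartz functions, transported (`testOp`). Schwartz functions on `ℝ` belong to the test
space, which gives density, and by unitarity and the symmetry of `-i d/dt` they may be moved to the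
other side of an inner product, so the operator is the inverted oscillator in the sense of
distributions (`isInvertedOscillator_testOp`).

The spectrum is that of `d/dt` on tempered distributions. If `T(f') = μ T(f)` and `μ` is not purely
imaginary, then `d/dt - μ` is onto on Schwartz functions and `T = 0`
(`eq_zero_of_deriv_eigenvector`). If `μ = iσ`, then `T` is a multiple of `f ↦ ∫ e^{-iσt} f(t) dt`,
because a Schwartz function of integral zero has a Schwartz primitive
(`exists_eq_mul_fourierFunctional`). With two lines, every real number is an eigenvalue and its
eigenspace has dimension at most two.

It remains to exhibit the two Kummer functionals in the eigenspace.
* Test vectors are integrable against `(1 + |x|)^(-1/2)`, with a continuous bound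
  (`exists_lintegral_weight_le`). Cutting off a pair `g` at `|t| ∼ τ` leaves an `L²` error
  `O(τ⁻²)`, and the remaining part is the image of a Schwartz function `θ` with
  `‖x θ‖ = O(e^{2τ})`, since `x` corresponds to a combination of `u` and `i d/du`. With `τ = k/4`
  this bounds the `L²` norm of a test vector over the shell `|x| ∼ e^k` by `O(k⁻²)`, and the
  Cauchy-Schwarz inequality over the shells concludes.
* Solutions of `ψ'' = -(r + ω² x²) ψ` are `O(|x|^(-1/2))` and their derivatives are
  `O(|x|^(1/2))`, by an energy estimate (`exists_bound_of_ode`); the Kummer solutions solve this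
  equation. So they define continuous functionals (`exists_functional`), and a cutoff argument in
  the distributional equation shows that these are eigenfunctionals (`integral_testOp_mul`).
* Testing against smooth compactly supported functions shows that a combination of the Kummer
  functionals vanishes only if the corresponding combination of functions does
  (`eq_zero_of_integral_eq_zero`); the values and slopes at `0` then exclude all but the trivial
  combination. Two independent functionals in an at most two-dimensional space form a basis.
-/

namespace InvertedOscillator

open FourierTransform

noncomputable section

/-! ### Pointwise formulas for the unitary operators -/

theorem WeightedChange.coeFn_unitary {X Y : Type} [MeasurableSpace X] [MeasurableSpace Y]
    {μ : Measure X} {ν : Measure Y} {e : X → Y} {w : X → ℂ} (h : WeightedChange μ ν e w)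
    (f : Lp ℂ 2 ν) : h.unitary f =ᵐ[μ] fun x => w x * f (e x) :=
  (h.memLp (Lp.memLp f)).coeFn_toLp

theorem coeFn_opU (f : L2R) :
    ∀ᵐ y ∂twoLines, opU f y = (expWeight y : ℂ) * f (signedExp y) :=
  exp_change.coeFn_unitary f

/-- On `L¹ ∩ L²` the Plancherel transform is the Fourier integral: both are the Fourier transform
in the sense of tempered distributions. -/
theorem coeFn_fourier_of_integrable (f : L2R) (hf : Integrable f volume) :
    (𝓕 f : L2R) =ᵐ[volume] 𝓕 (f : ℝ → ℂ) := by
  have hcont : Continuous (𝓕 (f : ℝ → ℂ)) :=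
    VectorFourier.fourierIntegral_continuous Real.continuous_fourierChar
      (by exact continuous_inner) hf
  refine ae_eq_of_integral_contDiff_smul_eq ((Lp.memLp _).locallyIntegrable (by norm_num))
    hcont.locallyIntegrable fun g hg hgs => ?_
  have hgs' : HasCompactSupport (fun x => (g x : ℂ)) :=
    hgs.comp_left (g := fun y : ℝ => (y : ℂ)) Complex.ofReal_zero
  set G : 𝓢(ℝ, ℂ) := hgs'.toSchwartzMap (Complex.ofRealCLM.contDiff.comp hg) with hG
  have hGg : ∀ x, G x = (g x : ℂ) := fun x => rfl
  have h1 : ∫ x, G x • (𝓕 f : L2R) x = ∫ x, (𝓕 G) x • f x := by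
    rw [← Lp.toTemperedDistribution_apply, ← Lp.toTemperedDistribution_apply,
      ← Lp.fourier_toTemperedDistribution_eq, TemperedDistribution.fourier_apply]
  have h2 : ∫ x, (𝓕 (G : ℝ → ℂ)) x • f x = ∫ x, G x • (𝓕 (f : ℝ → ℂ)) x := by
    simpa using! VectorFourier.integral_fourierIntegral_smul_eq_flip (L := innerₗ ℝ)
      Real.continuous_fourierChar continuous_inner G.integrable hf
  calc ∫ x, g x • (𝓕 f : L2R) x = ∫ x, G x • (𝓕 f : L2R) x := by
        refine integral_congr_ae (.of_forall fun x => ?_)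
        simp [hGg]
    _ = ∫ x, G x • (𝓕 (f : ℝ → ℂ)) x := by rw [h1, ← h2, fourier_coe]
    _ = _ := by
        refine integral_congr_ae (.of_forall fun x => ?_)
        simp [hGg]

theorem norm_chirp (k x : ℝ) : ‖Complex.exp (Complex.I * k * (x : ℂ) ^ 2)‖ = 1 := by
  have h1 : Complex.I * k * (x : ℂ) ^ 2 = ((k * x ^ 2 : ℝ) : ℂ) * Complex.I := by
    push_cast; ring
  rw [h1, Complex.norm_exp_ofReal_mul_I]

theorem opW_coeFn (A : Matrix.SpecialLinearGroup (Fin 2) ℝ) (hb : A 0 1 ≠ 0) (c : ℂ)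
    (hc : ‖c‖ = Real.sqrt (1 / (2 * Real.pi * |A 0 1|))) (f : L2R) (hf : Integrable f volume) :
    ∀ᵐ u : ℝ, opW A hb c hc f u = ∫ x : ℝ, c * Complex.exp (Complex.I / (2 * A 0 1) *
        (A 0 0 * x ^ 2 - 2 * u * x + A 1 1 * u ^ 2)) * f x := by
  set g : L2R := (chirp_change (A 0 0 / (2 * A 0 1))).unitary f with hg
  have hgf := (chirp_change (A 0 0 / (2 * A 0 1))).coeFn_unitary f
  have hgi : Integrable g volume := by
    refine Integrable.congr ?_ hgf.symm
    refine hf.bdd_mul (c := 1) (by fun_prop) (.of_forall fun x => ?_)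
    exact (norm_chirp _ x).le
  have h3 := (dilation_change (A 0 1) (A 1 1 / (2 * A 0 1)) hb c hc)
  have h4 := h3.qmp.ae_eq_comp (coeFn_fourier_of_integrable g hgi)
  filter_upwards [h3.coeFn_unitary (𝓕 g), h4] with u hu1 hu2
  simp only [Function.comp_apply] at hu2
  change h3.unitary (𝓕 g) u = _
  rw [hu1, hu2, Real.fourier_eq', ← integral_const_mul]
  refine integral_congr_ae ?_
  filter_upwards [hgf] with x hx
  rw [← hg] at hx
  rw [hx, smul_eq_mul]
  have hb' : (A 0 1 : ℂ) ≠ 0 := by exact_mod_cast hb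
  have hpi : (Real.pi : ℂ) ≠ 0 := by exact_mod_cast Real.pi_ne_zero
  rw [show ∀ p q r s t : ℂ, p * q * (r * (s * t)) = p * (q * r * s) * t by intros; ring,
    ← Complex.exp_add, ← Complex.exp_add]
  congr 3
  simp only [RCLike.inner_apply, conj_trivial]
  push_cast
  field_simp
  ring

/-! ### The metaplectic operator on Schwartz functions -/

theorem hasTemperateGrowth_cexp_mul_I :
    (fun x : ℝ => Complex.exp (x * Complex.I)).HasTemperateGrowth := by
  refine ⟨(Complex.ofRealCLM.contDiff.mul contDiff_const).cexp, fun n => ⟨0, 1, fun x => ?_⟩⟩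
  rw [norm_iteratedFDeriv_eq_norm_iteratedDeriv]
  have : iteratedDeriv n (fun x : ℝ => Complex.exp (x * Complex.I)) =
      fun x : ℝ => Complex.I ^ n * Complex.exp (x * Complex.I) := by
    induction n with
    | zero => simp
    | succ n ih =>
      rw [iteratedDeriv_succ, ih]
      funext x
      have h1 : HasDerivAt (fun x : ℝ => (x : ℂ) * Complex.I) Complex.I x := by
        simpa using (Complex.ofRealCLM.hasDerivAt (x := x)).mul_const Complex.I
      rw [(h1.cexp.const_mul _).deriv]
      ring
  rw [this]
  simp [Complex.norm_exp_ofReal_mul_I]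

theorem hasTemperateGrowth_cexp_linear (k : ℝ) :
    (fun x : ℝ => Complex.exp (Complex.I * k * x)).HasTemperateGrowth := by
  have h : (fun x : ℝ => k * x).HasTemperateGrowth := by fun_prop
  convert! hasTemperateGrowth_cexp_mul_I.comp h using 2 with x
  simp; ring_nf

theorem hasTemperateGrowth_chirp (k : ℝ) :
    (fun x : ℝ => Complex.exp (Complex.I * k * x ^ 2)).HasTemperateGrowth := by
  have h : (fun x : ℝ => k * x ^ 2).HasTemperateGrowth := by fun_prop
  convert! hasTemperateGrowth_cexp_mul_I.comp h using 2 with x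
  simp; ring_nf

/-- Multiplication by the coordinate on Schwartz functions. -/
def mulX : 𝓢(ℝ, ℂ) →L[ℂ] 𝓢(ℝ, ℂ) := smulLeftCLM ℂ (fun x : ℝ => (x : ℂ))

@[simp]
theorem mulX_apply (f : 𝓢(ℝ, ℂ)) (x : ℝ) : mulX f x = x * f x := by
  rw [mulX, smulLeftCLM_apply_apply (by fun_prop), smul_eq_mul]

theorem derivCLM_mulX (f : 𝓢(ℝ, ℂ)) :
    derivCLM ℂ ℂ (mulX f) = f + mulX (derivCLM ℂ ℂ f) := by
  ext x
  have h1 : HasDerivAt (fun x : ℝ => (x : ℂ) * f x) (1 * f x + x * deriv f x) x :=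
    (Complex.ofRealCLM.hasDerivAt (x := x)).mul (f.hasDerivAt x)
  have h2 : (mulX f : ℝ → ℂ) = fun x : ℝ => (x : ℂ) * f x := funext fun x => mulX_apply f x
  simp only [derivCLM_apply, h2, h1.deriv, add_apply, mulX_apply, one_mul]

/-- The substitution `u ↦ r u` in Schwartz functions, for `r ≠ 0`. -/
def dilation (r : ℝ) (hr : r ≠ 0) : 𝓢(ℝ, ℂ) →L[ℂ] 𝓢(ℝ, ℂ) :=
  compCLMOfContinuousLinearEquiv ℂ (ContinuousLinearEquiv.smulLeft (Units.mk0 r hr) : ℝ ≃L[ℝ] ℝ)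

@[simp]
theorem dilation_apply (r : ℝ) (hr : r ≠ 0) (f : 𝓢(ℝ, ℂ)) (x : ℝ) :
    dilation r hr f x = f (r * x) := rfl

theorem two_pi_inv_ne {b : ℝ} (hb : b ≠ 0) : (2 * Real.pi * b)⁻¹ ≠ 0 := by
  have := Real.pi_ne_zero
  positivity

/-- The operator `f ↦ c exp(i l u²) (𝓕 (exp(i k x²) f)) (u / (2π b))` on Schwartz functions. -/
def schwartzW (b k l : ℝ) (hb : b ≠ 0) (c : ℂ) : 𝓢(ℝ, ℂ) →L[ℂ] 𝓢(ℝ, ℂ) :=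
  smulLeftCLM ℂ (fun u : ℝ => c * Complex.exp (Complex.I * l * u ^ 2)) ∘L
    dilation (2 * Real.pi * b)⁻¹ (two_pi_inv_ne hb) ∘L fourierCLM ℂ 𝓢(ℝ, ℂ) ∘L
      smulLeftCLM ℂ (fun x : ℝ => Complex.exp (Complex.I * k * x ^ 2))

theorem schwartzW_apply (b k l : ℝ) (hb : b ≠ 0) (c : ℂ) (f : 𝓢(ℝ, ℂ)) (u : ℝ) :
    schwartzW b k l hb c f u = c * Complex.exp (Complex.I * l * u ^ 2) *
      (𝓕 (smulLeftCLM ℂ (fun x : ℝ => Complex.exp (Complex.I * k * x ^ 2)) f) : 𝓢(ℝ, ℂ))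
        ((2 * Real.pi * b)⁻¹ * u) := by
  have := hasTemperateGrowth_chirp l
  simp only [schwartzW, ContinuousLinearMap.comp_apply]
  rw [smulLeftCLM_apply_apply (by fun_prop), smul_eq_mul, dilation_apply]
  rfl

theorem opW_apply (A : Matrix.SpecialLinearGroup (Fin 2) ℝ) (hb : A 0 1 ≠ 0) (c : ℂ)
    (hc : ‖c‖ = Real.sqrt (1 / (2 * Real.pi * |A 0 1|))) (f : L2R) :
    opW A hb c hc f = (dilation_change (A 0 1) (A 1 1 / (2 * A 0 1)) hb c hc).unitary
      (𝓕 ((chirp_change (A 0 0 / (2 * A 0 1))).unitary f)) := rfl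

theorem chirp_unitary_toLp (k : ℝ) (f : 𝓢(ℝ, ℂ)) :
    (chirp_change k).unitary (f.toLp 2) =
      (smulLeftCLM ℂ (fun x : ℝ => Complex.exp (Complex.I * k * x ^ 2)) f).toLp 2 := by
  set g : 𝓢(ℝ, ℂ) := smulLeftCLM ℂ (fun x : ℝ => Complex.exp (Complex.I * k * x ^ 2)) f with hg
  apply Lp.ext
  filter_upwards [(chirp_change k).coeFn_unitary (f.toLp 2), f.coeFn_toLp 2, g.coeFn_toLp 2]
    with x h1 h2 h3
  rw [h1, h2, h3, hg, smulLeftCLM_apply_apply (hasTemperateGrowth_chirp k), smul_eq_mul]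

theorem opW_toLp (A : Matrix.SpecialLinearGroup (Fin 2) ℝ) (hb : A 0 1 ≠ 0) (c : ℂ)
    (hc : ‖c‖ = Real.sqrt (1 / (2 * Real.pi * |A 0 1|))) (f : 𝓢(ℝ, ℂ)) :
    opW A hb c hc (f.toLp 2) =
      (schwartzW (A 0 1) (A 0 0 / (2 * A 0 1)) (A 1 1 / (2 * A 0 1)) hb c f).toLp 2 := by
  rw [opW_apply, chirp_unitary_toLp, toLp_fourier_eq]
  have h3 := (dilation_change (A 0 1) (A 1 1 / (2 * A 0 1)) hb c hc)
  set g := smulLeftCLM ℂ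
    (fun x : ℝ => Complex.exp (Complex.I * (A 0 0 / (2 * A 0 1) : ℝ) * x ^ 2)) f
  apply Lp.ext
  filter_upwards [h3.coeFn_unitary ((𝓕 g).toLp 2),
    h3.qmp.ae_eq_comp ((𝓕 g).coeFn_toLp 2), (schwartzW _ _ _ hb c f).coeFn_toLp 2]
    with x h4 h5 h6
  simp only [Function.comp_apply] at h5
  rw [h4, h5, h6, schwartzW_apply]

theorem schwartzW_surjective (b k l : ℝ) (hb : b ≠ 0) (c : ℂ) (hc : c ≠ 0) :
    Function.Surjective (schwartzW b k l hb c) := by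
  intro g
  have hpi := Real.pi_ne_zero
  have hr : 2 * Real.pi * b ≠ 0 := by positivity
  have hl := hasTemperateGrowth_chirp l
  have hk := hasTemperateGrowth_chirp k
  have hl' := hasTemperateGrowth_chirp (-l)
  have hk' := hasTemperateGrowth_chirp (-k)
  set g1 : 𝓢(ℝ, ℂ) :=
    smulLeftCLM ℂ (fun u : ℝ => c⁻¹ * Complex.exp (Complex.I * (-l : ℝ) * u ^ 2)) g with hg1
  set g2 := dilation (2 * Real.pi * b) hr g1 with hg2
  refine ⟨smulLeftCLM ℂ (fun x : ℝ => Complex.exp (Complex.I * (-k : ℝ) * x ^ 2)) (𝓕⁻ g2), ?_⟩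
  ext u
  rw [schwartzW_apply, smulLeftCLM_smulLeftCLM_apply hk hk']
  have h1 : ((fun x : ℝ => Complex.exp (Complex.I * k * x ^ 2)) *
      fun x : ℝ => Complex.exp (Complex.I * (-k : ℝ) * x ^ 2)) = fun _ => 1 := by
    funext x
    simp only [Pi.mul_apply]
    rw [← Complex.exp_add, ← Complex.exp_zero]
    congr 1; push_cast; ring
  rw [h1, smulLeftCLM_const, one_smul, ContinuousLinearMap.id_apply, fourier_fourierInv_eq, hg2,
    dilation_apply, mul_inv_cancel_left₀ hr, hg1,
    smulLeftCLM_apply_apply (by fun_prop), smul_eq_mul]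
  have h2 : Complex.exp (Complex.I * l * u ^ 2) *
      Complex.exp (Complex.I * (-l : ℝ) * u ^ 2) = 1 := by
    rw [← Complex.exp_add, ← Complex.exp_zero]
    congr 1; push_cast; ring
  linear_combination (c * c⁻¹ * g u) * h2 + g u * mul_inv_cancel₀ hc

theorem fourier_derivCLM_apply (f : 𝓢(ℝ, ℂ)) (ξ : ℝ) :
    (𝓕 (derivCLM ℂ ℂ f) : 𝓢(ℝ, ℂ)) ξ = 2 * Real.pi * Complex.I * ξ * (𝓕 f : 𝓢(ℝ, ℂ)) ξ := by
  have h := Real.fourier_deriv f.integrable f.differentiable (derivCLM ℂ ℂ f).integrable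
  have h2 := congrFun h ξ
  rw [smul_eq_mul] at h2
  exact h2

theorem deriv_fourier_apply (f : 𝓢(ℝ, ℂ)) (ξ : ℝ) :
    deriv (𝓕 f : 𝓢(ℝ, ℂ)) ξ = -(2 * Real.pi * Complex.I) * (𝓕 (mulX f) : 𝓢(ℝ, ℂ)) ξ := by
  have h : Integrable (fun x : ℝ => x • f x) := by
    refine (mulX f).integrable.congr (.of_forall fun x => ?_)
    simp
  have h1 : (fun x : ℝ => (-2 * Real.pi * Complex.I * x : ℂ) • f x) =
      ((-(2 * Real.pi * Complex.I) : ℂ) • mulX f : 𝓢(ℝ, ℂ)) := by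
    funext x
    simp; ring
  rw [fourier_coe, (Real.hasDerivAt_fourier f.integrable h ξ).deriv, h1, ← fourier_coe,
    FourierTransform.fourier_smul, smul_apply, smul_eq_mul]

/-- Conjugation by the operator turns multiplication by `x` into the combination
`2 b l u + i b d/du`. -/
theorem schwartzW_mulX (b k l : ℝ) (hb : b ≠ 0) (c : ℂ) (f : 𝓢(ℝ, ℂ)) :
    schwartzW b k l hb c (mulX f) = (2 * b * l : ℂ) • mulX (schwartzW b k l hb c f) +
      (Complex.I * b) • derivCLM ℂ ℂ (schwartzW b k l hb c f) := by
  have hk := hasTemperateGrowth_chirp k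
  have hb' : (b : ℂ) ≠ 0 := by exact_mod_cast hb
  have hpi : (Real.pi : ℂ) ≠ 0 := by exact_mod_cast Real.pi_ne_zero
  ext u
  set g : 𝓢(ℝ, ℂ) := smulLeftCLM ℂ (fun x : ℝ => Complex.exp (Complex.I * k * x ^ 2)) f with hg
  have h1 : smulLeftCLM ℂ (fun x : ℝ => Complex.exp (Complex.I * k * x ^ 2)) (mulX f) = mulX g := by
    ext x
    rw [smulLeftCLM_apply_apply hk, mulX_apply, mulX_apply, hg, smulLeftCLM_apply_apply hk]
    simp only [smul_eq_mul]; ring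
  have h2 : (schwartzW b k l hb c f : ℝ → ℂ) = fun u : ℝ =>
      c * Complex.exp (Complex.I * l * u ^ 2) * (𝓕 g : 𝓢(ℝ, ℂ)) ((2 * Real.pi * b)⁻¹ * u) :=
    funext fun u => schwartzW_apply b k l hb c f u
  have h3 : HasDerivAt (fun u : ℝ => (u : ℂ)) 1 u := Complex.ofRealCLM.hasDerivAt (x := u)
  have h4 := (((h3.pow 2).const_mul (Complex.I * l)).cexp).const_mul c
  have h5 : HasDerivAt (fun u : ℝ => (2 * Real.pi * b)⁻¹ * u) ((2 * Real.pi * b)⁻¹) u := by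
    simpa using (hasDerivAt_id u).const_mul ((2 * Real.pi * b)⁻¹)
  have h6 := ((𝓕 g : 𝓢(ℝ, ℂ)).hasDerivAt ((2 * Real.pi * b)⁻¹ * u)).scomp u h5
  have h7 := (h4.mul h6).deriv
  simp only [add_apply, smul_apply, mulX_apply, derivCLM_apply, smul_eq_mul]
  rw [h2]
  have h8 : deriv (fun u : ℝ => c * Complex.exp (Complex.I * l * u ^ 2) *
      (𝓕 g : 𝓢(ℝ, ℂ)) ((2 * Real.pi * b)⁻¹ * u)) u = _ := h7
  rw [h8, schwartzW_apply, h1, deriv_fourier_apply]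
  simp only [Function.comp_apply, Complex.real_smul, Pi.pow_apply]
  push_cast
  field_simp
  ring_nf
  simp only [Complex.I_sq]
  ring

/-- Conjugation by the operator turns `d/dx + 2 i k x` into multiplication by `i u / b`. -/
theorem schwartzW_deriv (b k l : ℝ) (hb : b ≠ 0) (c : ℂ) (f : 𝓢(ℝ, ℂ)) :
    schwartzW b k l hb c (derivCLM ℂ ℂ f) = (Complex.I / b) • mulX (schwartzW b k l hb c f) -
      (2 * Complex.I * k) • schwartzW b k l hb c (mulX f) := by
  have hk := hasTemperateGrowth_chirp k
  have hb' : (b : ℂ) ≠ 0 := by exact_mod_cast hb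
  have hpi : (Real.pi : ℂ) ≠ 0 := by exact_mod_cast Real.pi_ne_zero
  set g : 𝓢(ℝ, ℂ) := smulLeftCLM ℂ (fun x : ℝ => Complex.exp (Complex.I * k * x ^ 2)) f with hg
  have h1 : smulLeftCLM ℂ (fun x : ℝ => Complex.exp (Complex.I * k * x ^ 2)) (mulX f) = mulX g := by
    ext x
    rw [smulLeftCLM_apply_apply hk, mulX_apply, mulX_apply, hg, smulLeftCLM_apply_apply hk]
    simp only [smul_eq_mul]; ring
  have h2 : smulLeftCLM ℂ (fun x : ℝ => Complex.exp (Complex.I * k * x ^ 2)) (derivCLM ℂ ℂ f) =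
      derivCLM ℂ ℂ g - (2 * Complex.I * k) • mulX g := by
    ext x
    have h2 : (g : ℝ → ℂ) = fun x : ℝ => Complex.exp (Complex.I * k * x ^ 2) * f x :=
      funext fun x => by rw [hg, smulLeftCLM_apply_apply hk, smul_eq_mul]
    have h3 : HasDerivAt (fun u : ℝ => (u : ℂ)) 1 x := Complex.ofRealCLM.hasDerivAt (x := x)
    have h4 := (((h3.pow 2).const_mul (Complex.I * k)).cexp).mul (f.hasDerivAt x)
    have h5 : deriv (fun x : ℝ => Complex.exp (Complex.I * k * x ^ 2) * f x) x = _ := h4.deriv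
    simp only [sub_apply, smul_apply, mulX_apply, derivCLM_apply, smul_eq_mul,
      smulLeftCLM_apply_apply hk]
    rw [h2, h5]
    simp only [Pi.pow_apply]
    push_cast
    ring
  ext u
  simp only [sub_apply, smul_apply, mulX_apply, schwartzW_apply, smul_eq_mul, h1, h2]
  rw [sub_eq_add_neg, ← neg_smul, FourierTransform.fourier_add, FourierTransform.fourier_smul]
  simp only [add_apply, smul_apply, smul_eq_mul, fourier_derivCLM_apply, ← hg]
  push_cast
  field_simp
  ring

/-- The inverted oscillator `-f'' - ω² x² f` on Schwartz functions. -/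
def schwartzOsc (ω : ℝ) : 𝓢(ℝ, ℂ) →L[ℂ] 𝓢(ℝ, ℂ) :=
  -(derivCLM ℂ ℂ ∘L derivCLM ℂ ℂ) - (ω : ℂ) ^ 2 • (mulX ∘L mulX)

theorem schwartzOsc_apply (ω : ℝ) (f : 𝓢(ℝ, ℂ)) (x : ℝ) :
    schwartzOsc ω f x = -(deriv (deriv f) x) - (ω : ℂ) ^ 2 * (x : ℂ) ^ 2 * f x := by
  have h : (derivCLM ℂ ℂ f : ℝ → ℂ) = deriv f := rfl
  simp only [schwartzOsc, sub_apply, neg_apply,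
    smul_apply, ContinuousLinearMap.comp_apply,
    mulX_apply, smul_eq_mul, derivCLM_apply, h]
  ring

section OscMatrix

variable (ω a : ℝ) (hω : ω ≠ 0) (ha : a ≠ 0) (c : ℂ)

/-- The restriction to Schwartz functions of `W_A`, for the matrix `A` of `oscMatrix`. -/
def oscW : 𝓢(ℝ, ℂ) →L[ℂ] 𝓢(ℝ, ℂ) :=
  schwartzW (a / ω) (ω / 2) (ω / (4 * a ^ 2)) (div_ne_zero ha hω) c

theorem opW_oscMatrix_toLp
    (hc : ‖c‖ = Real.sqrt (1 / (2 * Real.pi * |oscMatrix ω a hω ha 0 1|))) (f : 𝓢(ℝ, ℂ)) :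
    opW (oscMatrix ω a hω ha) (oscMatrix_ne ω a hω ha) c hc (f.toLp 2) =
      (oscW ω a hω ha c f).toLp 2 := by
  rw [opW_toLp, oscW]
  have h0 : oscMatrix ω a hω ha 0 0 = a := rfl
  have h1 : oscMatrix ω a hω ha 0 1 = a / ω := rfl
  have h2 : oscMatrix ω a hω ha 1 1 = 1 / (2 * a) := rfl
  have h3 : a / (2 * (a / ω)) = ω / 2 := by field_simp
  have h4 : 1 / (2 * a) / (2 * (a / ω)) = ω / (4 * a ^ 2) := by field_simp; ring
  simp only [h0, h1, h2, h3, h4]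

theorem oscW_mulX (f : 𝓢(ℝ, ℂ)) :
    oscW ω a hω ha c (mulX f) = (1 / (2 * a) : ℂ) • mulX (oscW ω a hω ha c f) +
      (Complex.I * a / ω) • derivCLM ℂ ℂ (oscW ω a hω ha c f) := by
  have hω' : (ω : ℂ) ≠ 0 := by exact_mod_cast hω
  have ha' : (a : ℂ) ≠ 0 := by exact_mod_cast ha
  rw [oscW, schwartzW_mulX]
  congr 2
  · push_cast; field_simp; norm_num
  · push_cast; ring

theorem oscW_deriv (f : 𝓢(ℝ, ℂ)) :
    oscW ω a hω ha c (derivCLM ℂ ℂ f) = (Complex.I * ω / (2 * a)) • mulX (oscW ω a hω ha c f) +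
      (a : ℂ) • derivCLM ℂ ℂ (oscW ω a hω ha c f) := by
  have hω' : (ω : ℂ) ≠ 0 := by exact_mod_cast hω
  have ha' : (a : ℂ) ≠ 0 := by exact_mod_cast ha
  have h := oscW_mulX ω a hω ha c f
  rw [oscW] at h ⊢
  rw [schwartzW_deriv, h]
  ext u
  simp only [add_apply, sub_apply, smul_apply, smul_eq_mul]
  push_cast
  field_simp
  ring_nf
  simp only [Complex.I_sq]
  ring

/-- `W_A` carries the inverted oscillator to the dilation generator `-iω (2 u d/du + 1)`. -/
theorem oscW_schwartzOsc (f : 𝓢(ℝ, ℂ)) :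
    oscW ω a hω ha c (schwartzOsc ω f) = (-(Complex.I * ω)) •
      ((2 : ℂ) • mulX (derivCLM ℂ ℂ (oscW ω a hω ha c f)) + oscW ω a hω ha c f) := by
  have hω' : (ω : ℂ) ≠ 0 := by exact_mod_cast hω
  have ha' : (a : ℂ) ≠ 0 := by exact_mod_cast ha
  simp only [schwartzOsc, sub_apply, neg_apply,
    smul_apply, ContinuousLinearMap.comp_apply, map_sub, map_neg, map_smul,
    oscW_deriv, oscW_mulX, map_add, derivCLM_mulX]
  ext u
  simp only [add_apply, sub_apply, neg_apply, smul_apply, smul_eq_mul, mulX_apply]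
  field_simp
  ring_nf
  simp only [Complex.I_sq]
  ring

theorem oscW_surjective (hc : c ≠ 0) : Function.Surjective (oscW ω a hω ha c) :=
  schwartzW_surjective _ _ _ _ c hc

end OscMatrix

/-! ### Exponential coordinates on Schwartz functions -/

/-- `η/2 + u η'`, the image of `d/dt` under the substitution `u = ± e^t`. -/
def eulerOp (f : 𝓢(ℝ, ℂ)) : 𝓢(ℝ, ℂ) := (1 / 2 : ℂ) • f + mulX (derivCLM ℂ ℂ f)

theorem hasDerivAt_exp_pullback (s : ℝ) (f : 𝓢(ℝ, ℂ)) (t : ℝ) :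
    HasDerivAt (fun t : ℝ => (Real.exp (t / 2) : ℂ) * f (s * Real.exp t))
      ((Real.exp (t / 2) : ℂ) * eulerOp f (s * Real.exp t)) t := by
  have h1 : HasDerivAt (fun t : ℝ => (Real.exp (t / 2) : ℂ))
      ((Real.exp (t / 2) * (1 / 2) : ℝ) : ℂ) t :=
    (((hasDerivAt_id t).div_const 2).exp).ofReal_comp
  have h2 : HasDerivAt (fun t : ℝ => s * Real.exp t) (s * Real.exp t) t :=
    (Real.hasDerivAt_exp t).const_mul s
  have h3 := (f.hasDerivAt (s * Real.exp t)).scomp t h2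
  convert! h1.mul h3 using 1
  simp only [eulerOp, add_apply, smul_apply, smul_eq_mul, mulX_apply, derivCLM_apply,
    Function.comp_apply, Complex.real_smul]
  push_cast
  ring

theorem iteratedDeriv_exp_pullback (s : ℝ) (n : ℕ) (f : 𝓢(ℝ, ℂ)) :
    iteratedDeriv n (fun t : ℝ => (Real.exp (t / 2) : ℂ) * f (s * Real.exp t)) =
      fun t : ℝ => (Real.exp (t / 2) : ℂ) * (eulerOp^[n] f) (s * Real.exp t) := by
  induction n generalizing f with
  | zero => simp
  | succ n ih =>
    rw [iteratedDeriv_succ', Function.iterate_succ_apply, ← ih]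
    congr 1
    funext t
    exact (hasDerivAt_exp_pullback s f t).deriv

/-- Rapid decay in the exponential coordinate: as `t → -∞` it comes from the weight `e^{t/2}`, as
`t → ∞` from the decay of `f`. -/
theorem exp_pullback_decay (s : ℝ) (hs : |s| = 1) (k : ℕ) (f : 𝓢(ℝ, ℂ)) (t : ℝ) :
    |t| ^ k * ‖(Real.exp (t / 2) : ℂ) * f (s * Real.exp t)‖ ≤
      2 ^ k * k.factorial * (SchwartzMap.seminorm ℂ 0 0 f + SchwartzMap.seminorm ℂ 2 0 f) := by
  have h0 := norm_le_seminorm ℂ f (s * Real.exp t)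
  have h2 := norm_pow_mul_le_seminorm ℂ f 2 (s * Real.exp t)
  have hS0 : 0 ≤ SchwartzMap.seminorm ℂ 0 0 f := apply_nonneg _ _
  have hS2 : 0 ≤ SchwartzMap.seminorm ℂ 2 0 f := apply_nonneg _ _
  have hp : |t| ^ k ≤ 2 ^ k * k.factorial * Real.exp (|t| / 2) := by
    have := Real.pow_div_factorial_le_exp (|t| / 2) (by positivity) k
    rw [div_le_iff₀ (by positivity), div_pow, div_le_iff₀ (by positivity)] at this
    linarith
  have hn : ‖s * Real.exp t‖ = Real.exp t := by
    rw [norm_mul, Real.norm_eq_abs, hs, one_mul, Real.norm_eq_abs, Real.abs_exp]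
  rw [hn] at h2
  rw [norm_mul, Complex.norm_real, Real.norm_eq_abs, Real.abs_exp]
  have key : Real.exp (|t| / 2) * (Real.exp (t / 2) * ‖f (s * Real.exp t)‖) ≤
      SchwartzMap.seminorm ℂ 0 0 f + SchwartzMap.seminorm ℂ 2 0 f := by
    rcases le_total t 0 with ht | ht
    · rw [abs_of_nonpos ht, ← mul_assoc, ← Real.exp_add]
      rw [show -t / 2 + t / 2 = 0 by ring, Real.exp_zero, one_mul]
      linarith
    · rw [abs_of_nonneg ht, ← mul_assoc, ← Real.exp_add, show t / 2 + t / 2 = t by ring]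
      have h3 : Real.exp t ≤ Real.exp t ^ 2 := le_self_pow₀ (Real.one_le_exp ht) two_ne_zero
      nlinarith [norm_nonneg (f (s * Real.exp t))]
  calc |t| ^ k * (Real.exp (t / 2) * ‖f (s * Real.exp t)‖)
      ≤ (2 ^ k * k.factorial * Real.exp (|t| / 2)) *
          (Real.exp (t / 2) * ‖f (s * Real.exp t)‖) := by gcongr
    _ = 2 ^ k * k.factorial * (Real.exp (|t| / 2) *
          (Real.exp (t / 2) * ‖f (s * Real.exp t)‖)) := by ring
    _ ≤ _ := by gcongr

/-- The Schwartz function `t ↦ √(e^t) η(s e^t)`, for a Schwartz function `η` and a sign `s`. -/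
def expPullback (s : ℝ) (hs : |s| = 1) (f : 𝓢(ℝ, ℂ)) : 𝓢(ℝ, ℂ) where
  toFun t := (Real.exp (t / 2) : ℂ) * f (s * Real.exp t)
  smooth' := by
    refine ContDiff.mul (Complex.ofRealCLM.contDiff.comp ?_) (f.smooth'.comp ?_)
    · exact (contDiff_id.div_const 2).exp
    · exact contDiff_const.mul Real.contDiff_exp
  decay' k n := ⟨_, fun t => by
    rw [norm_iteratedFDeriv_eq_norm_iteratedDeriv, iteratedDeriv_exp_pullback]
    exact exp_pullback_decay s hs k _ t⟩

theorem expPullback_apply (s : ℝ) (hs : |s| = 1) (f : 𝓢(ℝ, ℂ)) (t : ℝ) :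
    expPullback s hs f t = (Real.exp (t / 2) : ℂ) * f (s * Real.exp t) := rfl

theorem derivCLM_expPullback (s : ℝ) (hs : |s| = 1) (f : 𝓢(ℝ, ℂ)) :
    derivCLM ℂ ℂ (expPullback s hs f) = expPullback s hs (eulerOp f) := by
  ext t
  exact (hasDerivAt_exp_pullback s f t).deriv

/-- `U_exp` on Schwartz functions. -/
def schwartzU (f : 𝓢(ℝ, ℂ)) : 𝓢(ℝ, ℂ) × 𝓢(ℝ, ℂ) :=
  (expPullback 1 (by simp) f, expPullback (-1) (by simp) f)

theorem coeFn_schwartzIncl (g : 𝓢(ℝ, ℂ) × 𝓢(ℝ, ℂ)) :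
    schwartzIncl g =ᵐ[twoLines] Sum.elim g.1 g.2 :=
  (memLp_sumElim g).coeFn_toLp

theorem opU_toLp (f : 𝓢(ℝ, ℂ)) : opU (f.toLp 2) = schwartzIncl (schwartzU f) := by
  apply Lp.ext
  filter_upwards [coeFn_opU (f.toLp 2), exp_change.qmp.ae_eq_comp (f.coeFn_toLp 2),
    coeFn_schwartzIncl (schwartzU f)] with y h1 h2 h3
  simp only [Function.comp_apply] at h2
  rw [h1, h2, h3]
  rcases y with t | t <;>
    simp [expWeight, signedExp, schwartzU, expPullback_apply, Real.exp_half]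

theorem integral_twoLines {f : ℝ ⊕ ℝ → ℂ} (hf : Integrable f twoLines) :
    ∫ y, f y ∂twoLines = (∫ t, f (Sum.inl t)) + ∫ t, f (Sum.inr t) := by
  rw [twoLines] at hf ⊢
  rw [integral_add_measure (hf.mono_measure (Measure.le_add_right le_rfl))
    (hf.mono_measure (Measure.le_add_left le_rfl)),
    MeasurableEmbedding.integral_map ⟨Sum.inl_injective, measurable_inl, fun _ h => h.inl_image⟩,
    MeasurableEmbedding.integral_map ⟨Sum.inr_injective, measurable_inr, fun _ h => h.inr_image⟩]

theorem inner_schwartzIncl (g h : 𝓢(ℝ, ℂ) × 𝓢(ℝ, ℂ)) :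
    inner ℂ (schwartzIncl g) (schwartzIncl h) =
      (∫ t, inner ℂ (g.1 t) (h.1 t)) + ∫ t, inner ℂ (g.2 t) (h.2 t) := by
  have h1 : (fun y => inner ℂ (schwartzIncl g y) (schwartzIncl h y)) =ᵐ[twoLines]
      fun y => inner ℂ ((Sum.elim g.1 g.2 : ℝ ⊕ ℝ → ℂ) y) ((Sum.elim h.1 h.2 : ℝ ⊕ ℝ → ℂ) y) := by
    filter_upwards [coeFn_schwartzIncl g, coeFn_schwartzIncl h] with y h1 h2
    rw [h1, h2]
  rw [L2.inner_def, integral_congr_ae h1, integral_twoLines]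
  · rfl
  · exact (L2.integrable_inner (𝕜 := ℂ) _ _).congr h1

/-- The operator `κ d/dt` on pairs of Schwartz functions. -/
def pairDeriv (κ : ℂ) : (𝓢(ℝ, ℂ) × 𝓢(ℝ, ℂ)) →L[ℂ] 𝓢(ℝ, ℂ) × 𝓢(ℝ, ℂ) :=
  (κ • derivCLM ℂ ℂ).prodMap (κ • derivCLM ℂ ℂ)

theorem pairDeriv_apply (κ : ℂ) (g : 𝓢(ℝ, ℂ) × 𝓢(ℝ, ℂ)) :
    pairDeriv κ g = (κ • derivCLM ℂ ℂ g.1, κ • derivCLM ℂ ℂ g.2) := rfl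

/-- Complex conjugation of Schwartz functions. -/
def schwartzConj (f : 𝓢(ℝ, ℂ)) : 𝓢(ℝ, ℂ) :=
  postcompCLM (𝕜 := ℝ) (Complex.conjCLE : ℂ →L[ℝ] ℂ) f

theorem schwartzConj_apply (f : 𝓢(ℝ, ℂ)) (x : ℝ) :
    schwartzConj f x = starRingEnd ℂ (f x) := rfl

theorem deriv_schwartzConj (f : 𝓢(ℝ, ℂ)) (x : ℝ) :
    deriv (schwartzConj f) x = starRingEnd ℂ (deriv f x) :=
  ((f.hasDerivAt x).star).deriv

theorem integral_inner_deriv (f g : 𝓢(ℝ, ℂ)) (r : ℝ) :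
    ∫ t, inner ℂ (((2 * r * (-Complex.I) : ℂ) • derivCLM ℂ ℂ f) t) (g t) =
      ∫ t, inner ℂ (f t) (((2 * r * (-Complex.I) : ℂ) • derivCLM ℂ ℂ g) t) := by
  have h := integral_mul_deriv_eq_neg_deriv_mul (schwartzConj f) g
  simp only [deriv_schwartzConj, schwartzConj_apply] at h
  have h1 : ∀ t, inner ℂ (((2 * r * (-Complex.I) : ℂ) • derivCLM ℂ ℂ f) t) (g t) =
      (2 * r * Complex.I) * (starRingEnd ℂ (deriv f t) * g t) := fun t => by
    simp [map_ofNat (starRingEnd ℂ) 2, mul_comm, mul_left_comm]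
  have h2 : ∀ t, inner ℂ (f t) (((2 * r * (-Complex.I) : ℂ) • derivCLM ℂ ℂ g) t) =
      -(2 * r * Complex.I) * (starRingEnd ℂ (f t) * deriv g t) := fun t => by
    simp [mul_comm, mul_left_comm]
  simp_rw [h1, h2]
  rw [integral_const_mul, integral_const_mul, h]
  ring

theorem inner_pairDeriv (r : ℝ) (g h : 𝓢(ℝ, ℂ) × 𝓢(ℝ, ℂ)) :
    inner ℂ (schwartzIncl (pairDeriv (2 * r * (-Complex.I)) g)) (schwartzIncl h) =
      inner ℂ (schwartzIncl g) (schwartzIncl (pairDeriv (2 * r * (-Complex.I)) h)) := by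
  rw [inner_schwartzIncl, inner_schwartzIncl]
  simp only [pairDeriv_apply]
  rw [integral_inner_deriv, integral_inner_deriv]

/-! ### The test space and the operator on it -/

/-- The topological isomorphism between pairs of Schwartz functions and the test space. -/
def schwartzEquiv (W : L2R ≃ₗᵢ[ℂ] L2R) : (𝓢(ℝ, ℂ) × 𝓢(ℝ, ℂ)) ≃L[ℂ] TestSpace W where
  toLinearEquiv := LinearEquiv.ofBijective (ofSchwartz W) (ofSchwartz_bijective W)
  continuous_toFun := continuous_coinduced_rng
  continuous_invFun := by
    refine continuous_coinduced_dom.2 ?_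
    convert continuous_id using 1
    funext g
    exact (LinearEquiv.ofBijective (ofSchwartz W) (ofSchwartz_bijective W)).symm_apply_apply g

theorem opU_W_schwartzEquiv (W : L2R ≃ₗᵢ[ℂ] L2R) (g : 𝓢(ℝ, ℂ) × 𝓢(ℝ, ℂ)) :
    opU (W (schwartzEquiv W g).toL2) = schwartzIncl g :=
  (W.trans opU).apply_symm_apply (schwartzIncl g)

theorem schwartzIncl_injective : Function.Injective schwartzIncl := by
  intro g h hgh
  have h1 := (ofSchwartz_bijective (LinearIsometryEquiv.refl ℂ L2R)).1 (a₁ := g) (a₂ := h)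
  apply h1
  apply Subtype.ext
  change ((LinearIsometryEquiv.refl ℂ L2R).trans opU).symm (schwartzIncl g) =
    ((LinearIsometryEquiv.refl ℂ L2R).trans opU).symm (schwartzIncl h)
  rw [hgh]

/-- The operator on the test space that corresponds to `2ω (-i d/dt)`. -/
def testOp (W : L2R ≃ₗᵢ[ℂ] L2R) (ω : ℝ) : TestSpace W →L[ℂ] TestSpace W :=
  (schwartzEquiv W : (𝓢(ℝ, ℂ) × 𝓢(ℝ, ℂ)) →L[ℂ] TestSpace W) ∘L
    pairDeriv (2 * ω * (-Complex.I)) ∘L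
      ((schwartzEquiv W).symm : TestSpace W →L[ℂ] (𝓢(ℝ, ℂ) × 𝓢(ℝ, ℂ)))

theorem testOp_schwartzEquiv (W : L2R ≃ₗᵢ[ℂ] L2R) (ω : ℝ) (g : 𝓢(ℝ, ℂ) × 𝓢(ℝ, ℂ)) :
    testOp W ω (schwartzEquiv W g) = schwartzEquiv W (pairDeriv (2 * ω * (-Complex.I)) g) := by
  simp [testOp]

theorem opU_W_testOp (W : L2R ≃ₗᵢ[ℂ] L2R) (ω : ℝ) (φ : TestSpace W)
    (g : 𝓢(ℝ, ℂ) × 𝓢(ℝ, ℂ)) (h : opU (W φ.toL2) = schwartzIncl g) :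
    opU (W (testOp W ω φ).toL2) = schwartzIncl
      ((2 * ω * (-Complex.I)) • derivCLM ℂ ℂ g.1, (2 * ω * (-Complex.I)) • derivCLM ℂ ℂ g.2) := by
  obtain ⟨g', rfl⟩ := (schwartzEquiv W).surjective φ
  rw [opU_W_schwartzEquiv] at h
  obtain rfl := schwartzIncl_injective h
  rw [testOp_schwartzEquiv, opU_W_schwartzEquiv, pairDeriv_apply]

section OscMatrix

variable {ω a : ℝ} (hω : ω ≠ 0) (ha : a ≠ 0) {c : ℂ}
    (hc : ‖c‖ = Real.sqrt (1 / (2 * Real.pi * |oscMatrix ω a hω ha 0 1|)))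

/-- The operator `W_A` for the matrix `oscMatrix`. -/
abbrev oscOpW : L2R ≃ₗᵢ[ℂ] L2R :=
  opW (oscMatrix ω a hω ha) (oscMatrix_ne ω a hω ha) c hc

theorem opU_oscOpW_toLp (f : 𝓢(ℝ, ℂ)) :
    opU (oscOpW hω ha hc (f.toLp 2)) = schwartzIncl (schwartzU (oscW ω a hω ha c f)) := by
  rw [oscOpW, opW_oscMatrix_toLp, opU_toLp]

theorem schwartzU_oscW_schwartzOsc (f : 𝓢(ℝ, ℂ)) :
    schwartzU (oscW ω a hω ha c (schwartzOsc ω f)) =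
      pairDeriv (2 * ω * (-Complex.I)) (schwartzU (oscW ω a hω ha c f)) := by
  rw [oscW_schwartzOsc, pairDeriv_apply]
  simp only [schwartzU, derivCLM_expPullback]
  ext t <;>
  · simp only [expPullback_apply, smul_apply, add_apply, eulerOp, smul_eq_mul]
    ring

/-- Schwartz functions are test vectors. -/
theorem exists_toL2_eq_toLp (f : 𝓢(ℝ, ℂ)) :
    ∃ φ : TestSpace (oscOpW hω ha hc), φ.toL2 = f.toLp 2 := by
  refine ⟨schwartzEquiv _ (schwartzU (oscW ω a hω ha c f)), ?_⟩
  apply ((oscOpW hω ha hc).trans opU).injective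
  exact (opU_W_schwartzEquiv _ _).trans (opU_oscOpW_toLp hω ha hc f).symm

theorem dense_domain : Dense (domain (oscOpW hω ha hc) : Set L2R) := by
  have h := denseRange_toLpCLM (E := ℝ) (F := ℂ) (p := 2) (μ := volume) ENNReal.ofNat_ne_top
  refine Dense.mono ?_ h
  rintro _ ⟨f, rfl⟩
  obtain ⟨φ, hφ⟩ := exists_toL2_eq_toLp hω ha hc f
  rw [toLpCLM_apply, ← hφ]
  exact φ.2

/-- The weak form of the equation, tested against Schwartz functions. -/
theorem inner_schwartzOsc (f : 𝓢(ℝ, ℂ)) (φ : TestSpace (oscOpW hω ha hc)) :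
    inner ℂ ((schwartzOsc ω f).toLp 2) φ.toL2 =
      inner ℂ (f.toLp 2) (testOp _ ω φ).toL2 := by
  obtain ⟨g, rfl⟩ := (schwartzEquiv _).surjective φ
  rw [testOp_schwartzEquiv]
  have key := ((oscOpW hω ha hc).trans opU).inner_map_map
  refine (key _ _).symm.trans (Eq.trans ?_ (key _ _))
  simp only [LinearIsometryEquiv.trans_apply]
  rw [opU_W_schwartzEquiv, opU_W_schwartzEquiv, opU_oscOpW_toLp, opU_oscOpW_toLp,
    schwartzU_oscW_schwartzOsc, inner_pairDeriv]

theorem isInvertedOscillator_testOp (φ : TestSpace (oscOpW hω ha hc)) :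
    IsInvertedOscillator ω φ.toL2 (testOp _ ω φ).toL2 := by
  intro θ hθ hθs
  -- The inner product is conjugate linear in its first argument, so it is paired with `conj θ`.
  set Θ : 𝓢(ℝ, ℂ) := schwartzConj (hθs.toSchwartzMap hθ) with hΘ
  have hΘθ : (Θ : ℝ → ℂ) = fun x => starRingEnd ℂ (θ x) := rfl
  have hd1 : ∀ x, deriv Θ x = starRingEnd ℂ (deriv θ x) := fun x =>
    deriv_schwartzConj _ x
  have hd2 : ∀ x, deriv (deriv Θ) x = starRingEnd ℂ (deriv (deriv θ) x) := fun x => by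
    have h2 : (deriv Θ : ℝ → ℂ) = fun x => starRingEnd ℂ (deriv θ x) := funext hd1
    rw [h2]
    exact deriv_schwartzConj (derivCLM ℂ ℂ (hθs.toSchwartzMap hθ)) x
  have h := inner_schwartzOsc hω ha hc Θ φ
  rw [L2.inner_def, L2.inner_def] at h
  have h1 : ∫ x, inner ℂ ((schwartzOsc ω Θ).toLp 2 volume x) (φ.toL2 x) =
      ∫ x, φ.toL2 x * (-(deriv (deriv θ) x) - (ω : ℂ) ^ 2 * (x : ℂ) ^ 2 * θ x) := by
    refine integral_congr_ae ?_
    filter_upwards [(schwartzOsc ω Θ).coeFn_toLp 2] with x hx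
    rw [hx, schwartzOsc_apply, hd2, hΘθ]
    simp
  have h2 : ∫ x, inner ℂ (Θ.toLp 2 volume x) ((testOp _ ω φ).toL2 x) =
      ∫ x, (testOp _ ω φ).toL2 x * θ x := by
    refine integral_congr_ae ?_
    filter_upwards [Θ.coeFn_toLp 2] with x hx
    rw [hx, hΘθ]
    simp
  rw [← h1, ← h2, h]

end OscMatrix

/-! ### Decay of test vectors -/

theorem norm_le_add_of_ae {X : Type} [MeasurableSpace X] {μ : Measure X} (F G H : Lp ℂ 2 μ)
    {A B : ℝ} (hA : 0 ≤ A) (hB : 0 ≤ B) (h : ∀ᵐ x ∂μ, ‖F x‖ ≤ A * ‖G x‖ + B * ‖H x‖) :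
    ‖F‖ ≤ A * ‖G‖ + B * ‖H‖ := by
  set G' : Lp ℝ 2 μ := (Lp.memLp G).norm.toLp with hG
  set H' : Lp ℝ 2 μ := (Lp.memLp H).norm.toLp with hH
  have hG' : ‖G'‖ = ‖G‖ := by rw [hG, Lp.norm_toLp, eLpNorm_norm, Lp.norm_def]
  have hH' : ‖H'‖ = ‖H‖ := by rw [hH, Lp.norm_toLp, eLpNorm_norm, Lp.norm_def]
  calc ‖F‖ ≤ ‖A • G' + B • H'‖ := by
        refine Lp.norm_le_norm_of_ae_le ?_
        filter_upwards [h, (Lp.memLp G).norm.coeFn_toLp, (Lp.memLp H).norm.coeFn_toLp,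
          Lp.coeFn_add (A • G') (B • H'), Lp.coeFn_smul A G', Lp.coeFn_smul B H']
          with x h1 h2 h3 h4 h5 h6
        rw [h4, Pi.add_apply, h5, h6, Pi.smul_apply, Pi.smul_apply, hG, hH, h2, h3]
        exact h1.trans (le_abs_self _)
    _ ≤ ‖A • G'‖ + ‖B • H'‖ := norm_add_le _ _
    _ = A * ‖G‖ + B * ‖H‖ := by
        rw [norm_smul, norm_smul, hG', hH', Real.norm_of_nonneg hA, Real.norm_of_nonneg hB]

theorem norm_schwartzIncl_le {F G H : 𝓢(ℝ, ℂ) × 𝓢(ℝ, ℂ)} {A B : ℝ} (hA : 0 ≤ A) (hB : 0 ≤ B)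
    (h1 : ∀ t, ‖F.1 t‖ ≤ A * ‖G.1 t‖ + B * ‖H.1 t‖)
    (h2 : ∀ t, ‖F.2 t‖ ≤ A * ‖G.2 t‖ + B * ‖H.2 t‖) :
    ‖schwartzIncl F‖ ≤ A * ‖schwartzIncl G‖ + B * ‖schwartzIncl H‖ := by
  refine norm_le_add_of_ae _ _ _ hA hB ?_
  filter_upwards [coeFn_schwartzIncl F, coeFn_schwartzIncl G, coeFn_schwartzIncl H]
    with y hF hG hH
  rw [hF, hG, hH]
  rcases y with t | t
  · exact h1 t
  · exact h2 t

/-- A pair of compactly supported Schwartz functions is `U_exp` of a Schwartz function. -/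
theorem exists_schwartzU_eq (g : 𝓢(ℝ, ℂ) × 𝓢(ℝ, ℂ)) (K : ℝ)
    (hg : ∀ t, K < |t| → g.1 t = 0 ∧ g.2 t = 0) : ∃ η : 𝓢(ℝ, ℂ), schwartzU η = g := by
  -- `η(u) = |u|^{-1/2} g(log |u|)`; for negative `u`, `Real.log u` is `log |u|`.
  set η : ℝ → ℂ := fun u => if 0 < u then (Real.exp (-(Real.log u / 2)) : ℂ) * g.1 (Real.log u)
    else if u < 0 then (Real.exp (-(Real.log u / 2)) : ℂ) * g.2 (Real.log u) else 0 with hη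
  have hlog : ∀ u : ℝ, u ≠ 0 → ContDiffAt ℝ (⊤ : ℕ∞)
      (fun u => (Real.exp (-(Real.log u / 2)) : ℂ)) u := fun u hu => by
    refine Complex.ofRealCLM.contDiff.contDiffAt.comp u ?_
    exact ((Real.contDiffAt_log.2 hu).div_const 2).neg.exp
  have hzero : ∀ u : ℝ, |u| < Real.exp (-K) → η u = 0 := by
    intro u hu
    rcases eq_or_ne u 0 with rfl | h0
    · simp [hη]
    have h1 : K < |Real.log u| := by
      rw [← Real.log_abs]
      have : Real.log |u| < -K := (Real.log_lt_iff_lt_exp (abs_pos.2 h0)).2 hu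
      exact lt_of_lt_of_le (by linarith) (neg_le_abs _)
    simp [hη, (hg _ h1).1, (hg _ h1).2]
  have hsupp : HasCompactSupport η := by
    refine HasCompactSupport.intro (isCompact_Icc (a := -Real.exp K) (b := Real.exp K)) ?_
    intro u hu
    have h0 : Real.exp K < |u| := by
      rw [Set.mem_Icc, ← abs_le, not_le] at hu; exact hu
    have h1 : K < |Real.log u| := by
      rw [← Real.log_abs]
      exact lt_of_lt_of_le ((Real.lt_log_iff_exp_lt (lt_trans (Real.exp_pos _) h0)).2 h0)
        (le_abs_self _)
    simp [hη, (hg _ h1).1, (hg _ h1).2]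
  have hsmooth : ContDiff ℝ (⊤ : ℕ∞) η := by
    rw [contDiff_iff_contDiffAt]
    intro u
    rcases lt_trichotomy u 0 with hu | rfl | hu
    · have h1 : (fun u => (Real.exp (-(Real.log u / 2)) : ℂ) * g.2 (Real.log u))
          =ᶠ[nhds u] η := by
        filter_upwards [Iio_mem_nhds hu] with v hv
        simp [hη, Set.mem_Iio.1 hv, (Set.mem_Iio.1 hv).not_gt]
      refine ContDiffAt.congr_of_eventuallyEq ?_ h1.symm
      exact (hlog u hu.ne).mul ((g.2.smooth _).contDiffAt.comp u (Real.contDiffAt_log.2 hu.ne))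
    · have h1 : (fun _ => (0 : ℂ)) =ᶠ[nhds (0 : ℝ)] η := by
        filter_upwards [Metric.ball_mem_nhds (0 : ℝ) (Real.exp_pos (-K))] with v hv
        rw [Metric.mem_ball, dist_zero_right, Real.norm_eq_abs] at hv
        exact (hzero v hv).symm
      exact contDiffAt_const.congr_of_eventuallyEq h1.symm
    · have h1 : (fun u => (Real.exp (-(Real.log u / 2)) : ℂ) * g.1 (Real.log u))
          =ᶠ[nhds u] η := by
        filter_upwards [Ioi_mem_nhds hu] with v hv
        simp [hη, Set.mem_Ioi.1 hv]
      refine ContDiffAt.congr_of_eventuallyEq ?_ h1.symm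
      exact (hlog u hu.ne').mul ((g.1.smooth _).contDiffAt.comp u (Real.contDiffAt_log.2 hu.ne'))
  have hexp : ∀ t : ℝ, (Real.exp (t / 2) : ℂ) * (Real.exp (-(t / 2)) : ℂ) = 1 := fun t => by
    rw [← Complex.ofReal_mul, ← Real.exp_add]; simp
  refine ⟨hsupp.toSchwartzMap hsmooth, Prod.ext ?_ ?_⟩
  · ext t
    change (Real.exp (t / 2) : ℂ) * η (1 * Real.exp t) = g.1 t
    simp only [hη, one_mul, Real.exp_pos, if_true, Real.log_exp]
    rw [← mul_assoc, hexp, one_mul]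
  · ext t
    change (Real.exp (t / 2) : ℂ) * η (-1 * Real.exp t) = g.2 t
    have h1 : ¬ (0 < -1 * Real.exp t) := by simp [Real.exp_pos, le_of_lt]
    have h2 : -1 * Real.exp t < 0 := by simp [Real.exp_pos]
    simp only [hη, h1, h2, if_false, if_true]
    rw [neg_one_mul, Real.log_neg_eq_log, Real.log_exp]
    rw [← mul_assoc, hexp, one_mul]

/-- A smooth cutoff function equal to `1` on `[-1, 1]` and supported in `[-2, 2]`. -/
def bump : ContDiffBump (0 : ℝ) := ⟨1, 2, one_pos, one_lt_two⟩

theorem bump_eq_one {t : ℝ} (ht : |t| ≤ 1) : bump t = 1 :=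
  bump.one_of_mem_closedBall (by simpa [bump] using ht)

theorem bump_eq_zero {t : ℝ} (ht : 2 ≤ |t|) : bump t = 0 :=
  bump.zero_of_le_dist (by simpa [bump] using ht)

theorem exists_bound_deriv_bump : ∃ M : ℝ, 0 ≤ M ∧ ∀ t, |deriv bump t| ≤ M := by
  have h1 : Continuous (deriv bump) := (bump.contDiff (n := 1)).continuous_deriv le_rfl
  obtain ⟨M, hM⟩ := h1.bounded_above_of_compact_support bump.hasCompactSupport.deriv
  exact ⟨M, (norm_nonneg _).trans (hM 0), hM⟩

theorem hasTemperateGrowth_bump {τ : ℝ} (hτ : 0 < τ) :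
    (fun t : ℝ => (bump (t / τ) : ℂ)).HasTemperateGrowth := by
  have hs : HasCompactSupport (fun t : ℝ => (bump (t / τ) : ℂ)) := by
    refine HasCompactSupport.intro (isCompact_Icc (a := -(2 * τ)) (b := 2 * τ)) ?_
    intro t ht
    rw [Set.mem_Icc, ← abs_le, not_le] at ht
    rw [bump_eq_zero, Complex.ofReal_zero]
    rw [abs_div, abs_of_pos hτ, le_div_iff₀ hτ]
    exact ht.le
  refine hs.hasTemperateGrowth ?_
  exact Complex.ofRealCLM.contDiff.comp (bump.contDiff.comp (contDiff_id.div_const τ))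

/-- Multiplication of a Schwartz function by the cutoff at scale `τ`. -/
def cutoff (τ : ℝ) (f : 𝓢(ℝ, ℂ)) : 𝓢(ℝ, ℂ) := smulLeftCLM ℂ (fun t : ℝ => (bump (t / τ) : ℂ)) f

theorem cutoff_apply {τ : ℝ} (hτ : 0 < τ) (f : 𝓢(ℝ, ℂ)) (t : ℝ) :
    cutoff τ f t = bump (t / τ) * f t := by
  rw [cutoff, smulLeftCLM_apply_apply (hasTemperateGrowth_bump hτ), smul_eq_mul]

theorem cutoff_eq_zero {τ : ℝ} (hτ : 0 < τ) (f : 𝓢(ℝ, ℂ)) {t : ℝ} (ht : 2 * τ ≤ |t|) :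
    cutoff τ f t = 0 := by
  rw [cutoff_apply hτ, bump_eq_zero, Complex.ofReal_zero, zero_mul]
  rwa [abs_div, abs_of_pos hτ, le_div_iff₀ hτ]

theorem norm_cutoff_le {τ : ℝ} (hτ : 0 < τ) (f : 𝓢(ℝ, ℂ)) (t : ℝ) : ‖cutoff τ f t‖ ≤ ‖f t‖ := by
  rw [cutoff_apply hτ, norm_mul, Complex.norm_real, Real.norm_of_nonneg bump.nonneg]
  exact mul_le_of_le_one_left (norm_nonneg _) bump.le_one

/-- Where the cutoff is not `1` one has `τ ≤ |t|`, which costs the factor `(t/τ)²`. -/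
theorem norm_sub_cutoff_le {τ : ℝ} (hτ : 0 < τ) (f : 𝓢(ℝ, ℂ)) (t : ℝ) :
    ‖f t - cutoff τ f t‖ ≤ (τ ^ 2)⁻¹ * ‖mulX (mulX f) t‖ := by
  have h1 : f t - cutoff τ f t = ((1 - bump (t / τ) : ℝ) : ℂ) * f t := by
    rw [cutoff_apply hτ]; push_cast; ring
  have h2 : mulX (mulX f) t = ((t ^ 2 : ℝ) : ℂ) * f t := by
    rw [mulX_apply, mulX_apply]; push_cast; ring
  rw [h1, h2, norm_mul, norm_mul, Complex.norm_real, Complex.norm_real, ← mul_assoc,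
    Real.norm_of_nonneg (sub_nonneg.2 bump.le_one), Real.norm_of_nonneg (sq_nonneg t)]
  refine mul_le_mul_of_nonneg_right ?_ (norm_nonneg _)
  rcases le_total |t| τ with h | h
  · rw [bump_eq_one, sub_self]
    · positivity
    · rwa [abs_div, abs_of_pos hτ, div_le_one hτ]
  · have h3 : τ ^ 2 ≤ t ^ 2 := by rw [← sq_abs t]; gcongr
    have h4 : 1 ≤ (τ ^ 2)⁻¹ * t ^ 2 := by
      rw [inv_mul_eq_div, le_div_iff₀ (by positivity)]; linarith
    linarith [bump.nonneg (x := t / τ)]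

theorem norm_deriv_cutoff_le {M : ℝ} (hM : ∀ t, |deriv bump t| ≤ M) {τ : ℝ} (hτ : 0 < τ)
    (f : 𝓢(ℝ, ℂ)) (t : ℝ) : ‖derivCLM ℂ ℂ (cutoff τ f) t‖ ≤ M / τ * ‖f t‖ + ‖deriv f t‖ := by
  have h1 : (cutoff τ f : ℝ → ℂ) = fun t : ℝ => (bump (t / τ) : ℂ) * f t :=
    funext (cutoff_apply hτ f)
  have h2 : HasDerivAt (fun t : ℝ => bump (t / τ)) (deriv bump (t / τ) * (1 / τ)) t :=
    ((bump.contDiff (n := 1)).differentiable one_ne_zero _).hasDerivAt.comp t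
      ((hasDerivAt_id t).div_const τ)
  have h3 := h2.ofReal_comp.mul (f.hasDerivAt t)
  have h4 : deriv (fun t : ℝ => (bump (t / τ) : ℂ) * f t) t = _ := h3.deriv
  rw [derivCLM_apply, h1, h4]
  refine (norm_add_le _ _).trans (add_le_add ?_ ?_)
  · rw [norm_mul, Complex.norm_real, Real.norm_eq_abs, abs_mul,
      abs_of_pos (by positivity : 0 < 1 / τ)]
    gcongr
    rw [mul_one_div]
    gcongr
    exact hM _
  · rw [norm_mul, Complex.norm_real, Real.norm_of_nonneg bump.nonneg]
    exact mul_le_of_le_one_left (norm_nonneg _) bump.le_one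

theorem norm_toLp_eq_norm_schwartzU (η : 𝓢(ℝ, ℂ)) : ‖η.toLp 2‖ = ‖schwartzIncl (schwartzU η)‖ := by
  rw [← opU_toLp, LinearIsometryEquiv.norm_map]

theorem schwartzU_mulX (η : 𝓢(ℝ, ℂ)) (t : ℝ) :
    (schwartzU (mulX η)).1 t = Real.exp t * (schwartzU η).1 t ∧
      (schwartzU (mulX η)).2 t = -Real.exp t * (schwartzU η).2 t := by
  simp only [schwartzU, expPullback_apply, mulX_apply]
  push_cast
  constructor <;> ring

theorem schwartzU_deriv (η : 𝓢(ℝ, ℂ)) (t : ℝ) :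
    (schwartzU (derivCLM ℂ ℂ η)).1 t = Real.exp (-t) *
        (derivCLM ℂ ℂ (schwartzU η).1 t - 1 / 2 * (schwartzU η).1 t) ∧
      (schwartzU (derivCLM ℂ ℂ η)).2 t = -Real.exp (-t) *
        (derivCLM ℂ ℂ (schwartzU η).2 t - 1 / 2 * (schwartzU η).2 t) := by
  have h : (Real.exp (-t) : ℂ) * (Real.exp t : ℂ) = 1 := by
    rw [← Complex.ofReal_mul, ← Real.exp_add]; simp
  simp only [schwartzU, derivCLM_expPullback]
  simp only [expPullback_apply, eulerOp, add_apply, smul_apply, mulX_apply, smul_eq_mul]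
  constructor
  · push_cast at h ⊢
    linear_combination -(Complex.exp (t / 2) * (derivCLM ℂ ℂ η) (1 * Real.exp t)) * h
  · push_cast at h ⊢
    linear_combination -(Complex.exp (t / 2) * (derivCLM ℂ ℂ η) (-1 * Real.exp t)) * h

/-- The continuous function `‖g‖ + ‖g'‖ + ‖t² g‖` (norms of `L²`) on pairs of Schwartz functions. -/
def pairNorm (g : 𝓢(ℝ, ℂ) × 𝓢(ℝ, ℂ)) : ℝ :=
  ‖schwartzIncl g‖ + ‖schwartzIncl (pairDeriv 1 g)‖ +
    ‖schwartzIncl (mulX (mulX g.1), mulX (mulX g.2))‖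

theorem pairNorm_nonneg (g : 𝓢(ℝ, ℂ) × 𝓢(ℝ, ℂ)) : 0 ≤ pairNorm g := by
  unfold pairNorm; positivity

theorem norm_schwartzIncl_le_toLp (g : 𝓢(ℝ, ℂ) × 𝓢(ℝ, ℂ)) :
    ‖schwartzIncl g‖ ≤ ‖g.1.toLp 2‖ + ‖g.2.toLp 2‖ := by
  have h0 : ∀ f : 𝓢(ℝ, ℂ), ‖f.toLp 2‖ ^ 2 = RCLike.re (∫ t, inner ℂ (f t) (f t)) := fun f => by
    rw [norm_sq_eq_re_inner (𝕜 := ℂ), L2.inner_def]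
    congr 1
    refine integral_congr_ae ?_
    filter_upwards [f.coeFn_toLp 2] with t ht
    rw [ht]
  have h : ‖schwartzIncl g‖ ^ 2 = ‖g.1.toLp 2‖ ^ 2 + ‖g.2.toLp 2‖ ^ 2 := by
    rw [norm_sq_eq_re_inner (𝕜 := ℂ), inner_schwartzIncl, h0, h0, map_add]
  refine le_of_sq_le_sq ?_ (by positivity)
  nlinarith [norm_nonneg (g.1.toLp 2), norm_nonneg (g.2.toLp 2)]

theorem continuous_schwartzIncl : Continuous schwartzIncl := by
  refine continuous_of_continuousAt_zero schwartzIncl ?_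
  rw [ContinuousAt, map_zero, tendsto_zero_iff_norm_tendsto_zero]
  have h : Continuous fun g : 𝓢(ℝ, ℂ) × 𝓢(ℝ, ℂ) =>
      ‖toLpCLM ℂ ℂ 2 volume g.1‖ + ‖toLpCLM ℂ ℂ 2 volume g.2‖ := by fun_prop
  refine squeeze_zero (fun _ => norm_nonneg _) norm_schwartzIncl_le_toLp ?_
  have h0 := h.tendsto 0
  simp only [Prod.fst_zero, Prod.snd_zero, map_zero, norm_zero, add_zero] at h0
  exact h0

theorem continuous_pairNorm : Continuous pairNorm := by
  have h := continuous_schwartzIncl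
  unfold pairNorm
  fun_prop

theorem const_ne_zero {ω a : ℝ} (hω : ω ≠ 0) (ha : a ≠ 0) {c : ℂ}
    (hc : ‖c‖ = Real.sqrt (1 / (2 * Real.pi * |oscMatrix ω a hω ha 0 1|))) : c ≠ 0 := by
  have h := abs_pos.2 (oscMatrix_ne ω a hω ha)
  have := Real.pi_pos
  rw [← norm_pos_iff, hc]
  positivity

/-- The norm of `x θ`, read off in the exponential coordinates: `x` corresponds to
`u / (2a) + (i a / ω) d/du`. -/
theorem norm_toLp_mulX_le {ω a : ℝ} (hω : ω ≠ 0) (ha : a ≠ 0) {c : ℂ}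
    (hc : ‖c‖ = Real.sqrt (1 / (2 * Real.pi * |oscMatrix ω a hω ha 0 1|))) (θ : 𝓢(ℝ, ℂ)) :
    ‖(mulX θ).toLp 2‖ ≤ |1 / (2 * a)| *
        ‖schwartzIncl (schwartzU (mulX (oscW ω a hω ha c θ)))‖ +
      |a / ω| * ‖schwartzIncl (schwartzU (derivCLM ℂ ℂ (oscW ω a hω ha c θ)))‖ := by
  have h1 : ‖(mulX θ).toLp 2‖ = ‖(oscW ω a hω ha c (mulX θ)).toLp 2‖ := by
    rw [← opW_oscMatrix_toLp ω a hω ha c hc, LinearIsometryEquiv.norm_map]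
  rw [h1, oscW_mulX, ← norm_toLp_eq_norm_schwartzU, ← norm_toLp_eq_norm_schwartzU]
  have h2 : ∀ f : 𝓢(ℝ, ℂ), f.toLp 2 = toLpCLM ℂ ℂ 2 volume f := fun f => rfl
  rw [h2, h2, h2, map_add, map_smul, map_smul]
  refine (norm_add_le _ _).trans (add_le_add ?_ ?_)
  · rw [norm_smul]
    gcongr
    rw [← Real.norm_eq_abs, ← Complex.norm_real]
    push_cast
    exact le_rfl
  · rw [norm_smul]
    gcongr
    rw [mul_div_assoc, norm_mul, Complex.norm_I, one_mul, ← Complex.ofReal_div, Complex.norm_real,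
      Real.norm_eq_abs]

section OscMatrix

variable {ω a : ℝ} (hω : ω ≠ 0) (ha : a ≠ 0) {c : ℂ}
    (hc : ‖c‖ = Real.sqrt (1 / (2 * Real.pi * |oscMatrix ω a hω ha 0 1|)))

/-- Splitting of a test vector at the scale `|t| ∼ τ` of the exponential coordinate: the part near
the origin is a Schwartz function `θ` with `x θ` in `L²`. -/
theorem exists_schwartz_approx : ∃ C : ℝ, 0 ≤ C ∧ ∀ (τ : ℝ), 1 / 4 ≤ τ →
    ∀ g : 𝓢(ℝ, ℂ) × 𝓢(ℝ, ℂ), ∃ θ : 𝓢(ℝ, ℂ),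
      ‖(schwartzEquiv (oscOpW hω ha hc) g).toL2 - θ.toLp 2 volume‖ ≤ (τ ^ 2)⁻¹ * pairNorm g ∧
      ‖(mulX θ).toLp 2‖ ≤ C * Real.exp (2 * τ) * pairNorm g := by
  obtain ⟨M, hM0, hM⟩ := exists_bound_deriv_bump
  refine ⟨|1 / (2 * a)| + |a / ω| * (4 * M + 2), by positivity, fun τ hτ4 g => ?_⟩
  have hτ : 0 < τ := by linarith
  have hN0 := norm_nonneg (schwartzIncl g)
  have hN1 := norm_nonneg (schwartzIncl (pairDeriv 1 g))
  have hN2 := norm_nonneg (schwartzIncl (mulX (mulX g.1), mulX (mulX g.2)))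
  obtain ⟨η, hη⟩ := exists_schwartzU_eq (cutoff τ g.1, cutoff τ g.2) (2 * τ)
    (fun t ht => ⟨cutoff_eq_zero hτ _ ht.le, cutoff_eq_zero hτ _ ht.le⟩)
  obtain ⟨θ, hθ⟩ := oscW_surjective ω a hω ha c (const_ne_zero hω ha hc) η
  refine ⟨θ, ?_, ?_⟩
  · have h1 : ‖(schwartzEquiv (oscOpW hω ha hc) g).toL2 - θ.toLp 2 volume‖ =
        ‖schwartzIncl (g - (cutoff τ g.1, cutoff τ g.2))‖ := by
      rw [← ((oscOpW hω ha hc).trans opU).norm_map, map_sub, map_sub]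
      simp only [LinearIsometryEquiv.trans_apply]
      rw [opU_W_schwartzEquiv, opU_oscOpW_toLp, hθ, hη]
    rw [h1]
    have h2 := norm_schwartzIncl_le (F := g - (cutoff τ g.1, cutoff τ g.2))
      (G := (mulX (mulX g.1), mulX (mulX g.2))) (H := g) (A := (τ ^ 2)⁻¹) (B := 0)
      (by positivity) le_rfl
      (fun t => by
        rw [zero_mul, add_zero]; exact norm_sub_cutoff_le hτ g.1 t)
      (fun t => by
        rw [zero_mul, add_zero]; exact norm_sub_cutoff_le hτ g.2 t)
    refine h2.trans ?_
    rw [zero_mul, add_zero]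
    gcongr
    unfold pairNorm
    linarith
  · refine (norm_toLp_mulX_le hω ha hc θ).trans ?_
    rw [hθ]
    have hE : ∀ t : ℝ, |t| < 2 * τ → Real.exp t ≤ Real.exp (2 * τ) ∧
        Real.exp (-t) ≤ Real.exp (2 * τ) := fun t ht =>
      ⟨Real.exp_le_exp.2 ((le_abs_self t).trans ht.le),
        Real.exp_le_exp.2 ((neg_le_abs t).trans ht.le)⟩
    have hA : ∀ (f : 𝓢(ℝ, ℂ)) (t : ℝ),
        Real.exp t * ‖cutoff τ f t‖ ≤ Real.exp (2 * τ) * ‖f t‖ := fun f t => by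
      rcases lt_or_ge |t| (2 * τ) with ht | ht
      · exact mul_le_mul (hE t ht).1 (norm_cutoff_le hτ f t) (norm_nonneg _) (Real.exp_pos _).le
      · rw [cutoff_eq_zero hτ f ht, norm_zero, mul_zero]; positivity
    have hB : ∀ (f : 𝓢(ℝ, ℂ)) (t : ℝ),
        Real.exp (-t) * ‖derivCLM ℂ ℂ (cutoff τ f) t - 1 / 2 * cutoff τ f t‖ ≤
          Real.exp (2 * τ) * (4 * M + 1) * ‖f t‖ + Real.exp (2 * τ) * ‖deriv f t‖ := fun f t => by
      rcases lt_or_ge (2 * τ) |t| with ht | ht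
      · have hz : cutoff τ f =ᶠ[nhds t] fun _ => 0 := by
          filter_upwards [(isOpen_lt continuous_const continuous_abs).mem_nhds ht] with s hs
          exact cutoff_eq_zero hτ f (le_of_lt hs)
        have hd : deriv (cutoff τ f) t = 0 := by rw [hz.deriv_eq]; simp
        rw [derivCLM_apply, hd, hz.eq_of_nhds]
        simp only [mul_zero, sub_zero, norm_zero]
        positivity
      · have h1 := norm_deriv_cutoff_le hM hτ f t
        have h2 := norm_cutoff_le hτ f t
        have h3 : M / τ ≤ 4 * M := by
          rw [div_le_iff₀ hτ]; nlinarith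
        have h4 : ‖derivCLM ℂ ℂ (cutoff τ f) t - 1 / 2 * cutoff τ f t‖ ≤
            (4 * M + 1) * ‖f t‖ + ‖deriv f t‖ := by
          refine (norm_sub_le _ _).trans ?_
          rw [norm_mul]
          have h5 : ‖(1 / 2 : ℂ)‖ = 1 / 2 := by norm_num
          rw [h5]
          nlinarith [norm_nonneg (f t), norm_nonneg (cutoff τ f t),
            mul_le_mul_of_nonneg_right h3 (norm_nonneg (f t))]
        have h6 : Real.exp (-t) ≤ Real.exp (2 * τ) :=
          Real.exp_le_exp.2 ((neg_le_abs t).trans ht)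
        calc _ ≤ Real.exp (2 * τ) * ((4 * M + 1) * ‖f t‖ + ‖deriv f t‖) :=
              mul_le_mul h6 h4 (norm_nonneg _) (Real.exp_pos _).le
          _ = _ := by ring
    have h1 := norm_schwartzIncl_le (F := schwartzU (mulX η)) (G := g) (H := g)
      (A := Real.exp (2 * τ)) (B := 0) (Real.exp_pos _).le le_rfl
      (fun t => by
        rw [(schwartzU_mulX η t).1, hη, norm_mul, Complex.norm_real, Real.norm_eq_abs,
          Real.abs_exp, zero_mul, add_zero]
        exact hA g.1 t)
      (fun t => by
        rw [(schwartzU_mulX η t).2, hη, norm_mul, norm_neg, Complex.norm_real, Real.norm_eq_abs,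
          Real.abs_exp, zero_mul, add_zero]
        exact hA g.2 t)
    have h2 := norm_schwartzIncl_le (F := schwartzU (derivCLM ℂ ℂ η)) (G := g)
      (H := pairDeriv 1 g) (A := Real.exp (2 * τ) * (4 * M + 1)) (B := Real.exp (2 * τ))
      (by positivity) (Real.exp_pos _).le
      (fun t => by
        rw [(schwartzU_deriv η t).1, hη, norm_mul, Complex.norm_real, Real.norm_eq_abs,
          Real.abs_exp, pairDeriv_apply]
        simp only [one_smul]
        exact hB g.1 t)
      (fun t => by
        rw [(schwartzU_deriv η t).2, hη, norm_mul, norm_neg, Complex.norm_real, Real.norm_eq_abs,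
          Real.abs_exp, pairDeriv_apply]
        simp only [one_smul]
        exact hB g.2 t)
    rw [zero_mul, add_zero] at h1
    have h3 : ‖schwartzIncl g‖ ≤ pairNorm g := by unfold pairNorm; linarith
    have h4 : ‖schwartzIncl (pairDeriv 1 g)‖ ≤ pairNorm g := by unfold pairNorm; linarith
    calc _ ≤ |1 / (2 * a)| * (Real.exp (2 * τ) * pairNorm g) + |a / ω| *
          (Real.exp (2 * τ) * (4 * M + 1) * pairNorm g + Real.exp (2 * τ) * pairNorm g) := by
          gcongr
          · exact h1.trans (by gcongr)
          · exact h2.trans (by gcongr)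
      _ = _ := by ring

/-- The shells `e^k < |x| ≤ e^(k+1)`, with the ball `|x| ≤ e` as the first of them. -/
def shell (k : ℕ) : Set ℝ := {x | |x| ≤ Real.exp (k + 1) ∧ (k = 0 ∨ Real.exp k < |x|)}

theorem measurableSet_shell (k : ℕ) : MeasurableSet (shell k) :=
  (measurableSet_le measurable_norm measurable_const).inter
    ((MeasurableSet.const _).union (measurableSet_lt measurable_const measurable_norm))

theorem iUnion_shell : ⋃ k, shell k = Set.univ := by
  refine Set.eq_univ_of_forall fun x => Set.mem_iUnion.2 ?_
  have h : ∃ n : ℕ, |x| ≤ Real.exp (n + 1) := by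
    obtain ⟨n, hn⟩ := exists_nat_ge |x|
    exact ⟨n, hn.trans (by linarith [Real.add_one_le_exp ((n : ℝ) + 1)])⟩
  classical
  refine ⟨Nat.find h, Nat.find_spec h, ?_⟩
  rcases Nat.eq_zero_or_pos (Nat.find h) with h0 | h0
  · exact Or.inl h0
  · refine Or.inr ?_
    have h1 := Nat.find_min h (Nat.sub_lt h0 one_pos)
    rw [not_le] at h1
    have h2 : ((Nat.find h - 1 : ℕ) : ℝ) + 1 = Nat.find h := by
      have : 1 ≤ Nat.find h := h0
      push_cast [Nat.cast_sub this]
      ring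
    rwa [h2] at h1

theorem volume_shell_le (k : ℕ) : volume (shell k) ≤ ENNReal.ofReal (2 * Real.exp (k + 1)) := by
  have h : shell k ⊆ Set.Icc (-Real.exp (k + 1)) (Real.exp (k + 1)) := fun x hx => abs_le.1 hx.1
  refine (measure_mono h).trans ?_
  rw [Real.volume_Icc]
  exact ENNReal.ofReal_le_ofReal (by linarith)

/-- The `L²` norm of a test vector over the shells is summable. -/
theorem exists_eLpNorm_shell_le : ∃ C : ℝ, 0 ≤ C ∧ ∀ (k : ℕ) (g : 𝓢(ℝ, ℂ) × 𝓢(ℝ, ℂ)),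
    eLpNorm (schwartzEquiv (oscOpW hω ha hc) g).toL2 2 (volume.restrict (shell k)) ≤
      ENNReal.ofReal (C * (1 / ((k : ℝ) + 1) ^ 2) * pairNorm g) := by
  obtain ⟨C, hC0, hC⟩ := exists_schwartz_approx hω ha hc
  refine ⟨64 + 16 * C, by positivity, fun k g => ?_⟩
  set φ := (schwartzEquiv (oscOpW hω ha hc) g).toL2 with hφ
  have hP := pairNorm_nonneg g
  rcases Nat.eq_zero_or_pos k with rfl | hk
  · refine (eLpNorm_mono_measure _ Measure.restrict_le_self).trans ?_
    rw [← ENNReal.ofReal_toReal (Lp.eLpNorm_ne_top φ), ← Lp.norm_def]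
    refine ENNReal.ofReal_le_ofReal ?_
    have h1 : ‖φ‖ = ‖schwartzIncl g‖ := by
      rw [← opU_W_schwartzEquiv (oscOpW hω ha hc), LinearIsometryEquiv.norm_map,
        LinearIsometryEquiv.norm_map]
    have h2 : ‖φ‖ ≤ pairNorm g := by
      have hN1 := norm_nonneg (schwartzIncl (pairDeriv 1 g))
      have hN2 := norm_nonneg (schwartzIncl (mulX (mulX g.1), mulX (mulX g.2)))
      rw [h1]; unfold pairNorm; linarith
    have h3 : 0 ≤ C * pairNorm g := by positivity
    norm_num
    nlinarith
  · have hk1 : (1 : ℝ) ≤ k := by exact_mod_cast hk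
    -- At scale `τ = k/4` the loss `e^{2τ} = e^{k/2}` is beaten by the gain `|x|⁻¹ ≤ e^{-k}`.
    obtain ⟨θ, hθ1, hθ2⟩ := hC (k / 4) (by linarith) g
    set f1 := φ - θ.toLp 2 volume with hf1
    set f2 := (mulX θ).toLp 2 volume with hf2
    have hpt : ∀ᵐ x ∂(volume.restrict (shell k)),
        ‖φ x‖ ≤ ‖‖f1 x‖ + Real.exp (-k) * ‖f2 x‖‖ := by
      filter_upwards [ae_restrict_mem (measurableSet_shell k),
        ae_restrict_of_ae (Lp.coeFn_sub φ (θ.toLp 2 volume)),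
        ae_restrict_of_ae (θ.coeFn_toLp 2 volume),
        ae_restrict_of_ae ((mulX θ).coeFn_toLp 2 volume)] with x hx h1 h2 h3
      refine le_trans ?_ (le_abs_self _)
      have h4 : f1 x = φ x - θ x := by rw [hf1, h1, Pi.sub_apply, h2]
      have hx' : Real.exp k < |x| := hx.2.resolve_left (by omega)
      have h5 : ‖θ x‖ ≤ Real.exp (-k) * ‖f2 x‖ := by
        rw [hf2, h3, mulX_apply, norm_mul, Complex.norm_real, Real.norm_eq_abs, Real.exp_neg,
          ← mul_assoc, inv_mul_eq_div]
        refine le_mul_of_one_le_left (norm_nonneg _) ?_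
        rw [le_div_iff₀ (Real.exp_pos _)]
        linarith
      calc ‖φ x‖ = ‖f1 x + θ x‖ := by rw [h4, sub_add_cancel]
        _ ≤ ‖f1 x‖ + ‖θ x‖ := norm_add_le _ _
        _ ≤ _ := by gcongr
    have hexp : Real.exp (-k) * Real.exp (2 * (k / 4)) ≤ 16 * (1 / ((k : ℝ) + 1) ^ 2) := by
      rw [← Real.exp_add, show -(k : ℝ) + 2 * (k / 4) = -(k / 2) by ring, Real.exp_neg,
        mul_one_div, inv_eq_one_div, div_le_div_iff₀ (Real.exp_pos _) (by positivity), one_mul]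
      have h1 := Real.pow_div_factorial_le_exp ((k + 1 : ℝ) / 2) (by positivity) 2
      have h2 : Real.exp ((k + 1 : ℝ) / 2) = Real.exp (1 / 2) * Real.exp (k / 2) := by
        rw [← Real.exp_add]; ring_nf
      have h3 : Real.exp (1 / 2) ≤ 2 := by
        have h5 : Real.exp (1 / 2) ^ 2 ≤ 2 ^ 2 := by
          rw [← Real.exp_nat_mul]
          norm_num
          linarith [Real.exp_one_lt_d9]
        exact le_of_sq_le_sq h5 (by norm_num)
      have h4 := Real.exp_pos ((k : ℝ) / 2)
      rw [h2, show (Nat.factorial 2 : ℝ) = 2 by norm_num] at h1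
      nlinarith
    calc eLpNorm φ 2 (volume.restrict (shell k))
        ≤ eLpNorm (fun x => ‖f1 x‖ + Real.exp (-k) * ‖f2 x‖) 2 (volume.restrict (shell k)) :=
          eLpNorm_mono_ae hpt
      _ ≤ eLpNorm (fun x => ‖f1 x‖ + Real.exp (-k) * ‖f2 x‖) 2 volume :=
          eLpNorm_mono_measure _ Measure.restrict_le_self
      _ ≤ eLpNorm (fun x => ‖f1 x‖) 2 volume +
            eLpNorm (fun x => Real.exp (-k) * ‖f2 x‖) 2 volume :=
          eLpNorm_add_le (Lp.memLp f1).1.norm ((Lp.memLp f2).1.norm.const_mul _) (by norm_num)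
      _ = ENNReal.ofReal ‖f1‖ + ENNReal.ofReal (Real.exp (-k) * ‖f2‖) := by
          congr 1
          · rw [eLpNorm_norm, Lp.norm_def, ENNReal.ofReal_toReal (Lp.eLpNorm_ne_top f1)]
          · have h1 : (fun x => Real.exp (-k) * ‖f2 x‖) = Real.exp (-k) • fun x => ‖f2 x‖ := rfl
            rw [h1, eLpNorm_const_smul, eLpNorm_norm, Lp.norm_def,
              ENNReal.ofReal_mul (Real.exp_pos _).le,
              ENNReal.ofReal_toReal (Lp.eLpNorm_ne_top f2),
              Real.enorm_eq_ofReal (Real.exp_pos _).le]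
      _ = ENNReal.ofReal (‖f1‖ + Real.exp (-k) * ‖f2‖) :=
          (ENNReal.ofReal_add (norm_nonneg _) (by positivity)).symm
      _ ≤ _ := by
          refine ENNReal.ofReal_le_ofReal ?_
          have h1 : (((k : ℝ) / 4) ^ 2)⁻¹ ≤ 64 * (1 / ((k : ℝ) + 1) ^ 2) := by
            rw [mul_one_div, inv_eq_one_div, div_le_div_iff₀ (by positivity) (by positivity)]
            nlinarith
          calc ‖f1‖ + Real.exp (-k) * ‖f2‖
              ≤ (((k : ℝ) / 4) ^ 2)⁻¹ * pairNorm g +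
                  Real.exp (-k) * (C * Real.exp (2 * (k / 4)) * pairNorm g) := by gcongr
            _ = (((k : ℝ) / 4) ^ 2)⁻¹ * pairNorm g +
                  C * (Real.exp (-k) * Real.exp (2 * (k / 4))) * pairNorm g := by ring
            _ ≤ 64 * (1 / ((k : ℝ) + 1) ^ 2) * pairNorm g +
                  C * (16 * (1 / ((k : ℝ) + 1) ^ 2)) * pairNorm g := by gcongr
            _ = _ := by ring

/-- The weight `(1 + |x|)^(-1/2)`, the rate of decay of the generalized eigenfunctions. -/
def weight (x : ℝ) : ℝ := (Real.sqrt (1 + |x|))⁻¹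

theorem weight_nonneg (x : ℝ) : 0 ≤ weight x := by unfold weight; positivity

theorem continuous_weight : Continuous weight := by
  unfold weight
  refine Continuous.inv₀ (by fun_prop) fun x => ?_
  have := abs_nonneg x
  positivity

theorem weight_le_of_mem_shell {k : ℕ} {x : ℝ} (hx : x ∈ shell k) :
    weight x ≤ Real.exp (-(k / 2)) := by
  have h : Real.exp k ≤ 1 + |x| := by
    rcases hx.2 with h | h
    · rw [h]; simp
    · linarith
  rw [weight, Real.exp_neg, Real.exp_half]
  gcongr

/-- A test vector is integrable against `(1 + |x|)^(-1/2)`, with a continuous bound. -/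
theorem exists_lintegral_weight_le : ∃ C : ℝ, 0 ≤ C ∧ ∀ g : 𝓢(ℝ, ℂ) × 𝓢(ℝ, ℂ),
    ∫⁻ x, ‖(schwartzEquiv (oscOpW hω ha hc) g).toL2 x‖ₑ * ENNReal.ofReal (weight x) ≤
      ENNReal.ofReal (C * pairNorm g) := by
  obtain ⟨C, hC0, hC⟩ := exists_eLpNorm_shell_le hω ha hc
  set D : ℝ := Real.sqrt (2 * Real.exp 1) with hD
  have hsum : Summable fun k : ℕ => 1 / ((k : ℝ) + 1) ^ 2 := by
    have h := (summable_nat_add_iff 1).2 (Real.summable_one_div_nat_pow.2 (one_lt_two))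
    simpa using h
  refine ⟨(∑' k : ℕ, 1 / ((k : ℝ) + 1) ^ 2) * C * D, by positivity, fun g => ?_⟩
  have hP := pairNorm_nonneg g
  set φ := (schwartzEquiv (oscOpW hω ha hc) g).toL2 with hφ
  have hk : ∀ k : ℕ, ∫⁻ x in shell k, ‖φ x‖ₑ * ENNReal.ofReal (weight x) ≤
      ENNReal.ofReal (1 / ((k : ℝ) + 1) ^ 2 * (C * D * pairNorm g)) := fun k => by
    -- Cauchy-Schwarz: the factor `e^{k/2}` from the length of the shell cancels the weight.
    have h1 : ∫⁻ x in shell k, ‖φ x‖ₑ ≤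
        ENNReal.ofReal (C * (1 / ((k : ℝ) + 1) ^ 2) * pairNorm g) *
          ENNReal.ofReal (Real.sqrt (2 * Real.exp (k + 1))) := by
      have h2 := eLpNorm_le_eLpNorm_mul_rpow_measure_univ (p := 1) (q := 2)
        (μ := volume.restrict (shell k)) (by norm_num) (Lp.aestronglyMeasurable φ).restrict
      rw [eLpNorm_one_eq_lintegral_enorm] at h2
      refine h2.trans (mul_le_mul' (hC k g) ?_)
      rw [Measure.restrict_apply_univ]
      calc volume (shell k) ^ (1 / (1 : ℝ≥0∞).toReal - 1 / (2 : ℝ≥0∞).toReal)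
          ≤ ENNReal.ofReal (2 * Real.exp (k + 1)) ^ (1 / 2 : ℝ) := by
            rw [ENNReal.toReal_one, ENNReal.toReal_ofNat,
              show (1 / 1 - 1 / 2 : ℝ) = 1 / 2 by norm_num]
            exact ENNReal.rpow_le_rpow (volume_shell_le k) (by norm_num)
        _ = _ := by
            rw [ENNReal.ofReal_rpow_of_nonneg (by positivity) (by norm_num), Real.sqrt_eq_rpow]
    calc ∫⁻ x in shell k, ‖φ x‖ₑ * ENNReal.ofReal (weight x)
        ≤ ∫⁻ x in shell k, ‖φ x‖ₑ * ENNReal.ofReal (Real.exp (-(k / 2))) := by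
          refine lintegral_mono_ae ?_
          filter_upwards [ae_restrict_mem (measurableSet_shell k)] with x hx
          gcongr
          exact weight_le_of_mem_shell hx
      _ = (∫⁻ x in shell k, ‖φ x‖ₑ) * ENNReal.ofReal (Real.exp (-(k / 2))) :=
          lintegral_mul_const' _ _ ENNReal.ofReal_ne_top
      _ ≤ ENNReal.ofReal (C * (1 / ((k : ℝ) + 1) ^ 2) * pairNorm g) *
          ENNReal.ofReal (Real.sqrt (2 * Real.exp (k + 1))) *
            ENNReal.ofReal (Real.exp (-(k / 2))) := by gcongr
      _ = _ := by
          rw [← ENNReal.ofReal_mul (by positivity), ← ENNReal.ofReal_mul (by positivity)]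
          congr 1
          have h3 : Real.sqrt (2 * Real.exp (k + 1)) = D * Real.exp (k / 2) := by
            rw [hD, add_comm, Real.exp_add, ← mul_assoc, Real.sqrt_mul (by positivity),
              Real.exp_half]
          have h4 : Real.exp ((k : ℝ) / 2) * Real.exp (-(k / 2)) = 1 := by
            rw [← Real.exp_add]; simp
          rw [h3]
          linear_combination (C * (1 / ((k : ℝ) + 1) ^ 2) * pairNorm g * D) * h4
  calc ∫⁻ x, ‖φ x‖ₑ * ENNReal.ofReal (weight x)
      = ∫⁻ x in ⋃ k, shell k, ‖φ x‖ₑ * ENNReal.ofReal (weight x) := by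
        rw [iUnion_shell, Measure.restrict_univ]
    _ ≤ ∑' k, ∫⁻ x in shell k, ‖φ x‖ₑ * ENNReal.ofReal (weight x) := lintegral_iUnion_le _ _
    _ ≤ ∑' k : ℕ, ENNReal.ofReal (1 / ((k : ℝ) + 1) ^ 2 * (C * D * pairNorm g)) :=
        ENNReal.tsum_le_tsum hk
    _ = ENNReal.ofReal (∑' k : ℕ, 1 / ((k : ℝ) + 1) ^ 2 * (C * D * pairNorm g)) :=
        (ENNReal.ofReal_tsum_of_nonneg (fun k => by positivity) (hsum.mul_right _)).symm
    _ = _ := by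
        rw [tsum_mul_right]
        congr 1
        ring

end OscMatrix

/-! ### Tempered eigenfunctionals of the derivative -/

theorem norm_pow_mul_setIntegral_le (f : 𝓢(ℝ, ℂ)) (k : ℕ) (t : ℝ) {s : Set ℝ}
    (hs : MeasurableSet s) (hts : ∀ x ∈ s, |t| ≤ |x|) :
    |t| ^ k * ‖∫ x in s, f x‖ ≤ ∫ x, ‖x‖ ^ k * ‖f x‖ := by
  have hi : Integrable (fun x => ‖x‖ ^ k * ‖f x‖) := f.integrable_pow_mul volume k
  calc |t| ^ k * ‖∫ x in s, f x‖ ≤ |t| ^ k * ∫ x in s, ‖f x‖ := by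
        gcongr; exact norm_integral_le_integral_norm _
    _ = ∫ x in s, |t| ^ k * ‖f x‖ := (integral_const_mul _ _).symm
    _ ≤ ∫ x in s, ‖x‖ ^ k * ‖f x‖ := by
        refine setIntegral_mono_on (f.integrable.norm.const_mul _).integrableOn
          hi.integrableOn hs ?_
        intro x hx
        gcongr
        exact hts x hx
    _ ≤ ∫ x, ‖x‖ ^ k * ‖f x‖ := setIntegral_le_integral hi (.of_forall fun x => by positivity)

/-- A Schwartz function with vanishing integral has a Schwartz primitive. -/
theorem exists_derivCLM_eq (f : 𝓢(ℝ, ℂ)) (hf : ∫ x, f x = 0) :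
    ∃ G : 𝓢(ℝ, ℂ), derivCLM ℂ ℂ G = f := by
  set G : ℝ → ℂ := fun t => ∫ x in Set.Iic t, f x with hG
  have hd : ∀ t, HasDerivAt G (f t) t := fun t => by
    have h1 : ∀ t, G t = G 0 + ∫ x in (0 : ℝ)..t, f x := fun t => by
      have h := intervalIntegral.integral_Iic_sub_Iic (a := 0) (b := t)
        (f.integrable (μ := volume)).integrableOn (f.integrable (μ := volume)).integrableOn
      rw [← h]
      simp only [hG]
      ring
    have h2 : HasDerivAt (fun t => G 0 + ∫ x in (0 : ℝ)..t, f x) (f t) t :=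
      (f.continuous.integral_hasStrictDerivAt 0 t).hasDerivAt.const_add _
    rwa [← funext h1] at h2
  have hdG : deriv G = f := funext fun t => (hd t).deriv
  have hG2 : ∀ t, G t = -∫ x in Set.Ioi t, f x := fun t => by
    have h := integral_add_compl (measurableSet_Iic (a := t)) (f.integrable (μ := volume))
    rw [hf, Set.compl_Iic] at h
    exact eq_neg_of_add_eq_zero_left h
  have hdecay : ∀ k n : ℕ, ∃ C, ∀ t, ‖t‖ ^ k * ‖iteratedFDeriv ℝ n G t‖ ≤ C := by
    intro k n
    rcases n with _ | n
    · refine ⟨∫ x, ‖x‖ ^ k * ‖f x‖, fun t => ?_⟩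
      rw [norm_iteratedFDeriv_zero, Real.norm_eq_abs]
      rcases le_total t 0 with ht | ht
      · refine norm_pow_mul_setIntegral_le f k t measurableSet_Iic fun x hx => ?_
        have hx' : x ≤ t := hx
        rw [abs_of_nonpos ht, abs_of_nonpos (hx'.trans ht)]
        linarith
      · rw [hG2, norm_neg]
        refine norm_pow_mul_setIntegral_le f k t measurableSet_Ioi fun x hx => ?_
        have hx' : t < x := hx
        rw [abs_of_nonneg ht, abs_of_nonneg (ht.trans hx'.le)]
        linarith
    · obtain ⟨C, hC⟩ := f.decay' k n
      refine ⟨C, fun t => ?_⟩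
      rw [norm_iteratedFDeriv_eq_norm_iteratedDeriv, iteratedDeriv_succ', hdG,
        ← norm_iteratedFDeriv_eq_norm_iteratedDeriv]
      exact hC t
  have hsmooth : ContDiff ℝ (⊤ : ℕ∞) G := by
    rw [contDiff_infty_iff_deriv, hdG]
    exact ⟨fun t => (hd t).differentiableAt, f.smooth'⟩
  refine ⟨⟨G, hsmooth, hdecay⟩, ?_⟩
  ext t
  exact (hd t).deriv

theorem exists_integral_eq_one : ∃ ρ : 𝓢(ℝ, ℂ), ∫ x, ρ x = 1 := by
  have hs : HasCompactSupport (fun x => (bump.normed volume x : ℂ)) :=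
    (bump.hasCompactSupport_normed (μ := volume)).comp_left (g := fun y : ℝ => (y : ℂ))
      Complex.ofReal_zero
  refine ⟨hs.toSchwartzMap (Complex.ofRealCLM.contDiff.comp bump.contDiff_normed), ?_⟩
  change ∫ x, ((bump.normed volume x : ℝ) : ℂ) = 1
  rw [integral_complex_ofReal, bump.integral_normed, Complex.ofReal_one]

/-- A linear functional on Schwartz functions that vanishes on derivatives is a multiple of the
integral. -/
theorem exists_eq_mul_integral (T : 𝓢(ℝ, ℂ) →ₗ[ℂ] ℂ) (hT : ∀ f, T (derivCLM ℂ ℂ f) = 0) :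
    ∃ C : ℂ, ∀ f, T f = C * ∫ x, f x := by
  obtain ⟨ρ, hρ⟩ := exists_integral_eq_one
  refine ⟨T ρ, fun f => ?_⟩
  obtain ⟨G, hG⟩ := exists_derivCLM_eq (f - (∫ x, f x) • ρ) (by
    simp only [sub_apply, smul_apply, smul_eq_mul]
    rw [integral_sub f.integrable (ρ.integrable.const_mul _), integral_const_mul, hρ, mul_one,
      sub_self])
  have h := hT G
  rw [hG, map_sub, map_smul, smul_eq_mul, sub_eq_zero] at h
  rw [h, mul_comm]

/-- Multiplication by `e^{iσt}`. -/
def mulChar (σ : ℝ) : 𝓢(ℝ, ℂ) →L[ℂ] 𝓢(ℝ, ℂ) :=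
  smulLeftCLM ℂ (fun t : ℝ => Complex.exp (Complex.I * σ * t))

theorem mulChar_apply (σ : ℝ) (f : 𝓢(ℝ, ℂ)) (t : ℝ) :
    mulChar σ f t = Complex.exp (Complex.I * σ * t) * f t := by
  rw [mulChar, smulLeftCLM_apply_apply (hasTemperateGrowth_cexp_linear σ), smul_eq_mul]

theorem mulChar_neg_mulChar (σ : ℝ) (f : 𝓢(ℝ, ℂ)) : mulChar σ (mulChar (-σ) f) = f := by
  ext t
  rw [mulChar_apply, mulChar_apply, ← mul_assoc, ← Complex.exp_add]
  push_cast
  ring_nf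
  simp

theorem derivCLM_mulChar (σ : ℝ) (f : 𝓢(ℝ, ℂ)) :
    derivCLM ℂ ℂ (mulChar σ f) = mulChar σ (derivCLM ℂ ℂ f) + (Complex.I * σ) • mulChar σ f := by
  ext t
  have h1 : (mulChar σ f : ℝ → ℂ) = fun t : ℝ => Complex.exp (Complex.I * σ * t) * f t :=
    funext (mulChar_apply σ f)
  have h2 : HasDerivAt (fun t : ℝ => (t : ℂ)) 1 t := Complex.ofRealCLM.hasDerivAt (x := t)
  have h3 : deriv (fun t : ℝ => Complex.exp (Complex.I * σ * t) * f t) t = _ :=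
    ((h2.const_mul (Complex.I * σ)).cexp.mul (f.hasDerivAt t)).deriv
  simp only [add_apply, smul_apply, smul_eq_mul, mulChar_apply, derivCLM_apply]
  rw [h1, h3]
  ring

/-- The functional `f ↦ ∫ e^{-iσt} f(t) dt`. -/
def fourierFunctional (σ : ℝ) : 𝓢(ℝ, ℂ) →L[ℂ] ℂ := integralCLM ℂ volume ∘L mulChar (-σ)

theorem fourierFunctional_deriv (σ : ℝ) (f : 𝓢(ℝ, ℂ)) :
    fourierFunctional σ (derivCLM ℂ ℂ f) = Complex.I * σ * fourierFunctional σ f := by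
  have h0 : ∀ f : 𝓢(ℝ, ℂ), integralCLM ℂ volume (derivCLM ℂ ℂ f) = 0 := fun f =>
    integral_eq_zero_of_hasDerivAt_of_integrable (fun t => f.hasDerivAt t)
      (derivCLM ℂ ℂ f).integrable f.integrable
  have h := h0 (mulChar (-σ) f)
  rw [derivCLM_mulChar, map_add, map_smul, smul_eq_mul] at h
  simp only [fourierFunctional, ContinuousLinearMap.comp_apply]
  push_cast at h
  linear_combination h

theorem fourierFunctional_ne_zero (σ : ℝ) : fourierFunctional σ ≠ 0 := by
  obtain ⟨ρ, hρ⟩ := exists_integral_eq_one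
  intro h
  have h1 : fourierFunctional σ (mulChar σ ρ) = 1 := by
    have h2 := mulChar_neg_mulChar (-σ) ρ
    rw [neg_neg] at h2
    rw [fourierFunctional, ContinuousLinearMap.comp_apply, h2, integralCLM_apply, hρ]
  rw [h] at h1
  simp at h1

/-- The eigenspace of the derivative for the eigenvalue `iσ` is one-dimensional. -/
theorem exists_eq_mul_fourierFunctional (σ : ℝ) (T : 𝓢(ℝ, ℂ) →ₗ[ℂ] ℂ)
    (hT : ∀ f, T (derivCLM ℂ ℂ f) = Complex.I * σ * T f) :
    ∃ C : ℂ, ∀ f, T f = C * fourierFunctional σ f := by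
  obtain ⟨C, hC⟩ := exists_eq_mul_integral (T ∘ₗ (mulChar σ).toLinearMap) (fun f => by
    have h := hT (mulChar σ f)
    rw [derivCLM_mulChar, map_add, map_smul, smul_eq_mul] at h
    simpa using h)
  refine ⟨C, fun f => ?_⟩
  have h := hC (mulChar (-σ) f)
  have h1 : (T ∘ₗ (mulChar σ).toLinearMap) (mulChar (-σ) f) = T (mulChar σ (mulChar (-σ) f)) := rfl
  rw [h1, mulChar_neg_mulChar] at h
  exact h

/-- For `μ` off the imaginary axis the operator `d/dt - μ` is surjective on Schwartz functions:
its symbol `2πiξ - μ` has an inverse of temperate growth. -/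
theorem exists_derivCLM_sub_smul_eq (μ : ℂ) (hμ : μ.re ≠ 0) (f : 𝓢(ℝ, ℂ)) :
    ∃ G : 𝓢(ℝ, ℂ), derivCLM ℂ ℂ G - μ • G = f := by
  set y : ℝ → ℝ := fun ξ => (2 * Real.pi * ξ - μ.im) / μ.re with hy
  have hyt : y.HasTemperateGrowth := by
    simp only [hy, div_eq_mul_inv]
    fun_prop
  have hr : (fun ξ => (1 + ‖y ξ‖ ^ 2) ^ (-1 : ℝ)).HasTemperateGrowth :=
    (Function.hasTemperateGrowth_one_add_norm_sq_rpow ℝ (-1)).comp hyt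
  have hr' : (fun ξ => (((1 + ‖y ξ‖ ^ 2) ^ (-1 : ℝ) : ℝ) : ℂ)).HasTemperateGrowth :=
    Function.Complex.hasTemperateGrowth_ofReal.comp hr
  -- The inverse of the symbol, as its conjugate over its squared modulus `μ.re² (1 + y²)`.
  set m : ℝ → ℂ := fun ξ => ((μ.re : ℂ) ^ 2)⁻¹ * (-(2 * Real.pi * Complex.I) * ξ -
    starRingEnd ℂ μ) * (((1 + ‖y ξ‖ ^ 2) ^ (-1 : ℝ) : ℝ) : ℂ) with hm
  have hmt : m.HasTemperateGrowth := by
    simp only [hm]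
    fun_prop
  have hmul : ∀ ξ : ℝ, (2 * Real.pi * Complex.I * ξ - μ) * m ξ = 1 := by
    intro ξ
    have h1 : (μ.re : ℂ) ≠ 0 := by exact_mod_cast hμ
    have h2 : (2 * Real.pi * Complex.I * ξ - μ) *
        (-(2 * Real.pi * Complex.I) * ξ - starRingEnd ℂ μ) =
          (((2 * Real.pi * ξ - μ.im) ^ 2 + μ.re ^ 2 : ℝ) : ℂ) := by
      have hc : starRingEnd ℂ μ = μ.re - μ.im * Complex.I := by apply Complex.ext <;> simp
      rw [hc]
      push_cast
      linear_combination (-(2 * Real.pi * Complex.I) * ξ - (μ.re - μ.im * Complex.I)) *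
        Complex.re_add_im μ - (2 * Real.pi * ξ - μ.im : ℂ) ^ 2 * Complex.I_sq
    have h3 : (2 * Real.pi * ξ - μ.im) ^ 2 + μ.re ^ 2 = μ.re ^ 2 * (1 + ‖y ξ‖ ^ 2) := by
      rw [hy, Real.norm_eq_abs, sq_abs]
      field_simp
      ring
    have h4 : (0 : ℝ) < 1 + ‖y ξ‖ ^ 2 := by positivity
    have h5 : ((1 + ‖y ξ‖ ^ 2 : ℝ) : ℂ) * ((1 + ‖y ξ‖ ^ 2 : ℝ) : ℂ)⁻¹ = 1 :=
      mul_inv_cancel₀ (by exact_mod_cast h4.ne')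
    have h6 : (μ.re : ℂ) ^ 2 * ((μ.re : ℂ) ^ 2)⁻¹ = 1 := mul_inv_cancel₀ (pow_ne_zero 2 h1)
    rw [h3] at h2
    simp only [hm, Real.rpow_neg_one]
    rw [Complex.ofReal_inv, ← mul_assoc, mul_left_comm, ← mul_assoc, mul_assoc _ _ (_ - _), h2]
    rw [Complex.ofReal_mul, Complex.ofReal_pow]
    linear_combination ((μ.re : ℂ) ^ 2 * ((μ.re : ℂ) ^ 2)⁻¹) * h5 + h6
  set G : 𝓢(ℝ, ℂ) := 𝓕⁻ (smulLeftCLM ℂ m (𝓕 f)) with hG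
  have hFG : 𝓕 G = smulLeftCLM ℂ m (𝓕 f) := fourier_fourierInv_eq _
  refine ⟨G, ?_⟩
  suffices h : 𝓕 (derivCLM ℂ ℂ G - μ • G) = 𝓕 f by
    rw [← fourierInv_fourier_eq (F := 𝓢(ℝ, ℂ)) (derivCLM ℂ ℂ G - μ • G), h,
      fourierInv_fourier_eq]
  ext ξ
  rw [sub_eq_add_neg, ← neg_smul, FourierTransform.fourier_add, FourierTransform.fourier_smul,
    add_apply, smul_apply, fourier_derivCLM_apply, hFG, smulLeftCLM_apply_apply hmt]
  simp only [smul_eq_mul]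
  linear_combination (𝓕 f : 𝓢(ℝ, ℂ)) ξ * hmul ξ

/-- The derivative has no eigenfunctional whose eigenvalue is off the imaginary axis. -/
theorem eq_zero_of_deriv_eigenvector (μ : ℂ) (hμ : μ.re ≠ 0) (T : 𝓢(ℝ, ℂ) →ₗ[ℂ] ℂ)
    (hT : ∀ f, T (derivCLM ℂ ℂ f) = μ * T f) : T = 0 := by
  ext f
  obtain ⟨G, rfl⟩ := exists_derivCLM_sub_smul_eq μ hμ f
  rw [map_sub, hT, map_smul, smul_eq_mul, sub_self, LinearMap.zero_apply]

/-! ### Growth of the solutions of `y'' = -(r + ω² x²) y` -/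

/-- The energy `(z² + (r + ω² x²) y²)/x + y z/x²` of a solution `y` with `y' = z`. The correction
`y z/x²` cancels the non-integrable terms, so that the derivative is `O(x⁻³)` times the energy. -/
theorem hasDerivAt_energy {ω r : ℝ} {y z : ℝ → ℝ} {x : ℝ} (hx : 0 < x)
    (hy : HasDerivAt y (z x) x) (hz : HasDerivAt z (-(r + ω ^ 2 * x ^ 2) * y x) x) :
    HasDerivAt (fun x => (z x ^ 2 + (r + ω ^ 2 * x ^ 2) * y x ^ 2) / x + y x * z x / x ^ 2)
      (-(2 * r / x ^ 2 * y x ^ 2) - 2 / x ^ 3 * (y x * z x)) x := by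
  have hid := hasDerivAt_id x
  have h1 := ((hz.pow 2).add ((((hid.pow 2).const_mul (ω ^ 2)).const_add r).mul
    (hy.pow 2))).div hid hx.ne'
  have h2 := (hy.mul hz).div (hid.pow 2) (pow_ne_zero 2 hx.ne')
  convert! h1.add h2 using 1
  simp only [id_eq, Pi.pow_apply, Pi.mul_apply, Pi.add_apply]
  push_cast
  field_simp
  ring

/-- For large `x` the energy `E` dominates half of `Q = z²/x + ω² x y²`, and `E' ≤ K x⁻³ E`; as
`x⁻³` is integrable at infinity, `E` and hence `Q` stay bounded. -/
theorem exists_energy_bound {ω r : ℝ} (hω : ω ≠ 0) {y z : ℝ → ℝ}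
    (hy : ∀ x, HasDerivAt y (z x) x) (hz : ∀ x, HasDerivAt z (-(r + ω ^ 2 * x ^ 2) * y x) x) :
    ∃ X M : ℝ, 1 ≤ X ∧ ∀ x, X ≤ x → z x ^ 2 / x + ω ^ 2 * x * y x ^ 2 ≤ M := by
  have hω' : 0 < |ω| := abs_pos.2 hω
  set X : ℝ := 1 + 2 / |ω| + 4 * |r| / ω ^ 2 with hX
  have hX1 : 1 ≤ X := by
    have : 0 ≤ 2 / |ω| + 4 * |r| / ω ^ 2 := by positivity
    linarith
  set E : ℝ → ℝ := fun x => (z x ^ 2 + (r + ω ^ 2 * x ^ 2) * y x ^ 2) / x + y x * z x / x ^ 2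
    with hE
  set Q : ℝ → ℝ := fun x => z x ^ 2 / x + ω ^ 2 * x * y x ^ 2 with hQ
  set K : ℝ := 4 * |r| / ω ^ 2 + 2 / |ω| with hK
  have hK0 : 0 ≤ K := by positivity
  have hyz : ∀ x, 0 < x → |y x * z x| ≤ Q x / (2 * |ω|) := fun x hx => by
    rw [le_div_iff₀ (by positivity), abs_mul]
    have h1 : 0 ≤ (|z x| - |ω| * x * |y x|) ^ 2 / x := by positivity
    have h2 : (|z x| - |ω| * x * |y x|) ^ 2 / x = Q x - |y x| * |z x| * (2 * |ω|) := by
      simp only [hQ]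
      rw [← sq_abs (z x), ← sq_abs (y x), ← sq_abs ω]
      field_simp
      ring
    linarith
  have hQ0 : ∀ x, 0 < x → 0 ≤ Q x := fun x hx => by simp only [hQ]; positivity
  have hyQ : ∀ x, 0 < x → y x ^ 2 ≤ Q x / (ω ^ 2 * x) := fun x hx => by
    rw [le_div_iff₀ (by positivity)]
    simp only [hQ]
    have : 0 ≤ z x ^ 2 / x := by positivity
    linarith
  have hlow : ∀ x, X ≤ x → Q x / 2 ≤ E x := fun x hx => by
    have hx1 : 1 ≤ x := hX1.trans hx
    have hx0 : 0 < x := by linarith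
    have hxx : x ≤ x ^ 2 := by nlinarith
    have h1 : E x = Q x + r * y x ^ 2 / x + y x * z x / x ^ 2 := by
      simp only [hE, hQ]; field_simp; ring
    have h2 : |r * y x ^ 2 / x| ≤ Q x / 4 := by
      rw [abs_div, abs_mul, abs_of_pos hx0, abs_of_nonneg (sq_nonneg (y x)), div_le_iff₀ hx0]
      have h3 : 4 * |r| ≤ ω ^ 2 * x ^ 2 := by
        have h5 : 4 * |r| / ω ^ 2 ≤ x := by
          have : 0 ≤ 2 / |ω| := by positivity
          linarith
        rw [div_le_iff₀ (by positivity)] at h5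
        nlinarith [sq_nonneg ω]
      have h4 := hyQ x hx0
      rw [le_div_iff₀ (by positivity)] at h4
      nlinarith [sq_nonneg (y x)]
    have h3 : |y x * z x / x ^ 2| ≤ Q x / 4 := by
      rw [abs_div, abs_of_pos (by positivity : 0 < x ^ 2), div_le_iff₀ (by positivity)]
      refine (hyz x hx0).trans ?_
      rw [div_le_iff₀ (by positivity)]
      have h5 : 2 ≤ |ω| * x ^ 2 := by
        have h6 : 2 / |ω| ≤ x := by
          have : 0 ≤ 4 * |r| / ω ^ 2 := by positivity
          linarith
        rw [div_le_iff₀ hω'] at h6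
        nlinarith
      nlinarith [hQ0 x hx0]
    rw [h1]
    linarith [neg_le_of_abs_le h2, neg_le_of_abs_le h3]
  have hder : ∀ x, X ≤ x → -(2 * r / x ^ 2 * y x ^ 2) - 2 / x ^ 3 * (y x * z x) ≤
      K / x ^ 3 * E x := fun x hx => by
    have hx0 : 0 < x := by linarith
    have h1 : -(2 * r / x ^ 2 * y x ^ 2) ≤ 2 * |r| / x ^ 2 * (Q x / (ω ^ 2 * x)) := by
      have h3 : -(2 * r / x ^ 2 * y x ^ 2) ≤ 2 * |r| / x ^ 2 * y x ^ 2 := by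
        rw [← neg_mul, ← neg_div]
        gcongr
        linarith [neg_le_abs r]
      exact h3.trans (mul_le_mul_of_nonneg_left (hyQ x hx0) (by positivity))
    have h2 : -(2 / x ^ 3 * (y x * z x)) ≤ 2 / x ^ 3 * (Q x / (2 * |ω|)) := by
      rw [← mul_neg]
      exact mul_le_mul_of_nonneg_left ((neg_le_abs _).trans (hyz x hx0)) (by positivity)
    have h3 : 2 * |r| / x ^ 2 * (Q x / (ω ^ 2 * x)) + 2 / x ^ 3 * (Q x / (2 * |ω|)) =
        K / x ^ 3 * (Q x / 2) := by
      simp only [hK]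
      rw [← sq_abs ω]
      field_simp
      ring
    have h4 : K / x ^ 3 * (Q x / 2) ≤ K / x ^ 3 * E x :=
      mul_le_mul_of_nonneg_left (hlow x hx) (by positivity)
    linarith
  -- The integrating factor for `E' ≤ K x⁻³ E`.
  set g : ℝ → ℝ := fun x => E x * Real.exp (K / 2 * (x ^ 2)⁻¹) with hg
  have hgd : ∀ x, X ≤ x → HasDerivAt g (Real.exp (K / 2 * (x ^ 2)⁻¹) *
      (-(2 * r / x ^ 2 * y x ^ 2) - 2 / x ^ 3 * (y x * z x) - K / x ^ 3 * E x)) x := fun x hx => by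
    have hx0 : 0 < x := by linarith
    have h1 := hasDerivAt_energy hx0 (hy x) (hz x)
    have h2 := ((((hasDerivAt_id x).pow 2).inv (pow_ne_zero 2 hx0.ne')).const_mul (K / 2)).exp
    convert! h1.mul h2 using 1
    simp only [hE, id_eq, Pi.pow_apply, Pi.inv_apply]
    push_cast
    field_simp
    ring
  have hanti : AntitoneOn g (Set.Ici X) := by
    refine antitoneOn_of_deriv_nonpos (convex_Ici X)
      (fun x hx => (hgd x hx).continuousAt.continuousWithinAt)
      (fun x hx => (hgd x (interior_subset hx)).differentiableAt.differentiableWithinAt) ?_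
    intro x hx
    have hx' : X ≤ x := interior_subset hx
    rw [(hgd x hx').deriv]
    exact mul_nonpos_of_nonneg_of_nonpos (Real.exp_pos _).le (by linarith [hder x hx'])
  refine ⟨X, 2 * g X, hX1, fun x hx => ?_⟩
  have hx0 : 0 < x := by linarith
  have h1 : g x ≤ g X := hanti (Set.mem_Ici.2 le_rfl) hx hx
  have h2 : E x ≤ g x := by
    refine le_mul_of_one_le_right ((by linarith [hQ0 x hx0] : 0 ≤ Q x / 2).trans (hlow x hx)) ?_
    exact Real.one_le_exp (by positivity)
  have h3 := hlow x hx
  change Q x ≤ _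
  linarith

theorem exists_bound_of_nonneg {ω r : ℝ} (hω : ω ≠ 0) {y z : ℝ → ℝ}
    (hy : ∀ x, HasDerivAt y (z x) x) (hz : ∀ x, HasDerivAt z (-(r + ω ^ 2 * x ^ 2) * y x) x) :
    ∃ C : ℝ, ∀ x, 0 ≤ x → y x ^ 2 * (1 + x) ≤ C ∧ z x ^ 2 ≤ C * (1 + x) := by
  obtain ⟨X, M, hX, hM⟩ := exists_energy_bound hω hy hz
  have hcy : Continuous y := continuous_iff_continuousAt.2 fun x => (hy x).continuousAt
  have hcz : Continuous z := continuous_iff_continuousAt.2 fun x => (hz x).continuousAt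
  obtain ⟨A, hA⟩ := (isCompact_Icc (a := (0 : ℝ)) (b := X)).bddAbove_image
    (f := fun x => y x ^ 2 * (1 + x)) (by fun_prop)
  obtain ⟨B, hB⟩ := (isCompact_Icc (a := (0 : ℝ)) (b := X)).bddAbove_image
    (f := fun x => z x ^ 2) (by fun_prop)
  refine ⟨|A| + |B| + |M| + 2 * |M| / ω ^ 2, fun x hx => ?_⟩
  have hω2 : 0 < ω ^ 2 := by positivity
  have hA0 := abs_nonneg A
  have hB0 := abs_nonneg B
  have hM0 := abs_nonneg M
  have hD0 : 0 ≤ 2 * |M| / ω ^ 2 := by positivity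
  rcases le_total x X with h | h
  · have h1 : y x ^ 2 * (1 + x) ≤ A := hA ⟨x, ⟨hx, h⟩, rfl⟩
    have h2 : z x ^ 2 ≤ B := hB ⟨x, ⟨hx, h⟩, rfl⟩
    constructor
    · linarith [le_abs_self A]
    · nlinarith [le_abs_self B]
  · have hx1 : 1 ≤ x := hX.trans h
    have h1 : z x ^ 2 / x + ω ^ 2 * x * y x ^ 2 ≤ |M| := (hM x h).trans (le_abs_self M)
    have h2 : 0 ≤ z x ^ 2 / x := by positivity
    have h3 : 0 ≤ ω ^ 2 * x * y x ^ 2 := by positivity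
    constructor
    · have h4 : y x ^ 2 * (1 + x) ≤ 2 * |M| / ω ^ 2 := by
        rw [le_div_iff₀ hω2]
        have h5 : ω ^ 2 * (y x ^ 2) ≤ ω ^ 2 * x * y x ^ 2 := by
          nlinarith [mul_nonneg hω2.le (sq_nonneg (y x))]
        nlinarith
      linarith
    · have h4 : z x ^ 2 ≤ |M| * x := by
        rw [← div_le_iff₀ (by linarith)]; linarith
      nlinarith

/-- Solutions of `ψ'' = -(r + ω² x²) ψ` are `O(|x|^(-1/2))`, their derivatives `O(|x|^(1/2))`. -/
theorem exists_bound_of_ode {ω r : ℝ} (hω : ω ≠ 0) {ψ ψ' : ℝ → ℂ}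
    (h1 : ∀ x, HasDerivAt ψ (ψ' x) x)
    (h2 : ∀ x : ℝ, HasDerivAt ψ' (-(r + (ω : ℂ) ^ 2 * (x : ℂ) ^ 2) * ψ x) x) :
    ∃ C : ℝ, 0 ≤ C ∧ ∀ x, ‖ψ x‖ ≤ C * weight x ∧ ‖ψ' x‖ ≤ C * (1 + |x|) * weight x := by
  -- The coefficients are real, so the real and imaginary parts solve the same equation; the
  -- reflection `x ↦ -x` reduces negative to positive arguments.
  have key : ∀ L : ℂ →L[ℝ] ℝ, ∃ C : ℝ, ∀ x, L (ψ x) ^ 2 * (1 + |x|) ≤ C ∧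
      L (ψ' x) ^ 2 ≤ C * (1 + |x|) := by
    intro L
    have hy : ∀ x, HasDerivAt (fun x => L (ψ x)) (L (ψ' x)) x := fun x =>
      L.hasFDerivAt.comp_hasDerivAt x (h1 x)
    have hz : ∀ x, HasDerivAt (fun x => L (ψ' x)) (-(r + ω ^ 2 * x ^ 2) * L (ψ x)) x := fun x => by
      have h := L.hasFDerivAt.comp_hasDerivAt x (h2 x)
      have h3 : L (-(r + (ω : ℂ) ^ 2 * (x : ℂ) ^ 2) * ψ x) = -(r + ω ^ 2 * x ^ 2) * L (ψ x) := by
        rw [← smul_eq_mul (-(r + ω ^ 2 * x ^ 2)), ← L.map_smul, Complex.real_smul]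
        push_cast
        rfl
      rwa [h3] at h
    obtain ⟨A, hA⟩ := exists_bound_of_nonneg hω hy hz
    have hy' : ∀ x, HasDerivAt (fun x => L (ψ (-x))) (-L (ψ' (-x))) x := fun x => by
      exact ((hy (-x)).scomp x (hasDerivAt_neg x)).congr_deriv (by simp)
    have hz' : ∀ x, HasDerivAt (fun x => -L (ψ' (-x))) (-(r + ω ^ 2 * x ^ 2) * L (ψ (-x))) x :=
      fun x => by
        exact ((hz (-x)).scomp x (hasDerivAt_neg x)).neg.congr_deriv (by simp)
    obtain ⟨B, hB⟩ := exists_bound_of_nonneg hω hy' hz'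
    refine ⟨max A B, fun x => ?_⟩
    have h0 := abs_nonneg x
    rcases le_total 0 x with hx | hx
    · have h := hA x hx
      rw [abs_of_nonneg hx]
      exact ⟨h.1.trans (le_max_left _ _), h.2.trans (by gcongr; exact le_max_left _ _)⟩
    · have h := hB (-x) (by linarith)
      simp only [neg_neg, neg_sq] at h
      rw [abs_of_nonpos hx]
      exact ⟨h.1.trans (le_max_right _ _), h.2.trans (by gcongr; linarith; exact le_max_right _ _)⟩
  obtain ⟨A, hA⟩ := key Complex.reCLM
  obtain ⟨B, hB⟩ := key Complex.imCLM
  simp only [Complex.reCLM_apply, Complex.imCLM_apply] at hA hB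
  refine ⟨Real.sqrt (A + B), Real.sqrt_nonneg _, fun x => ?_⟩
  have h0 : 0 < 1 + |x| := by positivity
  have hsq : ∀ w : ℂ, ‖w‖ ^ 2 = w.re ^ 2 + w.im ^ 2 := fun w => by
    rw [← Complex.normSq_eq_norm_sq, Complex.normSq_apply]; ring
  have hAB : 0 ≤ A + B := by
    have := (hA x).1
    have := (hB x).1
    have h3 : 0 ≤ ‖ψ x‖ ^ 2 * (1 + |x|) := by positivity
    rw [hsq] at h3
    linarith
  have hs := Real.sq_sqrt h0.le
  have hs0 := Real.sqrt_pos.2 h0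
  have hAB2 := Real.sq_sqrt hAB
  constructor
  · rw [weight, ← div_eq_mul_inv, le_div_iff₀ hs0]
    refine Real.le_sqrt_of_sq_le ?_
    rw [mul_pow, hs, hsq]
    linarith [(hA x).1, (hB x).1]
  · have h3 : Real.sqrt (A + B) * (1 + |x|) * weight x = Real.sqrt ((A + B) * (1 + |x|)) := by
      rw [weight, Real.sqrt_mul hAB, ← div_eq_mul_inv, div_eq_iff hs0.ne', mul_assoc, ← sq, hs]
    rw [h3]
    refine Real.le_sqrt_of_sq_le ?_
    rw [hsq]
    linarith [(hA x).2, (hB x).2]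

/-! ### The Kummer function -/

/-- The power series with coefficients `c` converges absolutely everywhere. -/
def IsEntireSeries (c : ℕ → ℂ) : Prop := ∀ R : ℝ, 0 < R → Summable fun n => ‖c n‖ * R ^ n

theorem IsEntireSeries.summable {c : ℕ → ℂ} (h : IsEntireSeries c) (z : ℂ) :
    Summable fun n => c n * z ^ n := by
  refine Summable.of_norm_bounded (h (‖z‖ + 1) (by positivity)) fun n => ?_
  rw [norm_mul, norm_pow]
  gcongr
  linarith

theorem IsEntireSeries.nat_mul {c : ℕ → ℂ} (h : IsEntireSeries c) :
    IsEntireSeries fun n => n * c n := by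
  intro R hR
  refine Summable.of_nonneg_of_le (fun n => by positivity) (fun n => ?_) (h (2 * R) (by positivity))
  rw [norm_mul, Complex.norm_natCast, mul_pow, mul_comm (n : ℝ), mul_assoc]
  gcongr
  exact_mod_cast Nat.lt_two_pow_self.le

theorem IsEntireSeries.shift {c : ℕ → ℂ} (h : IsEntireSeries c) :
    IsEntireSeries fun n => c (n + 1) := by
  intro R hR
  have h1 := ((summable_nat_add_iff 1).2 (h R hR)).mul_right R⁻¹
  refine h1.congr fun n => ?_
  rw [pow_succ]
  field_simp

/-- The coefficients of the derivative of a power series. -/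
def derivCoeff (c : ℕ → ℂ) (n : ℕ) : ℂ := (n + 1) * c (n + 1)

theorem IsEntireSeries.derivCoeff {c : ℕ → ℂ} (h : IsEntireSeries c) :
    IsEntireSeries (derivCoeff c) := by
  have h1 := h.nat_mul.shift
  simp only [Nat.cast_add, Nat.cast_one] at h1
  exact h1

/-- Multiplication of a power series by `z` shifts its coefficients. -/
theorem IsEntireSeries.mul_tsum {c d : ℕ → ℂ} (hd : IsEntireSeries d) (h0 : d 0 = 0)
    (h1 : ∀ n, d (n + 1) = c n) (z : ℂ) : z * ∑' n, c n * z ^ n = ∑' n, d n * z ^ n := by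
  rw [(hd.summable z).tsum_eq_zero_add, h0, zero_mul, zero_add, ← tsum_mul_left]
  refine tsum_congr fun n => ?_
  rw [h1, pow_succ]
  ring

theorem IsEntireSeries.hasDerivAt {c : ℕ → ℂ} (h : IsEntireSeries c) (z : ℂ) :
    HasDerivAt (fun z => ∑' n, c n * z ^ n)
      (∑' n, InvertedOscillator.derivCoeff c n * z ^ n) z := by
  have hR : 0 < ‖z‖ + 1 := by positivity
  have hu : Summable fun n : ℕ => ‖c n‖ * (n * (‖z‖ + 1) ^ (n - 1)) := by
    refine (summable_nat_add_iff 1).1 ((h.derivCoeff (‖z‖ + 1) hR).congr fun n => ?_)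
    rw [InvertedOscillator.derivCoeff, norm_mul, Nat.add_sub_cancel]
    have h1 : ‖(n : ℂ) + 1‖ = n + 1 := by
      exact_mod_cast Complex.norm_natCast (n + 1)
    rw [h1]
    push_cast
    ring
  have hz : z ∈ Metric.ball (0 : ℂ) (‖z‖ + 1) := by simp
  have h1 := hasDerivAt_tsum_of_isPreconnected (g := fun n z => c n * z ^ n)
    (g' := fun n z => c n * (n * z ^ (n - 1))) hu Metric.isOpen_ball
    (convex_ball (0 : ℂ) (‖z‖ + 1)).isPreconnected
    (fun n y _ => (hasDerivAt_pow n y).const_mul (c n))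
    (fun n y hy => by
      rw [Metric.mem_ball, dist_zero_right] at hy
      rw [norm_mul, norm_mul, norm_pow, Complex.norm_natCast]
      gcongr) hz (h.summable z) hz
  have hs : Summable fun n : ℕ => c n * (n * z ^ (n - 1)) := by
    refine Summable.of_norm_bounded hu fun n => ?_
    rw [norm_mul, norm_mul, norm_pow, Complex.norm_natCast]
    gcongr
    linarith
  rw [hs.tsum_eq_zero_add] at h1
  simp only [Nat.cast_zero, zero_mul, mul_zero, zero_add, Nat.add_sub_cancel] at h1
  convert! h1 using 3 with n
  rw [InvertedOscillator.derivCoeff]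
  push_cast
  ring

/-- The coefficients `(p)ₙ / ((q)ₙ n!)` of the Kummer function. -/
def kummerCoeff (p q : ℂ) (n : ℕ) : ℂ :=
  (ascPochhammer ℂ n).eval p / ((ascPochhammer ℂ n).eval q * (n.factorial : ℂ))

theorem kummer_eq_tsum (p q z : ℂ) : kummer p q z = ∑' n, kummerCoeff p q n * z ^ n := by
  refine tsum_congr fun n => ?_
  rw [kummerCoeff]
  ring

theorem ascPochhammer_eval_ne_zero {q : ℂ} (hq : ∀ n : ℕ, q + n ≠ 0) (n : ℕ) :
    (ascPochhammer ℂ n).eval q ≠ 0 := by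
  induction n with
  | zero => simp
  | succ n ih => rw [ascPochhammer_succ_eval]; exact mul_ne_zero ih (hq n)

theorem kummerCoeff_succ (p : ℂ) {q : ℂ} (hq : ∀ n : ℕ, q + n ≠ 0) (n : ℕ) :
    kummerCoeff p q (n + 1) * ((q + n) * (n + 1)) = kummerCoeff p q n * (p + n) := by
  have h1 := ascPochhammer_eval_ne_zero hq n
  have h2 := hq n
  have h3 : (n.factorial : ℂ) ≠ 0 := by exact_mod_cast n.factorial_ne_zero
  have h4 : (n : ℂ) + 1 ≠ 0 := by exact_mod_cast n.succ_ne_zero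
  rw [kummerCoeff, kummerCoeff, ascPochhammer_succ_eval, ascPochhammer_succ_eval,
    Nat.factorial_succ]
  push_cast
  field_simp

theorem isEntireSeries_kummerCoeff (p : ℂ) {q : ℂ} (hq : ∀ n : ℕ, q + n ≠ 0) :
    IsEntireSeries (kummerCoeff p q) := by
  intro R hR
  refine summable_of_ratio_norm_eventually_le (r := 1 / 2) (by norm_num) ?_
  obtain ⟨N, hN⟩ := exists_nat_ge (‖p‖ + 2 * ‖q‖ + 8 * R + 1)
  filter_upwards [Filter.eventually_ge_atTop N] with n hn
  have hn' : ‖p‖ + 2 * ‖q‖ + 8 * R + 1 ≤ n := hN.trans (by exact_mod_cast hn)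
  have hp0 := norm_nonneg p
  have hq0 := norm_nonneg q
  have h1 : ‖p + n‖ ≤ 2 * n := by
    refine (norm_add_le _ _).trans ?_
    rw [Complex.norm_natCast]
    linarith
  have h2 : (n : ℝ) / 2 ≤ ‖q + n‖ := by
    have h3 : ‖(n : ℂ)‖ ≤ ‖q + n‖ + ‖q‖ := by
      have := norm_sub_le (q + n) q
      rwa [add_sub_cancel_left] at this
    rw [Complex.norm_natCast] at h3
    linarith
  have h3 : ‖(n : ℂ) + 1‖ = n + 1 := by exact_mod_cast Complex.norm_natCast (n + 1)
  have h4 := congrArg norm (kummerCoeff_succ p hq n)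
  rw [norm_mul, norm_mul, norm_mul, h3] at h4
  have hc := norm_nonneg (kummerCoeff p q n)
  have hc1 := norm_nonneg (kummerCoeff p q (n + 1))
  have hn0 : (0 : ℝ) < n := by linarith
  have h5 : ‖kummerCoeff p q (n + 1)‖ * (n / 2 * (n + 1)) ≤ ‖kummerCoeff p q n‖ * (2 * n) :=
    calc _ ≤ ‖kummerCoeff p q (n + 1)‖ * (‖q + n‖ * (n + 1)) := by gcongr
      _ = _ := h4
      _ ≤ _ := by gcongr
  have h6 : ‖kummerCoeff p q (n + 1)‖ * (n + 1) ≤ ‖kummerCoeff p q n‖ * 4 := by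
    have h7 : (n : ℝ) * (‖kummerCoeff p q (n + 1)‖ * (n + 1)) ≤
        n * (‖kummerCoeff p q n‖ * 4) := by linarith
    exact le_of_mul_le_mul_left h7 hn0
  have h7 : ‖kummerCoeff p q (n + 1)‖ * R ≤ 1 / 2 * ‖kummerCoeff p q n‖ := by
    have h8 : ‖kummerCoeff p q (n + 1)‖ * (8 * R) ≤ ‖kummerCoeff p q (n + 1)‖ * (n + 1) := by
      gcongr
      linarith
    linarith
  rw [Real.norm_of_nonneg (by positivity), Real.norm_of_nonneg (by positivity), pow_succ]
  calc ‖kummerCoeff p q (n + 1)‖ * (R ^ n * R) = ‖kummerCoeff p q (n + 1)‖ * R * R ^ n := by ring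
    _ ≤ 1 / 2 * ‖kummerCoeff p q n‖ * R ^ n := by gcongr
    _ = _ := by ring

theorem kummer_zero (p q : ℂ) : kummer p q 0 = 1 := by
  rw [kummer_eq_tsum, tsum_eq_single 0 (fun n hn => by simp [hn])]
  simp [kummerCoeff]

/-- The Kummer function is entire and solves `z M'' + (q - z) M' = p M`. -/
theorem exists_kummer_deriv (p : ℂ) {q : ℂ} (hq : ∀ n : ℕ, q + n ≠ 0) :
    ∃ M1 M2 : ℂ → ℂ, (∀ z, HasDerivAt (kummer p q) (M1 z) z) ∧ (∀ z, HasDerivAt M1 (M2 z) z) ∧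
      ∀ z, z * M2 z + (q - z) * M1 z = p * kummer p q z := by
  set c := kummerCoeff p q with hc
  have h0 : IsEntireSeries c := isEntireSeries_kummerCoeff p hq
  have h1 := h0.derivCoeff
  have hk : kummer p q = fun z => ∑' n, c n * z ^ n := funext fun z => kummer_eq_tsum p q z
  refine ⟨fun z => ∑' n, derivCoeff c n * z ^ n, fun z => ∑' n, derivCoeff (derivCoeff c) n * z ^ n,
    fun z => by rw [hk]; exact h0.hasDerivAt z, fun z => h1.hasDerivAt z, fun z => ?_⟩
  have h2 := h1.nat_mul.mul_tsum (c := derivCoeff (derivCoeff c)) (by simp)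
    (fun n => by rw [derivCoeff.eq_def (derivCoeff c)]; push_cast; ring) z
  have h3 := h0.nat_mul.mul_tsum (c := derivCoeff c) (by simp)
    (fun n => by rw [derivCoeff]; push_cast; ring) z
  have hs1 := h1.nat_mul.summable z
  have hs2 := (h1.summable z).mul_left q
  have hs3 := h0.nat_mul.summable z
  have hs4 := (h0.summable z).mul_left p
  simp only [hk]
  rw [sub_mul, h2, h3, ← tsum_mul_left, ← tsum_mul_left, ← add_sub_assoc,
    ← hs1.tsum_add hs2, ← (hs1.add hs2).tsum_sub hs3]
  refine tsum_congr fun n => ?_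
  have h4 := kummerCoeff_succ p hq n
  rw [derivCoeff]
  linear_combination z ^ n * h4

/-! ### The even and odd solutions -/

section Psi

variable {α : ℝ} {p q : ℂ} {M M1 M2 : ℂ → ℂ}

theorem hasDerivAt_neg_I_mul_sq (α : ℝ) (x : ℝ) :
    HasDerivAt (fun x : ℝ => -Complex.I * α * x ^ 2) (-Complex.I * α * (2 * x)) x := by
  have h := ((Complex.ofRealCLM.hasDerivAt (x := x)).pow 2).const_mul (-Complex.I * α)
  exact h.congr_deriv (by simp)

theorem hasDerivAt_chirp_half (α : ℝ) (x : ℝ) :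
    HasDerivAt (fun x : ℝ => Complex.exp (Complex.I * α * x ^ 2 / 2))
      (Complex.exp (Complex.I * α * x ^ 2 / 2) * (Complex.I * α * x)) x := by
  have h := (((Complex.ofRealCLM.hasDerivAt (x := x)).pow 2).const_mul
    (Complex.I * α)).div_const 2
  refine h.cexp.congr_deriv ?_
  simp
  ring

theorem hasDerivAt_exp_mul (hM : ∀ z, HasDerivAt M (M1 z) z) (x : ℝ) :
    HasDerivAt (fun x : ℝ => Complex.exp (Complex.I * α * x ^ 2 / 2) *
        M (-Complex.I * α * x ^ 2))
      (Complex.exp (Complex.I * α * x ^ 2 / 2) * (Complex.I * α * x *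
        (M (-Complex.I * α * x ^ 2) - 2 * M1 (-Complex.I * α * x ^ 2)))) x := by
  have h := (hasDerivAt_chirp_half α x).mul
    ((hM (-Complex.I * α * x ^ 2)).comp x (hasDerivAt_neg_I_mul_sq α x))
  refine h.congr_deriv ?_
  simp only [Function.comp_apply]
  ring

theorem hasDerivAt_deriv_exp_mul (hM : ∀ z, HasDerivAt M (M1 z) z)
    (hM1 : ∀ z, HasDerivAt M1 (M2 z) z) (x : ℝ) :
    HasDerivAt (fun x : ℝ => Complex.exp (Complex.I * α * x ^ 2 / 2) * (Complex.I * α * x *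
        (M (-Complex.I * α * x ^ 2) - 2 * M1 (-Complex.I * α * x ^ 2))))
      (Complex.exp (Complex.I * α * x ^ 2 / 2) * (Complex.I * α *
        (M (-Complex.I * α * x ^ 2) - 2 * M1 (-Complex.I * α * x ^ 2)) -
          (α : ℂ) ^ 2 * x ^ 2 * (M (-Complex.I * α * x ^ 2) - 4 * M1 (-Complex.I * α * x ^ 2) +
            4 * M2 (-Complex.I * α * x ^ 2)))) x := by
  have h1 : HasDerivAt (fun x : ℝ => Complex.I * α * x) (Complex.I * α) x :=
    ((Complex.ofRealCLM.hasDerivAt (x := x)).const_mul (Complex.I * α)).congr_deriv (by simp)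
  have hs := hasDerivAt_neg_I_mul_sq α x
  have h2 := ((hM (-Complex.I * α * x ^ 2)).comp x hs).sub
    (((hM1 (-Complex.I * α * x ^ 2)).comp x hs).const_mul 2)
  have h := (hasDerivAt_chirp_half α x).mul (h1.mul h2)
  refine h.congr_deriv ?_
  simp only [Function.comp_apply, Pi.sub_apply, Pi.mul_apply]
  ring_nf
  simp only [Complex.I_sq]
  ring

theorem contDiff_exp_mul_kummer (α : ℝ) (p : ℂ) {q : ℂ} (hq : ∀ n : ℕ, q + n ≠ 0) :
    ContDiff ℝ (⊤ : ℕ∞) fun x : ℝ => Complex.exp (Complex.I * α * x ^ 2 / 2) *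
      kummer p q (-Complex.I * α * x ^ 2) := by
  obtain ⟨M1, M2, h1, -, -⟩ := exists_kummer_deriv p hq
  have hd : Differentiable ℂ (kummer p q) := fun z => (h1 z).differentiableAt
  have hk : ContDiff ℂ (⊤ : ℕ∞) (kummer p q) := hd.contDiff
  have hx : ContDiff ℝ (⊤ : ℕ∞) fun x : ℝ => (x : ℂ) := Complex.ofRealCLM.contDiff
  refine ContDiff.mul ?_ ((hk.restrict_scalars ℝ).comp (contDiff_const.mul (hx.pow 2)))
  exact ((contDiff_const.mul (hx.pow 2)).div_const 2).cexp

end Psi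

theorem half_add_ne_zero (n : ℕ) : (1 / 2 : ℂ) + n ≠ 0 := by
  have h : (1 / 2 : ℝ) + n ≠ 0 := by positivity
  intro h1
  apply h
  have h2 : (((1 / 2 : ℝ) + n : ℝ) : ℂ) = 0 := by push_cast; exact h1
  exact_mod_cast h2

theorem three_half_add_ne_zero (n : ℕ) : (3 / 2 : ℂ) + n ≠ 0 := by
  have h := half_add_ne_zero (n + 1)
  intro h1
  apply h
  push_cast
  linear_combination h1

theorem contDiff_psiP (α : ℝ) (z : ℂ) : ContDiff ℝ (⊤ : ℕ∞) (psiP α z) :=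
  contDiff_exp_mul_kummer α _ half_add_ne_zero

theorem contDiff_psiN (α : ℝ) (z : ℂ) : ContDiff ℝ (⊤ : ℕ∞) (psiN α z) := by
  have h := (Complex.ofRealCLM.contDiff (n := ((⊤ : ℕ∞) : WithTop ℕ∞))).mul
    (contDiff_exp_mul_kummer α (z / (4 * Complex.I * α) + 3 / 4) three_half_add_ne_zero)
  convert! h using 1
  funext x
  simp only [psiN, Complex.ofRealCLM_apply]
  ring

/-- The even Kummer solution solves `ψ'' = -(z + α² x²) ψ`: this is the Kummer equation with
parameter `1/2` at the point `-i α x²`. -/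
theorem exists_deriv_psiP {α : ℝ} (hα : α ≠ 0) (z : ℂ) : ∃ ψ' : ℝ → ℂ,
    (∀ x, HasDerivAt (psiP α z) (ψ' x) x) ∧
    (∀ x : ℝ, HasDerivAt ψ' (-(z + (α : ℂ) ^ 2 * (x : ℂ) ^ 2) * psiP α z x) x) := by
  have hα' : (α : ℂ) ≠ 0 := by exact_mod_cast hα
  have hI := Complex.I_ne_zero
  set p : ℂ := z / (4 * Complex.I * α) + 1 / 4 with hp
  obtain ⟨M1, M2, h1, h2, h3⟩ := exists_kummer_deriv p half_add_ne_zero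
  refine ⟨_, fun x => hasDerivAt_exp_mul h1 x, fun x => ?_⟩
  refine (hasDerivAt_deriv_exp_mul h1 h2 x).congr_deriv ?_
  have h4 := h3 (-Complex.I * α * x ^ 2)
  have h5 : 4 * Complex.I * α * p = z + Complex.I * α := by
    rw [hp]; field_simp
  rw [psiP, ← hp]
  set K := kummer p (1 / 2) (-Complex.I * α * x ^ 2)
  set E := Complex.exp (Complex.I * α * x ^ 2 / 2)
  linear_combination (-4 * Complex.I * α * E) * h4 - E * K * h5 +
    (4 * E * α ^ 2 * x ^ 2 * (M1 (-Complex.I * α * x ^ 2) - M2 (-Complex.I * α * x ^ 2))) *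
      Complex.I_sq

/-- The odd Kummer solution solves `ψ'' = -(z + α² x²) ψ`: this is the Kummer equation with
parameter `3/2` at the point `-i α x²`. -/
theorem exists_deriv_psiN {α : ℝ} (hα : α ≠ 0) (z : ℂ) : ∃ ψ' : ℝ → ℂ,
    (∀ x, HasDerivAt (psiN α z) (ψ' x) x) ∧
    (∀ x : ℝ, HasDerivAt ψ' (-(z + (α : ℂ) ^ 2 * (x : ℂ) ^ 2) * psiN α z x) x) ∧
    ψ' 0 = 1 := by
  have hα' : (α : ℂ) ≠ 0 := by exact_mod_cast hα
  have hI := Complex.I_ne_zero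
  set p : ℂ := z / (4 * Complex.I * α) + 3 / 4 with hp
  obtain ⟨M1, M2, h1, h2, h3⟩ := exists_kummer_deriv p three_half_add_ne_zero
  have hx : ∀ x : ℝ, HasDerivAt (fun x : ℝ => (x : ℂ)) 1 x := fun x =>
    Complex.ofRealCLM.hasDerivAt (x := x)
  refine ⟨fun x => Complex.exp (Complex.I * α * x ^ 2 / 2) *
      kummer p (3 / 2) (-Complex.I * α * x ^ 2) + x * (Complex.exp (Complex.I * α * x ^ 2 / 2) *
        (Complex.I * α * x * (kummer p (3 / 2) (-Complex.I * α * x ^ 2) -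
          2 * M1 (-Complex.I * α * x ^ 2)))), fun x => ?_, fun x => ?_, ?_⟩
  · have h := (hx x).mul (hasDerivAt_exp_mul (α := α) h1 x)
    have h4 : psiN α z = (fun x : ℝ => (x : ℂ)) * fun x : ℝ =>
        Complex.exp (Complex.I * α * x ^ 2 / 2) * kummer p (3 / 2) (-Complex.I * α * x ^ 2) := by
      funext x
      simp only [psiN, Pi.mul_apply, hp]
      ring
    rw [h4]
    exact h.congr_deriv (by ring)
  · have h := (hasDerivAt_exp_mul (α := α) h1 x).add
      ((hx x).mul (hasDerivAt_deriv_exp_mul (α := α) h1 h2 x))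
    refine h.congr_deriv ?_
    have h4 := h3 (-Complex.I * α * x ^ 2)
    have h5 : 4 * Complex.I * α * p = z + 3 * Complex.I * α := by
      rw [hp]; field_simp
    rw [psiN, ← hp]
    set K := kummer p (3 / 2) (-Complex.I * α * x ^ 2)
    set E := Complex.exp (Complex.I * α * x ^ 2 / 2)
    linear_combination (-4 * Complex.I * α * E * x) * h4 - E * K * x * h5 +
      (4 * E * x * α ^ 2 * x ^ 2 * (M1 (-Complex.I * α * x ^ 2) - M2 (-Complex.I * α * x ^ 2))) *
        Complex.I_sq
  · simp [kummer_zero]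

theorem psiP_zero (α : ℝ) (z : ℂ) : psiP α z 0 = 1 := by simp [psiP, kummer_zero]

theorem psiN_zero (α : ℝ) (z : ℂ) : psiN α z 0 = 0 := by simp [psiN]

/-! ### Derivatives of the cutoff function -/

theorem exists_bound_deriv_deriv_bump : ∃ M : ℝ, 0 ≤ M ∧ ∀ t, |deriv (deriv bump) t| ≤ M := by
  have h0 : ContDiff ℝ 1 (deriv bump) := by
    have h : ContDiff ℝ (1 + 1) (bump : ℝ → ℝ) := bump.contDiff
    exact (contDiff_succ_iff_deriv.1 h).2.2
  have h1 : Continuous (deriv (deriv bump)) := h0.continuous_deriv le_rfl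
  obtain ⟨M, hM⟩ := h1.bounded_above_of_compact_support bump.hasCompactSupport.deriv.deriv
  exact ⟨M, (norm_nonneg _).trans (hM 0), hM⟩

theorem hasDerivAt_bump_div (R t : ℝ) :
    HasDerivAt (fun t : ℝ => (bump (t / R) : ℂ)) ((deriv bump (t / R) / R : ℝ) : ℂ) t := by
  have h2 : HasDerivAt (fun t : ℝ => bump (t / R)) (deriv bump (t / R) * (1 / R)) t :=
    ((bump.contDiff (n := 1)).differentiable one_ne_zero _).hasDerivAt.comp t
      ((hasDerivAt_id t).div_const R)
  rw [mul_one_div] at h2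
  exact h2.ofReal_comp

theorem hasDerivAt_deriv_bump_div (R t : ℝ) :
    HasDerivAt (fun t : ℝ => ((deriv bump (t / R) / R : ℝ) : ℂ))
      ((deriv (deriv bump) (t / R) / R ^ 2 : ℝ) : ℂ) t := by
  have h0 : ContDiff ℝ 1 (deriv bump) := by
    have h : ContDiff ℝ (1 + 1) (bump : ℝ → ℝ) := bump.contDiff
    exact (contDiff_succ_iff_deriv.1 h).2.2
  have h2 : HasDerivAt (fun t : ℝ => deriv bump (t / R)) (deriv (deriv bump) (t / R) * (1 / R)) t :=
    (h0.differentiable one_ne_zero _).hasDerivAt.comp t ((hasDerivAt_id t).div_const R)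
  exact (h2.div_const R).ofReal_comp.congr_deriv (by push_cast; ring)

theorem deriv_bump_eq_zero {t : ℝ} (ht : 2 < |t|) :
    deriv bump t = 0 ∧ deriv (deriv bump) t = 0 := by
  have h : (bump : ℝ → ℝ) =ᶠ[nhds t] fun _ => 0 := by
    filter_upwards [(isOpen_lt continuous_const continuous_abs).mem_nhds ht] with s hs
    exact bump_eq_zero (le_of_lt hs)
  exact ⟨by rw [h.deriv_eq]; simp, by rw [h.deriv.deriv_eq]; simp⟩

theorem deriv_bump_eq_zero_of_lt {t : ℝ} (ht : |t| < 1) :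
    deriv bump t = 0 ∧ deriv (deriv bump) t = 0 := by
  have h : (bump : ℝ → ℝ) =ᶠ[nhds t] fun _ => 1 := by
    filter_upwards [(isOpen_lt continuous_abs continuous_const).mem_nhds ht] with s hs
    exact bump_eq_one (le_of_lt hs)
  exact ⟨by rw [h.deriv_eq]; simp, by rw [h.deriv.deriv_eq]; simp⟩

/-! ### Functionals given by generalized eigenfunctions -/

section OscMatrix

variable {ω a : ℝ} (hω : ω ≠ 0) (ha : a ≠ 0) {c : ℂ}
    (hc : ‖c‖ = Real.sqrt (1 / (2 * Real.pi * |oscMatrix ω a hω ha 0 1|)))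

/-- The pairing with a function `O((1 + |x|)^(-1/2))` is bounded by a multiple of `pairNorm`. -/
theorem exists_integral_bound : ∃ K : ℝ, 0 ≤ K ∧ ∀ (ψ : ℝ → ℂ) (C : ℝ), Continuous ψ → 0 ≤ C →
    (∀ x, ‖ψ x‖ ≤ C * weight x) → ∀ g : 𝓢(ℝ, ℂ) × 𝓢(ℝ, ℂ),
      Integrable (fun x => (schwartzEquiv (oscOpW hω ha hc) g).toL2 x * ψ x) volume ∧
      ‖∫ x, (schwartzEquiv (oscOpW hω ha hc) g).toL2 x * ψ x‖ ≤ C * K * pairNorm g := by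
  obtain ⟨K, hK0, hK⟩ := exists_lintegral_weight_le hω ha hc
  refine ⟨K, hK0, fun ψ C hψ hC0 hC g => ?_⟩
  have hP := pairNorm_nonneg g
  set φ := (schwartzEquiv (oscOpW hω ha hc) g).toL2 with hφ
  have hle : ∫⁻ x, ‖φ x * ψ x‖ₑ ≤ ENNReal.ofReal (C * K * pairNorm g) := by
    calc ∫⁻ x, ‖φ x * ψ x‖ₑ
        ≤ ∫⁻ x, ENNReal.ofReal C * (‖φ x‖ₑ * ENNReal.ofReal (weight x)) := by
          refine lintegral_mono fun x => ?_
          rw [enorm_mul, mul_left_comm, ← ENNReal.ofReal_mul hC0]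
          gcongr
          rw [← ofReal_norm]
          exact ENNReal.ofReal_le_ofReal (hC x)
      _ = ENNReal.ofReal C * ∫⁻ x, ‖φ x‖ₑ * ENNReal.ofReal (weight x) :=
          lintegral_const_mul' _ _ ENNReal.ofReal_ne_top
      _ ≤ ENNReal.ofReal C * ENNReal.ofReal (K * pairNorm g) := by gcongr; exact hK g
      _ = _ := by rw [← ENNReal.ofReal_mul hC0, mul_assoc]
  refine ⟨⟨(Lp.aestronglyMeasurable φ).mul hψ.aestronglyMeasurable,
    hle.trans_lt ENNReal.ofReal_lt_top⟩, ?_⟩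
  have h1 := enorm_integral_le_lintegral_enorm (μ := volume) (fun x => φ x * ψ x)
  have h2 := h1.trans hle
  rw [← ofReal_norm] at h2
  exact (ENNReal.ofReal_le_ofReal_iff (by positivity)).1 h2

theorem integrable_mul_of_bound {ψ : ℝ → ℂ} {C : ℝ} (hψ : Continuous ψ)
    (hC : ∀ x, ‖ψ x‖ ≤ C * weight x) (φ : TestSpace (oscOpW hω ha hc)) :
    Integrable (fun x => φ.toL2 x * ψ x) volume := by
  obtain ⟨K, -, hK⟩ := exists_integral_bound hω ha hc
  obtain ⟨g, rfl⟩ := (schwartzEquiv _).surjective φ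
  refine (hK ψ |C| hψ (abs_nonneg C) (fun x => ?_) g).1
  exact (hC x).trans (mul_le_mul_of_nonneg_right (le_abs_self C) (weight_nonneg x))

/-- A continuous function that is `O((1 + |x|)^(-1/2))` defines a continuous functional on the
test space. -/
theorem exists_functional {ψ : ℝ → ℂ} {C : ℝ} (hψ : Continuous ψ) (hC0 : 0 ≤ C)
    (hC : ∀ x, ‖ψ x‖ ≤ C * weight x) :
    ∃ F : TestSpace (oscOpW hω ha hc) →L[ℂ] ℂ, ∀ φ, F φ = ∫ x, φ.toL2 x * ψ x := by
  obtain ⟨K, hK0, hK⟩ := exists_integral_bound hω ha hc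
  have hint := integrable_mul_of_bound hω ha hc hψ hC
  let L : TestSpace (oscOpW hω ha hc) →ₗ[ℂ] ℂ :=
    { toFun := fun φ => ∫ x, φ.toL2 x * ψ x
      map_add' := fun φ χ => by
        rw [← integral_add (hint φ) (hint χ)]
        refine integral_congr_ae ?_
        rw [map_add]
        filter_upwards [Lp.coeFn_add φ.toL2 χ.toL2] with x hx
        rw [hx, Pi.add_apply, add_mul]
      map_smul' := fun k φ => by
        rw [RingHom.id_apply, smul_eq_mul, ← integral_const_mul]
        refine integral_congr_ae ?_
        rw [map_smul]
        filter_upwards [Lp.coeFn_smul k φ.toL2] with x hx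
        rw [hx, Pi.smul_apply, smul_eq_mul, mul_assoc] }
  have h1 : Continuous fun g => L (schwartzEquiv _ g) := by
    refine continuous_of_continuousAt_zero
      (L ∘ₗ (schwartzEquiv (oscOpW hω ha hc)).toLinearEquiv.toLinearMap) ?_
    rw [ContinuousAt, map_zero, tendsto_zero_iff_norm_tendsto_zero]
    refine squeeze_zero (fun _ => norm_nonneg _) (fun g => (hK ψ C hψ hC0 hC g).2) ?_
    have h2 := (continuous_pairNorm.const_mul (C * K)).tendsto 0
    have h4 : schwartzIncl ((0 : 𝓢(ℝ, ℂ)), (0 : 𝓢(ℝ, ℂ))) = 0 := map_zero schwartzIncl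
    have h3 : pairNorm 0 = 0 := by simp [pairNorm, h4]
    rwa [h3, mul_zero] at h2
  have h2 : Continuous L := by
    have h3 : (L : TestSpace (oscOpW hω ha hc) → ℂ) =
        (fun g => L (schwartzEquiv _ g)) ∘ (schwartzEquiv _).symm := by
      funext φ; simp
    rw [h3]
    exact h1.comp (schwartzEquiv _).symm.continuous
  exact ⟨⟨L, h2⟩, fun φ => rfl⟩

/-- A smooth solution of `-ψ'' - ω² x² ψ = r ψ` defines an eigenfunctional. The equation of the
operator is tested against `ψ` cut off at radius `R`; the error terms `ψ' χ'(x/R)/R` and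
`ψ χ''(x/R)/R²` are dominated by `(1 + |x|)^(-1/2)` uniformly in `R`. -/
theorem integral_testOp_mul {r : ℝ} {ψ ψ' : ℝ → ℂ} (hsm : ContDiff ℝ (⊤ : ℕ∞) ψ)
    (h1 : ∀ x, HasDerivAt ψ (ψ' x) x)
    (h2 : ∀ x : ℝ, HasDerivAt ψ' (-(r + (ω : ℂ) ^ 2 * (x : ℂ) ^ 2) * ψ x) x)
    (φ : TestSpace (oscOpW hω ha hc)) :
    ∫ x, (testOp _ ω φ).toL2 x * ψ x = r * ∫ x, φ.toL2 x * ψ x := by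
  obtain ⟨C, hC0, hC⟩ := exists_bound_of_ode hω h1 h2
  obtain ⟨M, hM0, hM⟩ := exists_bound_deriv_bump
  obtain ⟨N, hN0, hN⟩ := exists_bound_deriv_deriv_bump
  set R : ℕ → ℝ := fun n => n + 1 with hR
  -- `θ n` is `ψ` cut off at radius `R n`, and `P n` is the inverted oscillator applied to it.
  have hR1 : ∀ n, 1 ≤ R n := fun n => by simp [hR]
  have hR0 : ∀ n, 0 < R n := fun n => one_pos.trans_le (hR1 n)
  set θ : ℕ → ℝ → ℂ := fun n x => ψ x * (bump (x / R n) : ℂ) with hθ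
  set P : ℕ → ℝ → ℂ := fun n x => r * ψ x * (bump (x / R n) : ℂ) -
    2 * ψ' x * ((deriv bump (x / R n) / R n : ℝ) : ℂ) -
      ψ x * ((deriv (deriv bump) (x / R n) / R n ^ 2 : ℝ) : ℂ) with hP
  have hθsm : ∀ n, ContDiff ℝ (⊤ : ℕ∞) (θ n) := fun n =>
    hsm.mul (Complex.ofRealCLM.contDiff.comp (bump.contDiff.comp (contDiff_id.div_const (R n))))
  have hθs : ∀ n, HasCompactSupport (θ n) := fun n => by
    refine HasCompactSupport.intro (isCompact_Icc (a := -(2 * R n)) (b := 2 * R n)) ?_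
    intro t ht
    rw [Set.mem_Icc, ← abs_le, not_le] at ht
    simp only [hθ]
    rw [bump_eq_zero, Complex.ofReal_zero, mul_zero]
    rw [abs_div, abs_of_pos (hR0 n), le_div_iff₀ (hR0 n)]
    exact ht.le
  have hθd : ∀ n, deriv (θ n) = fun x => ψ' x * (bump (x / R n) : ℂ) +
      ψ x * ((deriv bump (x / R n) / R n : ℝ) : ℂ) := fun n => funext fun x =>
    ((h1 x).mul (hasDerivAt_bump_div (R n) x)).deriv
  have hθdd : ∀ n x, -(deriv (deriv (θ n)) x) - (ω : ℂ) ^ 2 * (x : ℂ) ^ 2 * θ n x = P n x := by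
    intro n x
    have h3 := ((h2 x).mul (hasDerivAt_bump_div (R n) x)).add
      ((h1 x).mul (hasDerivAt_deriv_bump_div (R n) x))
    have h4 : deriv (fun x => ψ' x * (bump (x / R n) : ℂ) +
      ψ x * ((deriv bump (x / R n) / R n : ℝ) : ℂ)) x = _ := h3.deriv
    rw [hθd, h4]
    simp only [hθ, hP]
    ring
  -- The equation of the operator, tested against `θ n`; the claim is its limit.
  have hosc : ∀ n, ∫ x, φ.toL2 x * P n x = ∫ x, (testOp _ ω φ).toL2 x * θ n x := fun n => by
    rw [← isInvertedOscillator_testOp hω ha hc φ (θ n) (hθsm n) (hθs n)]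
    simp only [hθdd]
  have hψc : Continuous ψ := hsm.continuous
  have hψc' : Continuous ψ' := continuous_iff_continuousAt.2 fun x => (h2 x).continuousAt
  have hbc : Continuous (bump : ℝ → ℝ) := bump.continuous
  have hbc1 : Continuous (deriv bump) := (bump.contDiff (n := 1)).continuous_deriv le_rfl
  have hPc : ∀ n, Continuous (P n) := fun n => by
    have h3 : P n = fun x => -(deriv (deriv (θ n)) x) - (ω : ℂ) ^ 2 * (x : ℂ) ^ 2 * θ n x :=
      funext fun x => (hθdd n x).symm
    have h4 : Continuous (deriv (deriv (θ n))) := by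
      have h5 : ContDiff ℝ (1 + 1) (θ n) := 
        (contDiff_infty.1 (hθsm n) 2).of_le (by norm_num)
      exact ((contDiff_succ_iff_deriv.1 h5).2.2).continuous_deriv le_rfl
    have h6 := (hθsm n).continuous
    rw [h3]
    fun_prop
  have hbump : ∀ t, ‖(bump t : ℂ)‖ ≤ 1 := fun t => by
    rw [Complex.norm_real, Real.norm_of_nonneg bump.nonneg]
    exact bump.le_one
  have hθb : ∀ n x, ‖θ n x‖ ≤ C * weight x := fun n x => by
    rw [hθ, norm_mul]
    exact (mul_le_of_le_one_right (norm_nonneg _) (hbump _)).trans (hC x).1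
  have hw := weight_nonneg
  have hPb : ∀ n x, ‖P n x‖ ≤ (|r| + 6 * M + N) * C * weight x := fun n x => by
    have hA : ‖(r : ℂ) * ψ x * (bump (x / R n) : ℂ)‖ ≤ |r| * C * weight x := by
      rw [norm_mul, norm_mul, Complex.norm_real, Real.norm_eq_abs, mul_assoc |r| C]
      refine (mul_le_of_le_one_right (mul_nonneg (abs_nonneg r) (norm_nonneg (ψ x)))
        (hbump _)).trans ?_
      gcongr
      exact (hC x).1
    have hB : ‖2 * ψ' x * ((deriv bump (x / R n) / R n : ℝ) : ℂ)‖ ≤ 6 * M * C * weight x := by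
      rcases lt_or_ge 2 |x / R n| with h | h
      · rw [(deriv_bump_eq_zero h).1]
        simp only [zero_div, Complex.ofReal_zero, mul_zero, norm_zero]
        have := hw x
        positivity
      -- On the support `|x| ≤ 2 R`, so `1/R` absorbs the factor `1 + |x|` in the bound of `ψ'`.
      · rw [abs_div, abs_of_pos (hR0 n), div_le_iff₀ (hR0 n)] at h
        rw [norm_mul, norm_mul, Complex.norm_real, Real.norm_eq_abs, abs_div, abs_of_pos (hR0 n),
          Complex.norm_ofNat]
        have h3 : (1 + |x|) / R n ≤ 3 := by
          rw [div_le_iff₀ (hR0 n)]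
          linarith [hR1 n]
        calc 2 * ‖ψ' x‖ * (|deriv bump (x / R n)| / R n)
            ≤ 2 * (C * (1 + |x|) * weight x) * (M / R n) := by
              have := hR0 n
              have := hw x
              gcongr
              · exact (hC x).2
              · exact hM _
          _ = 2 * M * C * weight x * ((1 + |x|) / R n) := by ring
          _ ≤ 2 * M * C * weight x * 3 := by
              have := hw x
              gcongr
          _ = _ := by ring
    have hD : ‖ψ x * ((deriv (deriv bump) (x / R n) / R n ^ 2 : ℝ) : ℂ)‖ ≤
        N * C * weight x := by
      rw [norm_mul, Complex.norm_real, Real.norm_eq_abs, abs_div,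
        abs_of_pos (pow_pos (hR0 n) 2)]
      have h3 : |deriv (deriv bump) (x / R n)| / R n ^ 2 ≤ N :=
        (div_le_self (abs_nonneg _) (one_le_pow₀ (hR1 n))).trans (hN _)
      calc _ ≤ (C * weight x) * N := by
            have := hw x
            gcongr
            exact (hC x).1
        _ = _ := by ring
    calc ‖P n x‖ ≤ _ := (norm_sub_le _ _).trans (add_le_add_left (norm_sub_le _ _) _)
      _ ≤ |r| * C * weight x + 6 * M * C * weight x + N * C * weight x := by gcongr
      _ = _ := by ring
  have hev : ∀ x, ∀ᶠ n in Filter.atTop, |x / R n| < 1 := fun x => by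
    obtain ⟨m, hm⟩ := exists_nat_gt |x|
    filter_upwards [Filter.eventually_ge_atTop m] with n hn
    rw [abs_div, abs_of_pos (hR0 n), div_lt_one (hR0 n)]
    have : (m : ℝ) ≤ n := by exact_mod_cast hn
    simp only [hR]
    linarith
  have hdom : ∀ (χ : TestSpace (oscOpW hω ha hc)) (K : ℝ),
      Integrable (fun x => ‖χ.toL2 x‖ * (K * weight x)) volume := fun χ K => by
    have h3 := (integrable_mul_of_bound hω ha hc (ψ := fun x => (weight x : ℂ)) (C := 1)
      (Complex.continuous_ofReal.comp continuous_weight) (fun x => by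
        rw [Complex.norm_real, Real.norm_of_nonneg (hw x), one_mul]) χ).norm.const_mul K
    refine h3.congr (.of_forall fun x => ?_)
    simp only [norm_mul, Complex.norm_real, Real.norm_of_nonneg (hw x)]
    ring
  have hlim1 : Filter.Tendsto (fun n => ∫ x, φ.toL2 x * P n x) Filter.atTop
      (nhds (∫ x, φ.toL2 x * (r * ψ x))) := by
    refine tendsto_integral_of_dominated_convergence _
      (fun n => (Lp.aestronglyMeasurable φ.toL2).mul (hPc n).aestronglyMeasurable)
      (hdom φ ((|r| + 6 * M + N) * C)) (fun n => .of_forall fun x => ?_) (.of_forall fun x => ?_)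
    · rw [norm_mul]
      exact mul_le_mul_of_nonneg_left (hPb n x) (norm_nonneg _)
    · refine tendsto_const_nhds.congr' ?_
      filter_upwards [hev x] with n hn
      simp only [hP]
      rw [bump_eq_one hn.le, (deriv_bump_eq_zero_of_lt hn).1, (deriv_bump_eq_zero_of_lt hn).2]
      simp
  have hlim2 : Filter.Tendsto (fun n => ∫ x, (testOp _ ω φ).toL2 x * θ n x) Filter.atTop
      (nhds (∫ x, (testOp _ ω φ).toL2 x * ψ x)) := by
    refine tendsto_integral_of_dominated_convergence _
      (fun n => (Lp.aestronglyMeasurable _).mul (hθsm n).continuous.aestronglyMeasurable)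
      (hdom (testOp _ ω φ) C) (fun n => .of_forall fun x => ?_) (.of_forall fun x => ?_)
    · rw [norm_mul]
      exact mul_le_mul_of_nonneg_left (hθb n x) (norm_nonneg _)
    · refine tendsto_const_nhds.congr' ?_
      filter_upwards [hev x] with n hn
      simp only [hθ]
      rw [bump_eq_one hn.le]
      simp
  rw [← integral_const_mul, tendsto_nhds_unique hlim2 (hlim1.congr hosc)]
  exact integral_congr_ae (.of_forall fun x => mul_left_comm _ _ _)

/-- The test space contains all smooth compactly supported functions, so it separates continuous
functions. -/
theorem eq_zero_of_integral_eq_zero {ψ : ℝ → ℂ} (hψ : Continuous ψ)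
    (h : ∀ φ : TestSpace (oscOpW hω ha hc), ∫ x, φ.toL2 x * ψ x = 0) : ψ = 0 := by
  have h1 : ψ =ᵐ[volume] fun _ => 0 := by
    refine ae_eq_zero_of_integral_contDiff_smul_eq_zero hψ.locallyIntegrable fun g hg hgs => ?_
    have hgs' : HasCompactSupport (fun x => (g x : ℂ)) :=
      hgs.comp_left (g := fun y : ℝ => (y : ℂ)) Complex.ofReal_zero
    set G : 𝓢(ℝ, ℂ) := hgs'.toSchwartzMap (Complex.ofRealCLM.contDiff.comp hg) with hG
    obtain ⟨φ, hφ⟩ := exists_toL2_eq_toLp hω ha hc G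
    rw [← h φ, hφ]
    refine integral_congr_ae ?_
    filter_upwards [G.coeFn_toLp 2 volume] with x hx
    rw [hx, Complex.real_smul]
    rfl
  exact (Continuous.ae_eq_iff_eq volume hψ continuous_const).1 h1

end OscMatrix

/-! ### The eigenspaces -/

section Eigen

variable {W : L2R ≃ₗᵢ[ℂ] L2R} {ω : ℝ}

/-- An eigenfunctional of the operator restricts, on each of the two lines, to an eigenfunctional
of `d/dt` with eigenvalue `i z / (2ω)`. -/
theorem eigen_deriv (hω : ω ≠ 0) {F : TestSpace W →L[ℂ] ℂ} {z : ℂ}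
    (hF : ∀ φ, F (testOp W ω φ) = z * F φ) (f : 𝓢(ℝ, ℂ)) :
    F (schwartzEquiv W (derivCLM ℂ ℂ f, 0)) =
        Complex.I * z / (2 * ω) * F (schwartzEquiv W (f, 0)) ∧
      F (schwartzEquiv W (0, derivCLM ℂ ℂ f)) =
        Complex.I * z / (2 * ω) * F (schwartzEquiv W (0, f)) := by
  have hω' : (ω : ℂ) ≠ 0 := by exact_mod_cast hω
  have key : ∀ g h : 𝓢(ℝ, ℂ) × 𝓢(ℝ, ℂ), pairDeriv (2 * ω * (-Complex.I)) g =
      (2 * ω * (-Complex.I)) • h →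
      F (schwartzEquiv W h) = Complex.I * z / (2 * ω) * F (schwartzEquiv W g) := by
    intro g h hgh
    have h1 := hF (schwartzEquiv W g)
    rw [testOp_schwartzEquiv, hgh, map_smul, map_smul, smul_eq_mul] at h1
    field_simp
    linear_combination Complex.I * h1 +
      2 * ω * F (schwartzEquiv W h) * Complex.I_sq
  exact ⟨key _ _ (by simp [pairDeriv_apply]), key _ _ (by simp [pairDeriv_apply])⟩

theorem apply_schwartzEquiv (F : TestSpace W →L[ℂ] ℂ) (g : 𝓢(ℝ, ℂ) × 𝓢(ℝ, ℂ)) :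
    F (schwartzEquiv W g) = F (schwartzEquiv W (g.1, 0)) + F (schwartzEquiv W (0, g.2)) := by
  rw [← map_add, ← map_add, Prod.mk_add_mk, add_zero, zero_add]

theorem eigenvalue_real (hω : ω ≠ 0) {F : TestSpace W →L[ℂ] ℂ} {z : ℂ}
    (hF : IsGeneralizedEigenvector (testOp W ω : TestSpace W →ₗ[ℂ] TestSpace W) z F) :
    z.im = 0 := by
  by_contra hz
  apply hF.1
  have hre : (Complex.I * z / (2 * ω)).re ≠ 0 := by
    have h1 : (Complex.I * z / (2 * ω)).re = -z.im / (2 * ω) := by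
      have h2 : (2 * ω : ℂ) = ((2 * ω : ℝ) : ℂ) := by push_cast; ring
      rw [h2, Complex.div_ofReal_re]
      simp
    rw [h1]
    exact div_ne_zero (neg_ne_zero.2 hz) (mul_ne_zero two_ne_zero hω)
  let T1 : 𝓢(ℝ, ℂ) →ₗ[ℂ] ℂ := F.toLinearMap ∘ₗ
    (schwartzEquiv W).toLinearEquiv.toLinearMap ∘ₗ LinearMap.inl ℂ _ _
  let T2 : 𝓢(ℝ, ℂ) →ₗ[ℂ] ℂ := F.toLinearMap ∘ₗ
    (schwartzEquiv W).toLinearEquiv.toLinearMap ∘ₗ LinearMap.inr ℂ _ _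
  have h1 := eq_zero_of_deriv_eigenvector _ hre T1 fun f => (eigen_deriv hω hF.2 f).1
  have h2 := eq_zero_of_deriv_eigenvector _ hre T2 fun f => (eigen_deriv hω hF.2 f).2
  ext φ
  obtain ⟨g, rfl⟩ := (schwartzEquiv W).surjective φ
  rw [apply_schwartzEquiv]
  have h3 : F (schwartzEquiv W (g.1, 0)) = T1 g.1 := rfl
  have h4 : F (schwartzEquiv W (0, g.2)) = T2 g.2 := rfl
  rw [h3, h4, h1, h2]
  simp

/-- An eigenfunctional with real eigenvalue `r` is `C₁ I(g₁) + C₂ I(g₂)`, with `I` the functional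
`∫ e^{-iσt} g(t) dt` for `σ = r/(2ω)`: the eigenspace is at most two-dimensional. -/
theorem eigen_apply (hω : ω ≠ 0) {F : TestSpace W →L[ℂ] ℂ} {r : ℝ}
    (hF : ∀ φ, F (testOp W ω φ) = r * F φ) : ∃ C1 C2 : ℂ, ∀ g,
      F (schwartzEquiv W g) = C1 * fourierFunctional (r / (2 * ω)) g.1 +
        C2 * fourierFunctional (r / (2 * ω)) g.2 := by
  have hμ : Complex.I * r / (2 * ω) = Complex.I * (r / (2 * ω) : ℝ) := by push_cast; ring
  let T1 : 𝓢(ℝ, ℂ) →ₗ[ℂ] ℂ := F.toLinearMap ∘ₗ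
    (schwartzEquiv W).toLinearEquiv.toLinearMap ∘ₗ LinearMap.inl ℂ _ _
  let T2 : 𝓢(ℝ, ℂ) →ₗ[ℂ] ℂ := F.toLinearMap ∘ₗ
    (schwartzEquiv W).toLinearEquiv.toLinearMap ∘ₗ LinearMap.inr ℂ _ _
  obtain ⟨C1, h1⟩ := exists_eq_mul_fourierFunctional (r / (2 * ω)) T1 fun f => by
    rw [← hμ]; exact (eigen_deriv hω hF f).1
  obtain ⟨C2, h2⟩ := exists_eq_mul_fourierFunctional (r / (2 * ω)) T2 fun f => by
    rw [← hμ]; exact (eigen_deriv hω hF f).2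
  refine ⟨C1, C2, fun g => ?_⟩
  rw [apply_schwartzEquiv, ← h1, ← h2]
  rfl

theorem exists_isGeneralizedEigenvector (hω : ω ≠ 0) (r : ℝ) :
    ∃ F : TestSpace W →L[ℂ] ℂ,
      IsGeneralizedEigenvector (testOp W ω : TestSpace W →ₗ[ℂ] TestSpace W) r F := by
  have hω' : (ω : ℂ) ≠ 0 := by exact_mod_cast hω
  set I := fourierFunctional (r / (2 * ω)) with hI
  refine ⟨I ∘L ContinuousLinearMap.fst ℂ _ _ ∘L
    ((schwartzEquiv W).symm : TestSpace W →L[ℂ] (𝓢(ℝ, ℂ) × 𝓢(ℝ, ℂ))), fun h => ?_, fun φ => ?_⟩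
  · apply fourierFunctional_ne_zero (r / (2 * ω))
    ext f
    have h1 := DFunLike.congr_fun h (schwartzEquiv W (f, 0))
    simpa using h1
  · obtain ⟨g, rfl⟩ := (schwartzEquiv W).surjective φ
    have h1 : (testOp W ω : TestSpace W →ₗ[ℂ] TestSpace W) (schwartzEquiv W g) =
      schwartzEquiv W (pairDeriv (2 * ω * (-Complex.I)) g) := testOp_schwartzEquiv W ω g
    rw [h1]
    simp only [ContinuousLinearMap.comp_apply, ContinuousLinearEquiv.coe_coe,
      ContinuousLinearEquiv.symm_apply_apply, pairDeriv_apply, ContinuousLinearMap.coe_fst',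
      map_smul, smul_eq_mul]
    rw [hI, fourierFunctional_deriv]
    push_cast
    field_simp
    linear_combination -(r * I g.1) * Complex.I_sq

theorem generalizedSpectrum_testOp (hω : ω ≠ 0) :
    generalizedSpectrum (testOp W ω : TestSpace W →ₗ[ℂ] TestSpace W) =
      Set.range (fun r : ℝ => (r : ℂ)) := by
  ext z
  constructor
  · rintro ⟨F, hF⟩
    exact ⟨z.re, Complex.ext (by simp) (by simpa using (eigenvalue_real hω hF).symm)⟩
  · rintro ⟨r, rfl⟩
    exact exists_isGeneralizedEigenvector hω r

/-- Two linearly independent eigenfunctionals span the eigenspace. -/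
theorem exists_eq_smul_add_smul (hω : ω ≠ 0) {r : ℝ} {F1 F2 : TestSpace W →L[ℂ] ℂ}
    (h1 : ∀ φ, F1 (testOp W ω φ) = r * F1 φ) (h2 : ∀ φ, F2 (testOp W ω φ) = r * F2 φ)
    (hind : ∀ p q : ℂ, p • F1 + q • F2 = 0 → p = 0 ∧ q = 0) {F : TestSpace W →L[ℂ] ℂ}
    (hF : ∀ φ, F (testOp W ω φ) = r * F φ) : ∃ p q : ℂ, F = p • F1 + q • F2 := by
  obtain ⟨A1, A2, hA⟩ := eigen_apply hω h1
  obtain ⟨B1, B2, hB⟩ := eigen_apply hω h2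
  obtain ⟨C1, C2, hC⟩ := eigen_apply hω hF
  have key : ∀ (p q : ℂ) (G : TestSpace W →L[ℂ] ℂ) (D1 D2 : ℂ), (∀ g, G (schwartzEquiv W g) =
      D1 * fourierFunctional (r / (2 * ω)) g.1 + D2 * fourierFunctional (r / (2 * ω)) g.2) →
      p * A1 + q * B1 = D1 → p * A2 + q * B2 = D2 → p • F1 + q • F2 = G := by
    intro p q G D1 D2 hG hD1 hD2
    ext φ
    obtain ⟨g, rfl⟩ := (schwartzEquiv W).surjective φ
    have h3 : (p • F1 + q • F2) (schwartzEquiv W g) =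
      p * F1 (schwartzEquiv W g) + q * F2 (schwartzEquiv W g) := rfl
    rw [h3, hA, hB, hG, ← hD1, ← hD2]
    ring
  let Λ : ℂ × ℂ →ₗ[ℂ] ℂ × ℂ :=
    { toFun := fun v => (v.1 * A1 + v.2 * B1, v.1 * A2 + v.2 * B2)
      map_add' := fun v w => by ext <;> simp <;> ring
      map_smul' := fun k v => by ext <;> simp <;> ring }
  have hinj : Function.Injective Λ := by
    rw [injective_iff_map_eq_zero]
    rintro ⟨p, q⟩ hv
    have hv1 : p * A1 + q * B1 = 0 := congrArg Prod.fst hv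
    have hv2 : p * A2 + q * B2 = 0 := congrArg Prod.snd hv
    obtain ⟨hp, hq⟩ := hind p q (key p q 0 0 0 (fun g => by simp) hv1 hv2)
    rw [hp, hq]
    rfl
  obtain ⟨⟨p, q⟩, hpq⟩ := (LinearMap.injective_iff_surjective.1 hinj) (C1, C2)
  exact ⟨p, q, (key p q F C1 C2 hC (congrArg Prod.fst hpq) (congrArg Prod.snd hpq)).symm⟩

end Eigen

/-! ### The Kummer functionals -/

/-- The value at `0` and the slope at `0` separate the even and the odd Kummer solution. -/
theorem eq_zero_of_mul_psiP_add_mul_psiN {α : ℝ} (hα : α ≠ 0) {z p q : ℂ}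
    (h : ∀ x, p * psiP α z x + q * psiN α z x = 0) : p = 0 ∧ q = 0 := by
  have hp : p = 0 := by simpa [psiP_zero, psiN_zero] using h 0
  refine ⟨hp, ?_⟩
  obtain ⟨ψ', h1, -, h3⟩ := exists_deriv_psiN hα z
  have h4 : (fun x => q * psiN α z x) = fun _ => 0 := funext fun x => by simpa [hp] using h x
  have h5 := (h1 0).const_mul q
  rw [h4] at h5
  simpa [h3] using h5.unique (hasDerivAt_const (0 : ℝ) (0 : ℂ))

section OscMatrix

variable {ω a : ℝ} (hω : ω ≠ 0) (ha : a ≠ 0) {c : ℂ}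
    (hc : ‖c‖ = Real.sqrt (1 / (2 * Real.pi * |oscMatrix ω a hω ha 0 1|)))

/-- The even and the odd Kummer solution define eigenfunctionals. -/
theorem exists_kummer_functionals (r α : ℝ) (hα : α = ω ∨ α = -ω) :
    (∀ φ : TestSpace (oscOpW hω ha hc), Integrable (fun x => φ.toL2 x * psiP α r x) volume ∧
      Integrable (fun x => φ.toL2 x * psiN α r x) volume) ∧
    ∃ F G : TestSpace (oscOpW hω ha hc) →L[ℂ] ℂ,
      (∀ φ, F φ = ∫ x, φ.toL2 x * psiP α r x) ∧ (∀ φ, G φ = ∫ x, φ.toL2 x * psiN α r x) ∧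
      (∀ φ, F (testOp _ ω φ) = r * F φ) ∧ (∀ φ, G (testOp _ ω φ) = r * G φ) := by
  have hα2 : (α : ℂ) ^ 2 = (ω : ℂ) ^ 2 := by rcases hα with rfl | rfl <;> simp
  have hα0 : α ≠ 0 := by rcases hα with rfl | rfl <;> simpa using hω
  obtain ⟨P', hP1, hP2⟩ := exists_deriv_psiP hα0 (r : ℂ)
  obtain ⟨N', hN1, hN2, -⟩ := exists_deriv_psiN hα0 (r : ℂ)
  rw [hα2] at hP2 hN2
  obtain ⟨C, hC0, hC⟩ := exists_bound_of_ode hω hP1 hP2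
  obtain ⟨K, hK0, hK⟩ := exists_bound_of_ode hω hN1 hN2
  have hPs := contDiff_psiP α r
  have hNs := contDiff_psiN α r
  obtain ⟨F, hF⟩ := exists_functional hω ha hc hPs.continuous hC0 fun x => (hC x).1
  obtain ⟨G, hG⟩ := exists_functional hω ha hc hNs.continuous hK0 fun x => (hK x).1
  refine ⟨fun φ => ⟨integrable_mul_of_bound hω ha hc hPs.continuous (fun x => (hC x).1) φ,
    integrable_mul_of_bound hω ha hc hNs.continuous (fun x => (hK x).1) φ⟩, F, G, hF, hG,
    fun φ => ?_, fun φ => ?_⟩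
  · rw [hF, hF, integral_testOp_mul hω ha hc hPs hP1 hP2]
  · rw [hG, hG, integral_testOp_mul hω ha hc hNs hN1 hN2]

/-- The Kummer functionals are independent and the eigenspace is two-dimensional, so they form a
basis of it. -/
theorem kummer_functionals_eigenspace (r α : ℝ) (hα : α = ω ∨ α = -ω) :
    (∀ φ : TestSpace (oscOpW hω ha hc), Integrable (fun x => φ.toL2 x * psiP α r x) volume ∧
      Integrable (fun x => φ.toL2 x * psiN α r x) volume) ∧
    (∀ p q : ℂ, (p, q) ≠ 0 → ∃ F : TestSpace (oscOpW hω ha hc) →L[ℂ] ℂ,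
      IsGeneralizedEigenvector (testOp (oscOpW hω ha hc) ω :
        TestSpace (oscOpW hω ha hc) →ₗ[ℂ] TestSpace (oscOpW hω ha hc)) r F ∧
      ∀ φ, F φ = ∫ x, φ.toL2 x * (p * psiP α r x + q * psiN α r x)) ∧
    (∀ F : TestSpace (oscOpW hω ha hc) →L[ℂ] ℂ,
      IsGeneralizedEigenvector (testOp (oscOpW hω ha hc) ω :
        TestSpace (oscOpW hω ha hc) →ₗ[ℂ] TestSpace (oscOpW hω ha hc)) r F →
      ∃! pq : ℂ × ℂ, ∀ φ,
        F φ = ∫ x, φ.toL2 x * (pq.1 * psiP α r x + pq.2 * psiN α r x)) := by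
  have hα0 : α ≠ 0 := by rcases hα with rfl | rfl <;> simpa using hω
  obtain ⟨hint, F, G, hF, hG, hFe, hGe⟩ := exists_kummer_functionals hω ha hc r α hα
  have hFG : ∀ (p q : ℂ) φ, (p • F + q • G) φ =
      ∫ x, φ.toL2 x * (p * psiP α r x + q * psiN α r x) := fun p q φ => by
    have h1 : (p • F + q • G) φ = p * F φ + q * G φ := rfl
    rw [h1, hF, hG, ← integral_const_mul, ← integral_const_mul,
      ← integral_add ((hint φ).1.const_mul p) ((hint φ).2.const_mul q)]
    exact integral_congr_ae (.of_forall fun x => by ring)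
  have hind : ∀ p q : ℂ, p • F + q • G = 0 → p = 0 ∧ q = 0 := fun p q h => by
    refine eq_zero_of_mul_psiP_add_mul_psiN hα0 (z := r) (congrFun
      (eq_zero_of_integral_eq_zero hω ha hc (ψ := fun x => p * psiP α r x + q * psiN α r x)
        ?_ fun φ => ?_))
    · exact ((contDiff_psiP α r).continuous.const_mul p).add
        ((contDiff_psiN α r).continuous.const_mul q)
    · rw [← hFG, h]
      rfl
  refine ⟨hint, fun p q hpq => ⟨p • F + q • G, ⟨fun h => hpq ?_, fun φ => ?_⟩, hFG p q⟩,
    fun E hE => ?_⟩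
  · obtain ⟨hp, hq⟩ := hind p q h
    rw [hp, hq]
    rfl
  · have h1 : ∀ χ, (p • F + q • G) χ = p * F χ + q * G χ := fun χ => rfl
    rw [h1, h1, ContinuousLinearMap.coe_coe, hFe, hGe]
    ring
  · obtain ⟨p, q, rfl⟩ := exists_eq_smul_add_smul hω hFe hGe hind hE.2
    refine ⟨(p, q), hFG p q, fun pq h => ?_⟩
    have h1 : (pq.1 - p) • F + (pq.2 - q) • G = 0 := by
      ext φ
      have h2 : (pq.1 • F + pq.2 • G) φ = (p • F + q • G) φ := by rw [hFG, ← h φ]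
      have h3 : pq.1 * F φ + pq.2 * G φ = p * F φ + q * G φ := h2
      have h4 : ((pq.1 - p) • F + (pq.2 - q) • G) φ = (pq.1 - p) * F φ + (pq.2 - q) * G φ := rfl
      rw [h4, zero_apply]
      linear_combination h3
    obtain ⟨hp, hq⟩ := hind _ _ h1
    exact Prod.ext (sub_eq_zero.1 hp) (sub_eq_zero.1 hq)

end OscMatrix

end

end InvertedOscillator

open InvertedOscillator in
theorem mainTheorem2 (ω a : ℝ) (hω : ω ≠ 0) (ha : a ≠ 0) (c : ℂ)
    (hc : ‖c‖ = Real.sqrt (1 / (2 * Real.pi * |oscMatrix ω a hω ha 0 1|)))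
    (W : L2R ≃ₗᵢ[ℂ] L2R)
    (hW : W = opW (oscMatrix ω a hω ha) (oscMatrix_ne ω a hω ha) c hc) :
    (∀ f : L2R, Integrable f volume → ∀ᵐ u : ℝ,
      W f u = ∫ x : ℝ, c * Complex.exp (Complex.I / (2 * (a / ω)) *
        (a * x ^ 2 - 2 * u * x + 1 / (2 * a) * u ^ 2)) * f x) ∧
    (∀ f : L2R, ∀ᵐ y ∂twoLines, opU f y = (expWeight y : ℂ) * f (signedExp y)) ∧
    Dense (domain W : Set L2R) ∧
    ∃ H : TestSpace W →L[ℂ] TestSpace W,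
      (∀ φ : TestSpace W, IsInvertedOscillator ω φ.toL2 (H φ).toL2) ∧
      (∀ (φ : TestSpace W) (g : 𝓢(ℝ, ℂ) × 𝓢(ℝ, ℂ)), opU (W φ.toL2) = schwartzIncl g →
        opU (W (H φ).toL2) = schwartzIncl
          ((2 * ω * (-Complex.I)) • derivCLM ℂ ℂ g.1, (2 * ω * (-Complex.I)) • derivCLM ℂ ℂ g.2)) ∧
      generalizedSpectrum (H : TestSpace W →ₗ[ℂ] TestSpace W) = Set.range (fun r : ℝ => (r : ℂ)) ∧
      ∀ r α : ℝ, (α = ω ∨ α = -ω) →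
        (∀ φ : TestSpace W, Integrable (fun x => φ.toL2 x * psiP α r x) volume ∧
          Integrable (fun x => φ.toL2 x * psiN α r x) volume) ∧
        (∀ p q : ℂ, (p, q) ≠ 0 → ∃ F : TestSpace W →L[ℂ] ℂ,
          IsGeneralizedEigenvector (H : TestSpace W →ₗ[ℂ] TestSpace W) r F ∧
          ∀ φ : TestSpace W, F φ = ∫ x, φ.toL2 x * (p * psiP α r x + q * psiN α r x)) ∧
        (∀ F : TestSpace W →L[ℂ] ℂ,
          IsGeneralizedEigenvector (H : TestSpace W →ₗ[ℂ] TestSpace W) r F →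
          ∃! pq : ℂ × ℂ, ∀ φ : TestSpace W,
            F φ = ∫ x, φ.toL2 x * (pq.1 * psiP α r x + pq.2 * psiN α r x)) := by
  subst hW
  refine ⟨fun f hf => ?_, coeFn_opU, dense_domain hω ha hc, testOp _ ω,
    isInvertedOscillator_testOp hω ha hc, opU_W_testOp _ ω, generalizedSpectrum_testOp hω,
    kummer_functionals_eigenspace hω ha hc⟩
  have h00 : oscMatrix ω a hω ha 0 0 = a := rfl
  have h01 : oscMatrix ω a hω ha 0 1 = a / ω := rfl
  have h11 : oscMatrix ω a hω ha 1 1 = 1 / (2 * a) := rfl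
  have h := opW_coeFn (oscMatrix ω a hω ha) (oscMatrix_ne ω a hω ha) c hc f hf
  rw [h00, h01, h11] at h
  push_cast at h
  exact h
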